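/- Let $0<\beta<2$. A state is a family $f=(f_n)_{n\ge 2}$ of functions $f_n:[0,\infty)\to\mathbb R$. Put $$N(f)=\sum_{n\ge2}\int_0^\infty f_n\,da,\quad A(f)=\sum_{n\ge2}\int_0^\infty a f_n(a)\,da,\quad P(f)=\sum_{n\ge2}(n-6)\int_0^\infty f_n\,da,$$ $$(Jf)_2=3(\beta+1)f_3-2\beta f_2,\qquad (Jf)_n=(\beta+1)(n+1)f_{n+1}-(2\beta+1)nf_n+\beta(n-1)f_{n-1}\quad(n>2),$$ $$\Gamma(f)=\frac{\Gamma_N(f)}{\Gamma_D(f)},\quad \Gamma_N(f)=\sum_{n\ge2}(n-6)^2f_n(0),\quad \Gamma_D(f)=\sum_{n\ge2}n\int_0^\infty f_n\,da-2(\beta+1)\int_0^\infty f_2\,da,$$ $$\phi_n=\frac1{n\beta}\Big(\frac{\beta}{1+\beta}\Big)^n,\quad \|f\|_\beta=\sup_{n\ge2}\sup_{a\ge0}\frac{|f_n(a)|}{\phi_n},\quad \|f\|_L=\sum_{n\ge2}\int_0^\infty(n+a)|f_n(a)|\,da.$$ Let $Y$ be the set of states with all $f_n$ continuous on $[0,\infty)$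 and $\|f\|_\beta+\|f\|_L<\infty$. A state $f\in Y$ is admissible if $f_n\ge0$ for all $n\ge2$, $A(f)>0$, $P(f)=0$, and $f_n(0)=0$ for all $n>6$. It is regular if (i) for every $\varepsilon>0$ there is $\bar\delta>0$ such that $\|f(\cdot+\delta)-f\|_\beta\le\varepsilon$ for all $0\le\delta\le\bar\delta$, and (ii) there are constants $d>0$ and $D$ such that for all $\alpha\ge0$ $$\sum_{n\ge2}\int_\alpha^\infty af_n(a)\,da+\sum_{n\ge2,\;n\ge\lfloor\alpha\rfloor+1}n\int_0^\infty f_n(a)\,da\le De^{-d\alpha}.$$ For $t\ge0$ let $(\mathcal T(t)g)_n(a)=g_n(a-(n-6)t)$ if $a\ge(n-6)t$ and $(\mathcal T(t)g)_n(a)=0$ otherwise. A mild solution on $[0,T]$ with initial data $g$, of $$\partial_tf_n+(n-6)\partial_af_n=\Gamma(f(t))(Jf)_n,\qquad f_n(a,0)=g_n(a)\ (n\ge2),\qquad f_n(0,t)=0\ (n>6),$$ is a map $f:[0,T]\to Y$ with $\sup_{0\le t\le T}\|f(t)\|_\beta<\infty$, such that $t\mapsto f(t)$ is continuous with respect to $\|\cdot\|_L$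 and, for each $n\ge2$, $t\mapsto f_n(\cdot,t)$ is continuous with respect to the supremum norm; such that $\Gamma_D(f(t))\ne0$ for all $t\in[0,T]$ and the initial and boundary conditions hold; and such that, for all $t\in[0,T]$, $n\ge2$ and $a\ge0$, $$f_n(a,t)=(\mathcal T(t)g)_n(a)+\int_0^t\Big(\mathcal T(t-s)\big[\Gamma(f(s))\,Jf(s)\big]\Big)_n(a)\,ds.$$ Theorem. Let $g\in Y$ be admissible and regular. Then there is $f:[0,\infty)\to Y$ that is a mild solution with initial data $g$ on $[0,T]$ for every $T>0$. It is unique: for every $T>0$, every mild solution on $[0,T]$ with initial data $g$ coincides with $f$ on $[0,T]$. Moreover $A(f(t))=A(g)$ for all $t\ge0$, the function $t\mapsto N(f(t))$ is non-increasing on $[0,\infty)$, and for every $t\ge0$ the state $f(t)$ is admissible and regular and satisfies $$\sum_{n\ge2}(1+n)\int_0^\infty(1+a)|f_n(a,t)|\,da<\infty\qquad\text{and}\qquad\|f(t)\|_\beta\le\|g\|_\beta .$$ -/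

import Mathlib

open Set Filter Topology MeasureTheory
open scoped ENNReal NNReal

noncomputable section

namespace GrainGrowth

/-- A state `f = (f_n(a))`: `f n a` is the density of grains with `n` edges and area `a`.
Only the values with `n ≥ 2` and `a ≥ 0` are meaningful. All sums over the topological
classes `n ≥ 2` below are written with `n = k + 2`, `k : ℕ`. -/
abbrev State : Type := ℕ → ℝ → ℝ

/-- The number of grains `N(f) = ∑_{n ≥ 2} ∫_0^∞ f_n(a) da`. -/
def numGrains (f : State) : ℝ :=
  ∑' k : ℕ, ∫ a in Ioi (0 : ℝ), f (k + 2) a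

/-- The total area `A(f) = ∑_{n ≥ 2} ∫_0^∞ a f_n(a) da`. -/
def area (f : State) : ℝ :=
  ∑' k : ℕ, ∫ a in Ioi (0 : ℝ), a * f (k + 2) a

/-- The polyhedral defect `P(f) = ∑_{n ≥ 2} (n - 6) ∫_0^∞ f_n(a) da`. -/
def polyDefect (f : State) : ℝ :=
  ∑' k : ℕ, (((k + 2 : ℕ) : ℝ) - 6) * ∫ a in Ioi (0 : ℝ), f (k + 2) a

/-- The coupling operator: `(Jf)_2 = 3(β+1) f_3 - 2β f_2` and
`(Jf)_n = (β+1)(n+1) f_{n+1} - (2β+1) n f_n + β (n-1) f_{n-1}` for `n > 2`. -/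
def coupling (β : ℝ) (f : State) : State := fun n a =>
  if n = 2 then 3 * (β + 1) * f 3 a - 2 * β * f 2 a
  else (β + 1) * ((n : ℝ) + 1) * f (n + 1) a - (2 * β + 1) * (n : ℝ) * f n a
    + β * ((n : ℝ) - 1) * f (n - 1) a

/-- `Γ_N(f) = ∑_{n ≥ 2} (n - 6)² f_n(0)`. -/
def weightNum (f : State) : ℝ :=
  ∑' k : ℕ, (((k + 2 : ℕ) : ℝ) - 6) ^ 2 * f (k + 2) 0

/-- `Γ_D(f) = ∑_{n ≥ 2} n ∫_0^∞ f_n(a) da - 2 (β + 1) ∫_0^∞ f_2(a) da`. -/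
def weightDen (β : ℝ) (f : State) : ℝ :=
  (∑' k : ℕ, ((k + 2 : ℕ) : ℝ) * ∫ a in Ioi (0 : ℝ), f (k + 2) a)
    - 2 * (β + 1) * ∫ a in Ioi (0 : ℝ), f 2 a

/-- The coupling weight `Γ(f) = Γ_N(f) / Γ_D(f)`. -/
def weight (β : ℝ) (f : State) : ℝ := weightNum f / weightDen β f

/-- `φ_n = (1 / (n β)) (β / (1 + β))^n`. -/
def phi (β : ℝ) (n : ℕ) : ℝ := 1 / ((n : ℝ) * β) * (β / (1 + β)) ^ n

/-- `‖f‖_β = sup_{n ≥ 2} sup_{a ≥ 0} |f_n(a)| / φ_n`, with values in `[0, ∞]`. -/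
def betaNorm (β : ℝ) (f : State) : ℝ≥0∞ :=
  ⨆ (n : ℕ) (_ : 2 ≤ n) (a : ℝ) (_ : 0 ≤ a), ENNReal.ofReal (|f n a| / phi β n)

/-- `∑_{n ≥ 2} ∫_0^∞ (n + a) |f_n(a)| da`, with values in `[0, ∞]`. -/
def lNorm (f : State) : ℝ≥0∞ :=
  ∑' k : ℕ, ∫⁻ a in Ioi (0 : ℝ), ENNReal.ofReal ((((k + 2 : ℕ) : ℝ) + a) * |f (k + 2) a|)

/-- `∑_{n ≥ 2} (1 + n) ∫_0^∞ (1 + a) |f_n(a)| da`, with values in `[0, ∞]`. -/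
def productMoment (f : State) : ℝ≥0∞ :=
  ∑' k : ℕ, ENNReal.ofReal (1 + ((k + 2 : ℕ) : ℝ)) *
    ∫⁻ a in Ioi (0 : ℝ), ENNReal.ofReal ((1 + a) * |f (k + 2) a|)

/-- The state space `Y`: the components are continuous on `[0, ∞)` and both norms are finite. -/
structure MemY (β : ℝ) (f : State) : Prop where
  continuousOn : ∀ n, 2 ≤ n → ContinuousOn (f n) (Ici 0)
  betaNorm_lt_top : betaNorm β f < ⊤
  lNorm_lt_top : lNorm f < ⊤

/-- Admissible states. -/
structure IsAdmissible (β : ℝ) (f : State) : Prop where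
  memY : MemY β f
  nonneg : ∀ n, 2 ≤ n → ∀ a, 0 ≤ a → 0 ≤ f n a
  area_pos : 0 < area f
  polyhedral : polyDefect f = 0
  boundary : ∀ n, 6 < n → f n 0 = 0

/-- The quasi-complement
`M^⊥(f, α) = ∑_{n ≥ 2} ∫_α^∞ a f_n(a) da + ∑_{n ≥ 2, n ≥ ⌊α⌋ + 1} n ∫_0^∞ f_n(a) da`. -/
def quasiCompl (f : State) (α : ℝ) : ℝ :=
  (∑' k : ℕ, ∫ a in Ioi α, a * f (k + 2) a)
    + ∑' k : ℕ, if ⌊α⌋₊ + 1 ≤ k + 2 then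
        ((k + 2 : ℕ) : ℝ) * ∫ a in Ioi (0 : ℝ), f (k + 2) a else 0

/-- The left shift `(S_δ f)_n(a) = f_n(a + δ)`. -/
def leftShift (δ : ℝ) (f : State) : State := fun n a => f n (a + δ)

/-- Regular states: equicontinuous in `a` with respect to `‖·‖_β`, and rapidly decreasing. -/
structure IsRegular (β : ℝ) (f : State) : Prop where
  equicontinuous : ∀ ε : ℝ, 0 < ε → ∃ δ₀ : ℝ, 0 < δ₀ ∧
    ∀ δ : ℝ, 0 ≤ δ → δ ≤ δ₀ → betaNorm β (leftShift δ f - f) ≤ ENNReal.ofReal ε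
  rapidlyDecreasing : ∃ d D : ℝ, 0 < d ∧
    ∀ α : ℝ, 0 ≤ α → quasiCompl f α ≤ D * Real.exp (-d * α)

/-- The transport group: `(𝒯(t) g)_n(a) = g_n(a - (n - 6) t)` if `a ≥ (n - 6) t`, and `0`
otherwise. For `n ≤ 6` and `a, t ≥ 0` the first case always applies. -/
def transport (t : ℝ) (g : State) : State := fun n a =>
  if ((n : ℝ) - 6) * t ≤ a then g n (a - ((n : ℝ) - 6) * t) else 0

/-- The solution space on `[0, T]`: curves in `Y` that are bounded in `‖·‖_β`, all of whose
components are continuous in time with respect to the supremum norm in `a`, and that are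
continuous in time with respect to `lNorm`. -/
structure MemSolutionSpace (β T : ℝ) (f : ℝ → State) : Prop where
  memY : ∀ t ∈ Icc 0 T, MemY β (f t)
  bounded : ∃ C : ℝ≥0, ∀ t ∈ Icc 0 T, betaNorm β (f t) ≤ C
  continuous_comp : ∀ n, 2 ≤ n → ∀ t ∈ Icc 0 T,
    TendstoUniformlyOn (fun s => f s n) (f t n) (𝓝[Icc 0 T] t) (Ici 0)
  continuous_lNorm : ∀ t ∈ Icc 0 T,
    Tendsto (fun s => lNorm (f s - f t)) (𝓝[Icc 0 T] t) (𝓝 0)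

/-- `f` is a mild solution on `[0, T]` of
`∂_t f_n + (n - 6) ∂_a f_n = Γ(f(t)) (Jf)_n`, `f_n(·, 0) = g_n` for `n ≥ 2`,
`f_n(0, t) = 0` for `n > 6`. The weight has to be well defined along the solution. -/
structure IsMildSolution (β T : ℝ) (g : State) (f : ℝ → State) : Prop where
  memSolutionSpace : MemSolutionSpace β T f
  weightDen_ne_zero : ∀ t ∈ Icc 0 T, weightDen β (f t) ≠ 0
  initial : ∀ n, 2 ≤ n → ∀ a, 0 ≤ a → f 0 n a = g n a
  boundary : ∀ n, 6 < n → ∀ t ∈ Icc 0 T, f t n 0 = 0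
  duhamel : ∀ t ∈ Icc 0 T, ∀ n, 2 ≤ n → ∀ a, 0 ≤ a →
    f t n a = transport t g n a
      + ∫ s in (0 : ℝ)..t, transport (t - s) (weight β (f s) • coupling β (f s)) n a

end GrainGrowth

end

/-!
The equation is transport with speed `n - 6` in the area, coupled by the operator `J` whose weight
`Γ` depends on the whole state. Two algebraic facts about `J` carry the estimates. Its off-diagonal
entries are nonnegative, and `φ` is annihilated by it (`gain_phi`); treating the diagonal part as a
damping along characteristics, the comparison principle `Solves.abs_le` gives `0 ≤ f ≤ M φ` with
`M = ‖g‖_β`, whatever the nonnegative weight is. Moreover the sequences `ψ(ρ) = ρ ^ n / n` with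
`ratio β ≤ ρ ≤ 1` are supersolutions up to a bounded term (`gain_psi_le`), strict ones for
`ratio β < ρ < 1` (`exists_gain_psi_le`). Since grains of class `n` move outwards with speed less than `n`, the
exponential moment of class `n` stays below a multiple of `e^{pnt} ψ(ρ)_n = ψ(ρ e^{pt})_n` as long
as `ρ e^{pt} ≤ 1`; this propagates exponential tails, which the initial state has by regularity and
by interpolation with the bound `M φ` (`Data.exists_moment`).

The denominator of `Γ` could vanish, so the equation is first solved with the denominator cut off
from below at `c₀ e^{-2t}`. One step of the iteration solves the damped linear equation with the
gain of the previous curve as source. It preserves all a priori bounds (`Curve.step`), and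
strictness of the supersolution makes it a contraction in the norms weighted by `e^{Kt} ψ(ρ)_n`,
with `K` large (`Solves.contract`, `exists_contraction`): although `J` is unbounded, its gain is
dominated by the damping, with a factor `θ < 1`, up to a bounded term that is absorbed by `K`. The
fixed point is a global solution (`exists_fixed_point`).

The cut-off turns out to be inactive for suitable `c₀`, by the balance laws for moments
(`Solves.moment_identity`, `ClippedSolution.tsum_mom_eq`). As clipping only decreases the weight,
the polyhedral defect stays nonnegative (`ClippedSolution.polyDefect_nonneg`); it is the time
derivative of the area, which is thus at least its initial value. The second moment of the area
grows at most like `e^{2t}`, independently of the weight (`ClippedSolution.secondMoment_le`), so by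
the Cauchy-Schwarz inequality the number of grains is at least a multiple of `e^{-2t}`
(`ClippedSolution.numGrains_ge`). Finally the denominator is at least `(4 - 2β)` times the number
of grains when the defect is nonnegative (`ClippedSolution.weightDen_ge_numGrains`), and here
`β < 2` enters. With the weight unclipped the defect is conserved, hence zero, the area is constant, and
grains are lost only at `a = 0`. Uniqueness is the same contraction estimate, applied to the
difference with an arbitrary mild solution (`ClippedSolution.eq_of_isMildSolution`).
-/

namespace GrainGrowth

/-! ### The coupling operator on sequences -/

/-- The ratio `β / (1 + β)` of the geometric sequence in the equilibrium `φ`. -/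
noncomputable def ratio (β : ℝ) : ℝ := β / (1 + β)

/-- The loss rate: minus the diagonal entry of the coupling operator. -/
noncomputable def lam (β : ℝ) (n : ℕ) : ℝ := if n = 2 then 2 * β else (2 * β + 1) * n

/-- The gain part of the coupling operator: its off-diagonal entries, all of them nonnegative. -/
noncomputable def gain (β : ℝ) (u : ℕ → ℝ) (n : ℕ) : ℝ :=
  (β + 1) * ((n : ℝ) + 1) * u (n + 1) + if n = 2 then 0 else β * ((n : ℝ) - 1) * u (n - 1)

/-- The comparison sequences `ρ ^ n / n`; the equilibrium `φ` is `β⁻¹` times the one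
with `ρ = ratio β`. -/
noncomputable def psi (ρ : ℝ) (n : ℕ) : ℝ := ρ ^ n / n

lemma coupling_eq (β : ℝ) (f : State) (n : ℕ) (a : ℝ) :
    coupling β f n a = gain β (fun m => f m a) n - lam β n * f n a := by
  unfold coupling gain lam
  split_ifs with h
  · subst h; push_cast; ring_nf
  · ring

section
variable {β : ℝ}

lemma ratio_pos (hβ : 0 < β) : 0 < ratio β := by unfold ratio; positivity

lemma ratio_lt_one (hβ : 0 < β) : ratio β < 1 := by
  unfold ratio; rw [div_lt_one (by positivity)]; linarith

lemma mul_ratio (hβ : 0 < β) : (β + 1) * ratio β = β := by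
  unfold ratio; field_simp; ring

lemma phi_eq (n : ℕ) : phi β n = psi (ratio β) n / β := by
  unfold phi psi ratio
  rw [one_div, mul_inv, div_eq_mul_inv, div_eq_mul_inv (_ ^ _)]; ring

lemma psi_pos {ρ : ℝ} (hρ : 0 < ρ) {n : ℕ} (hn : 2 ≤ n) : 0 < psi ρ n := by
  have : (0 : ℝ) < n := by exact_mod_cast (by omega : 0 < n)
  unfold psi; positivity

lemma psi_nonneg {ρ : ℝ} (hρ : 0 ≤ ρ) (n : ℕ) : 0 ≤ psi ρ n := by unfold psi; positivity

lemma mul_psi (ρ : ℝ) {n : ℕ} (hn : 1 ≤ n) : (n : ℝ) * psi ρ n = ρ ^ n := by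
  have : (0 : ℝ) < n := by exact_mod_cast hn
  unfold psi; field_simp

lemma phi_pos (hβ : 0 < β) {n : ℕ} (hn : 2 ≤ n) : 0 < phi β n := by
  rw [phi_eq]; exact div_pos (psi_pos (ratio_pos hβ) hn) hβ

lemma lam_nonneg (hβ : 0 < β) (n : ℕ) : 0 ≤ lam β n := by
  unfold lam; split_ifs <;> positivity

lemma lam_le (hβ : 0 < β) (n : ℕ) : lam β n ≤ (2 * β + 1) * n := by
  unfold lam; split_ifs with h
  · subst h; push_cast; nlinarith
  · exact le_rfl

lemma gain_mono (hβ : 0 < β) {u v : ℕ → ℝ} {n : ℕ} (hn : 2 ≤ n)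
    (h : ∀ m, 2 ≤ m → u m ≤ v m) : gain β u n ≤ gain β v n := by
  have h1 : (2 : ℝ) ≤ n := by exact_mod_cast hn
  have h2 := h (n + 1) (by omega)
  unfold gain
  split_ifs with h3
  · gcongr
  · have h4 := h (n - 1) (by omega)
    have h5 : 0 ≤ β * ((n : ℝ) - 1) := mul_nonneg hβ.le (by linarith)
    gcongr

@[simp] lemma gain_zero (n : ℕ) : gain β (fun _ => 0) n = 0 := by simp [gain]

lemma gain_nonneg (hβ : 0 < β) {u : ℕ → ℝ} {n : ℕ} (hn : 2 ≤ n)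
    (h : ∀ m, 2 ≤ m → 0 ≤ u m) : 0 ≤ gain β u n := by
  simpa using gain_mono (u := fun _ => 0) hβ hn h

lemma gain_sub (u v : ℕ → ℝ) (n : ℕ) :
    gain β (fun m => u m - v m) n = gain β u n - gain β v n := by
  unfold gain; split_ifs <;> ring

lemma gain_const_mul (c : ℝ) (u : ℕ → ℝ) (n : ℕ) :
    gain β (fun m => c * u m) n = c * gain β u n := by
  unfold gain; split_ifs <;> ring

lemma gain_neg (u : ℕ → ℝ) (n : ℕ) : gain β (fun m => - u m) n = - gain β u n := by
  unfold gain; split_ifs <;> ring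

lemma abs_gain_le (hβ : 0 < β) {u v : ℕ → ℝ} {n : ℕ} (hn : 2 ≤ n)
    (h : ∀ m, 2 ≤ m → |u m| ≤ v m) : |gain β u n| ≤ gain β v n := by
  rw [abs_le]
  constructor
  · rw [← gain_neg]
    exact gain_mono hβ hn fun m hm => (abs_le.1 (h m hm)).1
  · exact gain_mono hβ hn fun m hm => (abs_le.1 (h m hm)).2

lemma gain_psi_two (ρ : ℝ) : gain β (psi ρ) 2 = (β + 1) * ρ ^ 3 := by
  simp [gain, psi]; ring

lemma gain_psi_of_ne (hβ : 0 < β) {ρ : ℝ} (hρ : 0 < ρ) {n : ℕ} (hn : 2 ≤ n) (h2 : n ≠ 2) :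
    gain β (psi ρ) n = (((β + 1) * ρ ^ 2 + β) / ((2 * β + 1) * ρ)) * (lam β n * psi ρ n) := by
  have h0 : 2 * β + 1 ≠ 0 := by positivity
  obtain ⟨k, rfl⟩ : ∃ k, n = k + 2 := ⟨n - 2, by omega⟩
  have hk : (0 : ℝ) < (k : ℝ) + 1 := by positivity
  have hk3 : ((k : ℝ) + 2 + 1) ≠ 0 := by positivity
  have e1 : ((k + 2 + 1 : ℕ) : ℝ) * psi ρ (k + 2 + 1) = ρ ^ (k + 3) := mul_psi ρ (by omega)
  have e2 : ((k + 1 : ℕ) : ℝ) * psi ρ (k + 1) = ρ ^ (k + 1) := mul_psi ρ (by omega)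
  have e3 : ((k + 2 : ℕ) : ℝ) * psi ρ (k + 2) = ρ ^ (k + 2) := mul_psi ρ (by omega)
  simp only [gain, lam, if_neg h2]
  rw [show k + 2 - 1 = k + 1 from rfl]
  have e4 : (β + 1) * (((k + 2 : ℕ) : ℝ) + 1) * psi ρ (k + 2 + 1) = (β + 1) * ρ ^ (k + 3) := by
    rw [← e1]; push_cast; ring
  have e5 : β * (((k + 2 : ℕ) : ℝ) - 1) * psi ρ (k + 1) = β * ρ ^ (k + 1) := by
    rw [← e2]; push_cast; ring
  rw [e4, e5, mul_assoc (2 * β + 1), e3]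
  rw [div_mul_eq_mul_div, eq_div_iff (by positivity)]
  ring

/-- `φ` is an equilibrium of the coupling operator. -/
lemma gain_phi (hβ : 0 < β) {n : ℕ} (hn : 2 ≤ n) : gain β (phi β) n = lam β n * phi β n := by
  have hr := mul_ratio hβ
  have hr0 := ratio_pos hβ
  have e : phi β = fun m => β⁻¹ * psi (ratio β) m := by
    funext m; rw [phi_eq]; ring
  rw [e, gain_const_mul]
  by_cases h2 : n = 2
  · subst h2
    rw [gain_psi_two]
    simp only [lam, psi, if_true]
    push_cast
    rw [show (β + 1) * ratio β ^ 3 = ((β + 1) * ratio β) * ratio β ^ 2 by ring, hr]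
    ring
  · have h := gain_psi_of_ne hβ hr0 hn h2
    · have : ((β + 1) * ratio β ^ 2 + β) / ((2 * β + 1) * ratio β) = 1 := by
        rw [div_eq_one_iff_eq (by positivity)]
        have : (β + 1) * ratio β ^ 2 = β * ratio β := by
          rw [pow_two, ← mul_assoc, hr]
        nlinarith
      rw [h, this]; ring

/-- For `ratio β ≤ ρ ≤ 1` the sequence `ψ(ρ)` is a supersolution of the coupling operator,
up to a term at `n = 2`. -/
lemma gain_psi_le (hβ : 0 < β) {ρ : ℝ} (h1 : ratio β ≤ ρ) (h2 : ρ ≤ 1) {n : ℕ} (hn : 2 ≤ n) :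
    gain β (psi ρ) n ≤ (lam β n + 2 * (β + 1)) * psi ρ n := by
  have hr := mul_ratio hβ
  have hρ : 0 < ρ := (ratio_pos hβ).trans_le h1
  have hψ := psi_pos hρ hn
  by_cases h3 : n = 2
  · subst h3
    rw [gain_psi_two]
    simp only [lam, psi, if_true]
    push_cast
    have : 0 ≤ ρ ^ 2 * (1 - ρ) := mul_nonneg (by positivity) (by linarith)
    nlinarith [mul_nonneg hβ.le this, mul_nonneg hβ.le (sq_nonneg ρ)]
  · have h := gain_psi_of_ne hβ hρ hn h3
    · have : ((β + 1) * ρ ^ 2 + β) / ((2 * β + 1) * ρ) ≤ 1 := by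
        rw [div_le_one (by positivity)]
        have : 0 ≤ (1 - ρ) * ((β + 1) * ρ - β) :=
          mul_nonneg (by linarith) (by nlinarith)
        nlinarith
      rw [h]
      have hl : 0 ≤ lam β n * psi ρ n := mul_nonneg (lam_nonneg hβ n) hψ.le
      nlinarith [mul_le_mul_of_nonneg_right this hl]

/-- For `ratio β < ρ < 1` the supersolution `ψ(ρ)` is strict. -/
lemma exists_gain_psi_le (hβ : 0 < β) {ρ : ℝ} (h1 : ratio β < ρ) (h2 : ρ < 1) :
    ∃ θ : ℝ, 0 < θ ∧ θ < 1 ∧ ∀ n, 2 ≤ n →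
      gain β (psi ρ) n ≤ (θ * lam β n + 2 * (β + 1)) * psi ρ n := by
  have hr := mul_ratio hβ
  have hρ : 0 < ρ := (ratio_pos hβ).trans h1
  refine ⟨((β + 1) * ρ ^ 2 + β) / ((2 * β + 1) * ρ), by positivity, ?_, fun n hn => ?_⟩
  · rw [div_lt_one (by positivity)]
    have : 0 < (1 - ρ) * ((β + 1) * ρ - β) :=
      mul_pos (by linarith) (by nlinarith)
    nlinarith
  have hψ := psi_pos hρ hn
  have hl : 0 ≤ lam β n * psi ρ n := mul_nonneg (lam_nonneg hβ n) hψ.le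
  by_cases h3 : n = 2
  · have := gain_psi_le hβ h1.le h2.le hn
    subst h3
    rw [gain_psi_two]
    have h4 : (β + 1) * ρ ^ 3 ≤ 2 * (β + 1) * psi ρ 2 := by
      simp only [psi]; push_cast
      have : 0 ≤ ρ ^ 2 * (1 - ρ) := mul_nonneg (by positivity) (by linarith)
      nlinarith [mul_nonneg hβ.le this]
    have h5 : 0 ≤ ((β + 1) * ρ ^ 2 + β) / ((2 * β + 1) * ρ) * (lam β 2 * psi ρ 2) := by
      positivity
    nlinarith
  · have h := gain_psi_of_ne hβ hρ hn h3
    · rw [h]; nlinarith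

/-- A polynomial factor is absorbed by enlarging the ratio of the geometric sequence. -/
lemma exists_pow_mul_le {x y : ℝ} (hx : 0 ≤ x) (hxy : x < y) (k : ℕ) :
    ∃ C : ℝ, 0 < C ∧ ∀ n : ℕ, (n : ℝ) ^ k * x ^ n ≤ C * y ^ n := by
  have hy : 0 < y := hx.trans_lt hxy
  have ht := tendsto_pow_const_mul_const_pow_of_lt_one k (div_nonneg hx hy.le)
    ((div_lt_one hy).2 hxy)
  obtain ⟨C, hC⟩ := ht.bddAbove_range
  refine ⟨max C 1, by positivity, fun n => ?_⟩
  have h : (n : ℝ) ^ k * (x / y) ^ n ≤ C := hC ⟨n, rfl⟩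
  rw [div_pow, mul_div_assoc', div_le_iff₀ (by positivity)] at h
  exact h.trans (by gcongr; exact le_max_left _ _)

lemma exists_psi_le {x y : ℝ} (hx : 0 ≤ x) (hxy : x < y) (k : ℕ) :
    ∃ C : ℝ, 0 < C ∧ ∀ n : ℕ, (n : ℝ) ^ k * psi x n ≤ C * psi y n := by
  obtain ⟨C, hC, h⟩ := exists_pow_mul_le hx hxy k
  refine ⟨C, hC, fun n => ?_⟩
  unfold psi
  rw [mul_div_assoc', mul_div_assoc']
  exact div_le_div_of_nonneg_right (h n) (Nat.cast_nonneg n)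

/-- The coupling operator conserves the number of grains. -/
lemma hasSum_gain_sub {u : ℕ → ℝ} (hu : Summable fun k : ℕ => ((k + 2 : ℕ) : ℝ) * u (k + 2)) :
    HasSum (fun k : ℕ => gain β u (k + 2) - lam β (k + 2) * u (k + 2)) 0 := by
  set v : ℕ → ℝ := fun k => ((k + 2 : ℕ) : ℝ) * u (k + 2) with hv
  -- the coupling operator is the difference of the fluxes between neighbouring classes
  set j : ℕ → ℝ := fun k => (β + 1) * v (k + 1) - β * v k with hj
  have e : ∀ k, gain β u (k + 2) - lam β (k + 2) * u (k + 2) =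
      j k - (if k = 0 then 0 else j (k - 1)) := by
    intro k
    rcases k with _ | k
    · simp only [gain, lam, hj, hv]; norm_num; ring
    · have : k + 1 + 2 ≠ 2 := by omega
      simp only [gain, lam, hj, hv, if_neg this, Nat.add_eq_zero_iff, one_ne_zero, and_false,
        if_false, Nat.add_sub_cancel]
      rw [show k + 1 + 2 - 1 = k + 2 by omega, show k + 1 + 2 + 1 = k + 1 + 1 + 2 by omega]
      push_cast; ring
  have hs : Summable j :=
    (((summable_nat_add_iff 1).2 hu).mul_left (β + 1)).sub (hu.mul_left β)
  have h2 : HasSum (fun k => if k = 0 then 0 else j (k - 1)) (∑' k, j k) := by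
    rw [← hasSum_nat_add_iff' 1]
    simpa using hs.hasSum
  simp_rw [e]
  simpa using hs.hasSum.sub h2

/-- The first moment of the coupling operator with respect to the number of edges. Its negative is
the denominator of the coupling weight, the term with `u 2` being due to the boundary class. -/
lemma hasSum_mul_gain_sub {u : ℕ → ℝ}
    (hu : Summable fun k : ℕ => ((k + 2 : ℕ) : ℝ) ^ 2 * u (k + 2)) :
    HasSum (fun k : ℕ => ((k + 2 : ℕ) : ℝ) * (gain β u (k + 2) - lam β (k + 2) * u (k + 2)))
      (-(∑' k : ℕ, ((k + 2 : ℕ) : ℝ) * u (k + 2)) + 2 * (β + 1) * u 2) := by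
  set v : ℕ → ℝ := fun k => ((k + 2 : ℕ) : ℝ) * u (k + 2) with hv
  have hu1 : Summable fun k : ℕ => ((k + 2 : ℕ) : ℝ) * v k := by
    refine hu.congr fun k => ?_
    simp only [hv]; ring
  have hv1 : Summable v := by
    refine Summable.of_norm_bounded hu1.norm fun k => ?_
    rw [norm_mul (_ : ℝ) (v k)]
    have : (1 : ℝ) ≤ ‖((k + 2 : ℕ) : ℝ)‖ := by
      rw [Real.norm_natCast]; exact_mod_cast (by omega : 1 ≤ k + 2)
    nlinarith [norm_nonneg (v k)]
  set j : ℕ → ℝ := fun k => (β + 1) * v (k + 1) - β * v k with hj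
  have e : ∀ k, ((k + 2 : ℕ) : ℝ) * (gain β u (k + 2) - lam β (k + 2) * u (k + 2)) =
      ((k + 2 : ℕ) : ℝ) * j k - (if k = 0 then 0 else ((k + 2 : ℕ) : ℝ) * j (k - 1)) := by
    intro k
    rcases k with _ | k
    · simp only [gain, lam, hj, hv]; norm_num; ring
    · have : k + 1 + 2 ≠ 2 := by omega
      simp only [gain, lam, hj, hv, if_neg this, Nat.add_eq_zero_iff, one_ne_zero, and_false,
        if_false, Nat.add_sub_cancel]
      rw [show k + 1 + 2 - 1 = k + 2 by omega, show k + 1 + 2 + 1 = k + 1 + 1 + 2 by omega]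
      push_cast; ring
  have hs : Summable j :=
    (((summable_nat_add_iff 1).2 hv1).mul_left (β + 1)).sub (hv1.mul_left β)
  have hs1 : Summable fun k : ℕ => ((k + 2 : ℕ) : ℝ) * j k := by
    have h1 : Summable fun k : ℕ => ((k + 1 + 2 : ℕ) : ℝ) * v (k + 1) - v (k + 1) :=
      ((summable_nat_add_iff 1).2 hu1).sub ((summable_nat_add_iff 1).2 hv1)
    refine ((h1.mul_left (β + 1)).sub (hu1.mul_left β)).congr fun k => ?_
    simp only [hj]; push_cast; ring
  have hs2 : Summable fun k : ℕ => ((k + 1 + 2 : ℕ) : ℝ) * j k := by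
    refine (hs1.add hs).congr fun k => ?_
    push_cast; ring
  have h2 : HasSum (fun k => if k = 0 then 0 else ((k + 2 : ℕ) : ℝ) * j (k - 1))
      (∑' k : ℕ, ((k + 1 + 2 : ℕ) : ℝ) * j k) := by
    rw [← hasSum_nat_add_iff' 1]
    simpa using hs2.hasSum
  simp_rw [e]
  have h3 : (∑' k : ℕ, ((k + 1 + 2 : ℕ) : ℝ) * j k) =
      (∑' k : ℕ, ((k + 2 : ℕ) : ℝ) * j k) + ∑' k, j k := by
    rw [← hs1.tsum_add hs]
    exact tsum_congr fun k => by push_cast; ring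
  have h4 : ∑' k, j k = (β + 1) * (∑' k, v k - v 0) - β * ∑' k, v k := by
    simp only [hj]
    rw [(((summable_nat_add_iff 1).2 hv1).mul_left (β + 1)).tsum_sub (hv1.mul_left β),
      tsum_mul_left, tsum_mul_left, hv1.tsum_eq_zero_add]
    ring
  have h5 := hs1.hasSum.sub h2
  rw [h3, h4] at h5
  have h6 : v 0 = 2 * u 2 := by simp [hv]
  rw [h6] at h5
  have h7 : -(∑' k, v k) + 2 * (β + 1) * u 2 = (∑' k : ℕ, ((k + 2 : ℕ) : ℝ) * j k) -
      ((∑' k : ℕ, ((k + 2 : ℕ) : ℝ) * j k) +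
        ((β + 1) * (∑' k, v k - 2 * u 2) - β * ∑' k, v k)) := by ring
  rw [h7]
  exact h5

end

/-! ### Damped transport along characteristics -/

/-- A solution of `y' = -κ y + q` also solves `y' = -κ' y + (q + (κ' - κ) y)`; both equations are in
integrated form, with `K` and `K'` antiderivatives of `κ` and `κ'`. -/
lemma variation_of_constants {K κ K' κ' q y : ℝ → ℝ} (hK : ∀ s, HasDerivAt K (κ s) s)
    (hK' : ∀ s, HasDerivAt K' (κ' s) s) (hκ : Continuous κ) (hκ' : Continuous κ')
    (hq : Continuous q) {τ t : ℝ} (hτ : τ ≤ t)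
    (hy : ∀ s ∈ Icc τ t, y s = Real.exp (K τ - K s) * y τ +
      ∫ x in τ..s, Real.exp (K x - K s) * q x) :
    y t = Real.exp (K' τ - K' t) * y τ +
      ∫ x in τ..t, Real.exp (K' x - K' t) * (q x + (κ' x - κ x) * y x) := by
  have hKc : Continuous K := continuous_iff_continuousAt.2 fun s => (hK s).continuousAt
  have hKc' : Continuous K' := continuous_iff_continuousAt.2 fun s => (hK' s).continuousAt
  obtain ⟨Y, hY⟩ : ∃ Y : ℝ → ℝ, ∀ s, Y s =
    Real.exp (-K s) * (Real.exp (K τ) * y τ + ∫ x in τ..s, Real.exp (K x) * q x) :=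
    ⟨_, fun _ => rfl⟩
  have hYy : ∀ s ∈ Icc τ t, y s = Y s := by
    intro s hs
    rw [hy s hs, hY]
    rw [mul_add, ← mul_assoc, ← Real.exp_add, ← intervalIntegral.integral_const_mul]
    congr 1
    · rw [neg_add_eq_sub]
    · congr 1; funext x
      rw [← mul_assoc, ← Real.exp_add, neg_add_eq_sub]
  have hYd : ∀ s, HasDerivAt Y (-κ s * Y s + q s) s := by
    intro s
    have h1 : HasDerivAt (fun s => Real.exp (-K s)) (Real.exp (-K s) * (-κ s)) s :=
      (hK s).neg.exp
    have h2 : HasDerivAt (fun s => Real.exp (K τ) * y τ + ∫ x in τ..s, Real.exp (K x) * q x)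
        (Real.exp (K s) * q s) s := by
      have hc : Continuous fun x => Real.exp (K x) * q x := by fun_prop
      exact (intervalIntegral.integral_hasDerivAt_right (hc.intervalIntegrable _ _)
        hc.stronglyMeasurable.stronglyMeasurableAtFilter hc.continuousAt).const_add _
    have : Real.exp (-K s) * Real.exp (K s) = 1 := by rw [← Real.exp_add]; simp
    rw [funext hY]
    refine (h1.mul h2).congr_deriv ?_
    rw [← mul_assoc, this]; ring
  have hYc : Continuous Y := continuous_iff_continuousAt.2 fun s => (hYd s).continuousAt
  have h3 : ∀ s, HasDerivAt (fun s => Real.exp (K' s) * Y s)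
      (Real.exp (K' s) * (q s + (κ' s - κ s) * Y s)) s := by
    intro s
    refine ((hK' s).exp.mul (hYd s)).congr_deriv ?_
    ring
  have h4 := intervalIntegral.integral_eq_sub_of_hasDerivAt (a := τ) (b := t)
    (fun s _ => h3 s) ((by fun_prop : Continuous _).intervalIntegrable _ _)
  have h5 : ∫ x in τ..t, Real.exp (K' x - K' t) * (q x + (κ' x - κ x) * y x) =
      Real.exp (-K' t) * ∫ x in τ..t, Real.exp (K' x) * (q x + (κ' x - κ x) * Y x) := by
    rw [← intervalIntegral.integral_const_mul]
    refine intervalIntegral.integral_congr fun x hx => ?_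
    rw [uIcc_of_le hτ] at hx
    simp only [hYy x hx]
    rw [← mul_assoc, ← Real.exp_add, neg_add_eq_sub]
  rw [h5, h4, hYy t ⟨hτ, le_rfl⟩, hYy τ ⟨le_rfl, hτ⟩, mul_sub, ← mul_assoc, ← mul_assoc,
    ← Real.exp_add, ← Real.exp_add, neg_add_cancel, Real.exp_zero, one_mul, neg_add_eq_sub]
  ring

/-- The function `e^{Cs}` solves `y' = -κ y + (κ + C) e^{Cs}`. It is the barrier in the comparison
arguments below. -/
lemma integral_exp_damped {K κ : ℝ → ℝ} (hK : ∀ s, HasDerivAt K (κ s) s) (hκ : Continuous κ)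
    (C τ t : ℝ) :
    ∫ s in τ..t, Real.exp (K s - K t) * ((κ s + C) * Real.exp (C * s)) =
      Real.exp (C * t) - Real.exp (K τ - K t) * Real.exp (C * τ) := by
  have hKc : Continuous K := continuous_iff_continuousAt.2 fun s => (hK s).continuousAt
  have h : ∀ s, HasDerivAt (fun s => Real.exp (K s - K t + C * s))
      (Real.exp (K s - K t) * ((κ s + C) * Real.exp (C * s))) s := by
    intro s
    have h1 : HasDerivAt (fun s => K s - K t + C * s) (κ s + C * 1) s :=
      ((hK s).sub_const (K t)).add ((hasDerivAt_id s).const_mul C)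
    convert h1.exp using 1
    rw [Real.exp_add]; ring
  rw [intervalIntegral.integral_eq_sub_of_hasDerivAt (fun s _ => h s)
    ((by fun_prop : Continuous _).intervalIntegrable _ _)]
  simp [Real.exp_add]

/-- Comparison of a solution of `y' = -κ y + q` with the supersolution `e^{Cs} B`. -/
lemma abs_damped_le {K κ q : ℝ → ℝ} (hK : ∀ s, HasDerivAt K (κ s) s) (hκ : Continuous κ)
    {B C τ t y₀ : ℝ} (hτ : τ ≤ t)
    (h0 : |y₀| ≤ Real.exp (C * τ) * B)
    (h : ∀ s ∈ Icc τ t, |q s| ≤ (κ s + C) * Real.exp (C * s) * B) :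
    |Real.exp (K τ - K t) * y₀ + ∫ s in τ..t, Real.exp (K s - K t) * q s| ≤
      Real.exp (C * t) * B := by
  have hKc : Continuous K := continuous_iff_continuousAt.2 fun s => (hK s).continuousAt
  have h1 : |∫ s in τ..t, Real.exp (K s - K t) * q s| ≤
      ∫ s in τ..t, Real.exp (K s - K t) * ((κ s + C) * Real.exp (C * s)) * B := by
    rw [← Real.norm_eq_abs]
    refine intervalIntegral.norm_integral_le_of_norm_le hτ (ae_of_all _ fun s hs => ?_)
      ((by fun_prop : Continuous _).intervalIntegrable _ _)
    rw [Real.norm_eq_abs, abs_mul, Real.abs_exp, mul_assoc]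
    exact mul_le_mul_of_nonneg_left (h s ⟨hs.1.le, hs.2⟩) (Real.exp_nonneg _)
  rw [intervalIntegral.integral_mul_const, integral_exp_damped hK hκ] at h1
  have h2 : |Real.exp (K τ - K t) * y₀| ≤ Real.exp (K τ - K t) * (Real.exp (C * τ) * B) := by
    rw [abs_mul, Real.abs_exp]
    exact mul_le_mul_of_nonneg_left h0 (Real.exp_nonneg _)
  calc _ ≤ _ := abs_add_le _ _
    _ ≤ _ := add_le_add h2 h1
    _ = _ := by ring

/-- A characteristic followed backwards from a point of the quadrant either reaches the
initial time or leaves through the boundary `a = 0`. -/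
lemma exists_entry {n : ℕ} {τ t a : ℝ} (hτ : τ ≤ t) (ha : 0 ≤ a) :
    ∃ σ ∈ Icc τ t, 0 ≤ a - ((n : ℝ) - 6) * (t - σ) ∧
      (σ = τ ∨ 6 < n ∧ τ < σ ∧ a - ((n : ℝ) - 6) * (t - σ) = 0) := by
  by_cases h : 0 ≤ a - ((n : ℝ) - 6) * (t - τ)
  · exact ⟨τ, ⟨le_rfl, hτ⟩, h, Or.inl rfl⟩
  · push Not at h
    have hc : 0 < (n : ℝ) - 6 := by
      by_contra hc
      push Not at hc
      nlinarith [mul_nonneg (sub_nonneg.2 hτ) (neg_nonneg.2 hc)]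
    have hn : 6 < n := by
      have : (6 : ℝ) < n := by linarith
      exact_mod_cast this
    have e : ((n : ℝ) - 6) * (a / ((n : ℝ) - 6)) = a := by field_simp
    have h1 : a / ((n : ℝ) - 6) < t - τ := by rw [div_lt_iff₀ hc]; linarith
    have h2 : 0 ≤ a / ((n : ℝ) - 6) := div_nonneg ha hc.le
    refine ⟨t - a / ((n : ℝ) - 6), ⟨by linarith, by linarith⟩, ?_, Or.inr ⟨hn, by linarith, ?_⟩⟩
    · rw [sub_sub_cancel, e]; simp
    · rw [sub_sub_cancel, e]; simp

/-- Joint continuity of the components of a curve of states in time and area. -/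
def JointCont (f : ℝ → State) : Prop := ∀ n, 2 ≤ n → Continuous fun p : ℝ × ℝ => f p.1 n p.2

lemma JointCont.comp {f : ℝ → State} (hf : JointCont f) {n : ℕ} (hn : 2 ≤ n)
    {X : Type*} [TopologicalSpace X] {u v : X → ℝ} (hu : Continuous u) (hv : Continuous v) :
    Continuous fun x => f (u x) n (v x) :=
  (hf n hn).comp (hu.prodMk hv)

/-- The total damping exponent of class `n` up to time `s` for the coupling weight `Γ`. -/
noncomputable def damp (β : ℝ) (Γ : ℝ → ℝ) (n : ℕ) (s : ℝ) : ℝ := lam β n * ∫ x in (0 : ℝ)..s, Γ x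

lemma hasDerivAt_damp {β : ℝ} {Γ : ℝ → ℝ} (hΓ : Continuous Γ) (n : ℕ) (s : ℝ) :
    HasDerivAt (damp β Γ n) (lam β n * Γ s) s :=
  (intervalIntegral.integral_hasDerivAt_right (hΓ.intervalIntegrable _ _)
    hΓ.stronglyMeasurable.stronglyMeasurableAtFilter hΓ.continuousAt).const_mul _

lemma continuous_damp {β : ℝ} {Γ : ℝ → ℝ} (hΓ : Continuous Γ) (n : ℕ) :
    Continuous (damp β Γ n) :=
  continuous_iff_continuousAt.2 fun s => (hasDerivAt_damp hΓ n s).continuousAt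

/-- `f` solves `∂_t f_n + (n - 6) ∂_a f_n + lam_n Γ f_n = Q_n` on `[0, T]` with initial state `g`
and zero boundary values for `n > 6`, in the integrated form along characteristics. Duhamel's
formula is required on every piece of a characteristic that stays in the quadrant; for `τ = 0` it
gives the values reached from the initial time, and together with `boundary` those reached from `a
= 0`. -/
structure Solves (β T : ℝ) (Γ : ℝ → ℝ) (Q : ℝ → State) (g : State) (f : ℝ → State) : Prop where
  init : ∀ n : ℕ, 2 ≤ n → ∀ a, 0 ≤ a → f 0 n a = g n a
  boundary : ∀ n : ℕ, 6 < n → ∀ t ∈ Icc 0 T, f t n 0 = 0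
  duhamel : ∀ n : ℕ, 2 ≤ n → ∀ τ t a : ℝ, 0 ≤ τ → τ ≤ t → t ≤ T → 0 ≤ a →
    0 ≤ a - ((n : ℝ) - 6) * (t - τ) →
    f t n a = Real.exp (damp β Γ n τ - damp β Γ n t) * f τ n (a - ((n : ℝ) - 6) * (t - τ)) +
      ∫ s in τ..t, Real.exp (damp β Γ n s - damp β Γ n t) * Q s n (a - ((n : ℝ) - 6) * (t - s))

section
variable {β T : ℝ} {Γ Γ' : ℝ → ℝ} {Q Q' : ℝ → State} {g g' : State} {f f' : ℝ → State}

lemma foot_nonneg {n : ℕ} {τ t s a : ℝ} (ha : 0 ≤ a) (h : 0 ≤ a - ((n : ℝ) - 6) * (t - τ))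
    (hs : s ∈ Icc τ t) : 0 ≤ a - ((n : ℝ) - 6) * (t - s) := by
  rcases le_total 0 ((n : ℝ) - 6) with hc | hc
  · have := mul_le_mul_of_nonneg_left (by linarith [hs.1] : t - s ≤ t - τ) hc
    linarith
  · nlinarith [mul_nonneg (sub_nonneg.2 hs.2) (neg_nonneg.2 hc)]

lemma Solves.congr (h : Solves β T Γ Q g f)
    (hQ : ∀ s ∈ Icc 0 T, ∀ n, 2 ≤ n → ∀ a, 0 ≤ a → Q s n a = Q' s n a) :
    Solves β T Γ Q' g f where
  init := h.init
  boundary := h.boundary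
  duhamel n hn τ t a h0 h1 h2 h3 h4 := by
    rw [h.duhamel n hn τ t a h0 h1 h2 h3 h4]
    congr 1
    refine intervalIntegral.integral_congr fun s hs => ?_
    rw [uIcc_of_le h1] at hs
    rw [hQ s ⟨h0.trans hs.1, hs.2.trans h2⟩ n hn _ (foot_nonneg h3 h4 hs)]

/-- A part of the loss term may be moved between the damping and the source. -/
lemma Solves.change_damping (h : Solves β T Γ Q g f) (hΓ : Continuous Γ) (hΓ' : Continuous Γ')
    (hQ : JointCont Q) :
    Solves β T Γ' (fun s n a => Q s n a + lam β n * (Γ' s - Γ s) * f s n a) g f where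
  init := h.init
  boundary := h.boundary
  duhamel n hn τ t a h0 h1 h2 h3 h4 := by
    have key := variation_of_constants (K := damp β Γ n) (K' := damp β Γ' n)
      (κ := fun s => lam β n * Γ s) (κ' := fun s => lam β n * Γ' s)
      (q := fun s => Q s n (a - ((n : ℝ) - 6) * (t - s)))
      (y := fun s => f s n (a - ((n : ℝ) - 6) * (t - s)))
      (hasDerivAt_damp hΓ n) (hasDerivAt_damp hΓ' n) (by fun_prop) (by fun_prop)
      (hQ.comp hn continuous_id (by fun_prop)) h1 (fun s hs => by
        have h5 := foot_nonneg h3 h4 hs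
        have := h.duhamel n hn τ s _ h0 hs.1 (hs.2.trans h2) h5 (by
          convert h4 using 1; ring)
        rw [this]
        congr 1
        · congr 2; ring
        · congr 1; funext x; congr 2; ring)
    simp only [sub_self, mul_zero, sub_zero] at key
    rw [key]
    congr 2; funext s; ring

lemma Solves.sub (h : Solves β T Γ Q g f) (h' : Solves β T Γ Q' g' f') (hΓ : Continuous Γ)
    (hQ : JointCont Q) (hQ' : JointCont Q') :
    Solves β T Γ (fun s n a => Q s n a - Q' s n a) (fun n a => g n a - g' n a)
      (fun s n a => f s n a - f' s n a) where
  init n hn a ha := by simp only [h.init n hn a ha, h'.init n hn a ha]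
  boundary n hn t ht := by simp only [h.boundary n hn t ht, h'.boundary n hn t ht, sub_self]
  duhamel n hn τ t a h0 h1 h2 h3 h4 := by
    have hd := continuous_damp (β := β) hΓ n
    have c1 := hQ.comp hn continuous_id (v := fun s => a - ((n : ℝ) - 6) * (t - s)) (by fun_prop)
    have c2 := hQ'.comp hn continuous_id (v := fun s => a - ((n : ℝ) - 6) * (t - s)) (by fun_prop)
    simp only [id] at c1 c2
    rw [intervalIntegral.integral_congr (fun s _ => mul_sub _ _ _)]
    rw [intervalIntegral.integral_sub
      (Continuous.intervalIntegrable ?_ _ _) (Continuous.intervalIntegrable ?_ _ _)]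
    rotate_left
    · exact Continuous.mul (by fun_prop) c1
    · exact Continuous.mul (by fun_prop) c2
    rw [h.duhamel n hn τ t a h0 h1 h2 h3 h4, h'.duhamel n hn τ t a h0 h1 h2 h3 h4]
    ring

/-- Pointwise comparison for damped transport. -/
lemma Solves.abs_le (h : Solves β T Γ Q g f) (hΓ : Continuous Γ)
    {n : ℕ} (hn : 2 ≤ n) {t B C : ℝ} (ht : t ∈ Icc 0 T) (hB : 0 ≤ B)
    (hg : ∀ a, 0 ≤ a → |g n a| ≤ B)
    (hb : ∀ s ∈ Icc 0 t, ∀ a, 0 ≤ a → |Q s n a| ≤ (lam β n * Γ s + C) * Real.exp (C * s) * B)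
    {a : ℝ} (ha : 0 ≤ a) : |f t n a| ≤ Real.exp (C * t) * B := by
  obtain ⟨σ, hσ, h1, h2⟩ := exists_entry (n := n) ht.1 ha
  rw [h.duhamel n hn σ t a hσ.1 hσ.2 ht.2 ha h1]
  refine abs_damped_le (κ := fun s => lam β n * Γ s) (hasDerivAt_damp hΓ n) (by fun_prop)
    hσ.2 ?_ fun s hs =>
      hb s ⟨hσ.1.trans hs.1, hs.2⟩ _ (foot_nonneg ha h1 hs)
  rcases h2 with rfl | ⟨h3, -, h4⟩
  · rw [h.init n hn _ h1]; simpa using hg _ h1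
  · rw [h4, h.boundary n h3 σ ⟨hσ.1, hσ.2.trans ht.2⟩]
    simp only [abs_zero]; positivity

lemma Solves.nonneg (h : Solves β T Γ Q g f)
    {n : ℕ} (hn : 2 ≤ n) {t : ℝ} (ht : t ∈ Icc 0 T)
    (hg : ∀ a, 0 ≤ a → 0 ≤ g n a)
    (hb : ∀ s ∈ Icc 0 t, ∀ a, 0 ≤ a → 0 ≤ Q s n a)
    {a : ℝ} (ha : 0 ≤ a) : 0 ≤ f t n a := by
  obtain ⟨σ, hσ, h1, h2⟩ := exists_entry (n := n) ht.1 ha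
  rw [h.duhamel n hn σ t a hσ.1 hσ.2 ht.2 ha h1]
  have h5 : 0 ≤ f σ n (a - ((n : ℝ) - 6) * (t - σ)) := by
    rcases h2 with rfl | ⟨h3, -, h4⟩
    · rw [h.init n hn _ h1]; exact hg _ h1
    · rw [h4, h.boundary n h3 σ ⟨hσ.1, hσ.2.trans ht.2⟩]
  refine add_nonneg (by positivity) (intervalIntegral.integral_nonneg hσ.2 fun s hs => ?_)
  have := hb s ⟨hσ.1.trans hs.1, hs.2⟩ _ (foot_nonneg ha h1 hs)
  positivity

/-! ### Exponential moments -/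

/-- The exponential moment `∫_0^∞ e^{p a} |u(a)| da`, with values in `[0, ∞]`; the `L¹` norm
is the case `p = 0`. -/
noncomputable def expMoment (p : ℝ) (u : ℝ → ℝ) : ℝ≥0∞ :=
  ∫⁻ a in Ioi (0 : ℝ), ENNReal.ofReal (Real.exp (p * a)) * ENNReal.ofReal |u a|

lemma expMoment_congr {p : ℝ} {u v : ℝ → ℝ} (h : ∀ a, 0 ≤ a → u a = v a) :
    expMoment p u = expMoment p v :=
  setLIntegral_congr_fun measurableSet_Ioi fun a ha => by simp only [h a (le_of_lt ha)]

lemma expMoment_mono_exponent {p q : ℝ} (hpq : p ≤ q) (u : ℝ → ℝ) :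
    expMoment p u ≤ expMoment q u :=
  setLIntegral_mono' measurableSet_Ioi fun a ha => by
    have : 0 ≤ a := le_of_lt ha
    gcongr

lemma expMoment_add_le {p : ℝ} {u v : ℝ → ℝ} (hu : Measurable u) :
    expMoment p (fun a => u a + v a) ≤ expMoment p u + expMoment p v := by
  unfold expMoment
  rw [← lintegral_add_left (by fun_prop)]
  refine lintegral_mono fun a => ?_
  rw [← mul_add, ← ENNReal.ofReal_add (abs_nonneg _) (abs_nonneg _)]
  gcongr; exact abs_add_le _ _

lemma expMoment_const_mul (p c : ℝ) (u : ℝ → ℝ) :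
    expMoment p (fun a => c * u a) = ENNReal.ofReal |c| * expMoment p u := by
  unfold expMoment
  rw [← lintegral_const_mul' _ _ ENNReal.ofReal_ne_top]
  refine lintegral_congr fun a => ?_
  rw [abs_mul, ENNReal.ofReal_mul (abs_nonneg _)]; ring

/-- Moving the mass outwards by `d` multiplies an exponential moment by at most `e^{pd}`. For
negative `d` mass leaves through `a = 0`. -/
lemma expMoment_shift_le {p d : ℝ} {U : ℝ → ℝ≥0∞} (hU : Measurable U) :
    ∫⁻ a in Ioi (0 : ℝ), (if d ≤ a then ENNReal.ofReal (Real.exp (p * a)) * U (a - d) else 0) ≤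
      ENNReal.ofReal (Real.exp (p * d)) *
        ∫⁻ a in Ioi (0 : ℝ), ENNReal.ofReal (Real.exp (p * a)) * U a := by
  rw [← lintegral_const_mul _ (by fun_prop), ← lintegral_indicator measurableSet_Ioi,
    ← lintegral_add_right_eq_self _ d]
  rw [setLIntegral_congr (Ioi_ae_eq_Ici (a := (0 : ℝ))), ← lintegral_indicator measurableSet_Ici]
  refine lintegral_mono fun x => ?_
  by_cases hx : 0 ≤ x
  · rw [indicator_of_mem (mem_Ici.2 hx)]
    refine (indicator_le_self' (fun _ _ => zero_le) _).trans ?_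
    rw [if_pos (by linarith), add_sub_cancel_right, ← mul_assoc, ← ENNReal.ofReal_mul
      (Real.exp_nonneg _), ← Real.exp_add]
    ring_nf; exact le_rfl
  · refine (indicator_le_self' (fun _ _ => zero_le) _).trans ?_
    rw [if_neg (by linarith)]
    exact zero_le

lemma ofReal_abs_integral_le {τ t : ℝ} (h : τ ≤ t) {q : ℝ → ℝ} :
    ENNReal.ofReal |∫ s in τ..t, q s| ≤ ∫⁻ s in Ioc τ t, ENNReal.ofReal |q s| := by
  rw [intervalIntegral.integral_of_le h]
  have := enorm_integral_le_lintegral_enorm (μ := volume.restrict (Ioc τ t)) q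
  simpa [← ofReal_norm, Real.norm_eq_abs] using this

/-- An upper bound for `|f|` by integrals over the fixed interval `[0, t]`. Extending the time
interval before the entry of the characteristic only increases the right-hand side, and
the measurable nonnegative integrand admits Tonelli's theorem. -/
lemma Solves.ofReal_abs_le (h : Solves β T Γ Q g f)
    {n : ℕ} (hn : 2 ≤ n) {t : ℝ} (ht : t ∈ Icc 0 T) {a : ℝ} (ha : 0 ≤ a) :
    ENNReal.ofReal |f t n a| ≤
      (if ((n : ℝ) - 6) * t ≤ a then ENNReal.ofReal (Real.exp (- damp β Γ n t)) *
        ENNReal.ofReal |f 0 n (a - ((n : ℝ) - 6) * t)| else 0) +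
      ∫⁻ s in Ioc 0 t, (if ((n : ℝ) - 6) * (t - s) ≤ a then
        ENNReal.ofReal (Real.exp (damp β Γ n s - damp β Γ n t)) *
          ENNReal.ofReal |Q s n (a - ((n : ℝ) - 6) * (t - s))| else 0) := by
  obtain ⟨σ, hσ, h1, h2⟩ := exists_entry (n := n) ht.1 ha
  rw [h.duhamel n hn σ t a hσ.1 hσ.2 ht.2 ha h1]
  refine (ENNReal.ofReal_le_ofReal (abs_add_le _ _)).trans ?_
  rw [ENNReal.ofReal_add (abs_nonneg _) (abs_nonneg _)]
  refine add_le_add ?_ ?_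
  · rcases h2 with rfl | ⟨h3, -, h4⟩
    · rw [sub_zero] at h1 ⊢
      rw [if_pos (by linarith), abs_mul, Real.abs_exp, ENNReal.ofReal_mul (Real.exp_nonneg _)]
      simp [damp]
    · rw [h4, h.boundary n h3 σ ⟨hσ.1, hσ.2.trans ht.2⟩]
      simp
  · refine (ofReal_abs_integral_le hσ.2).trans ?_
    refine (lintegral_mono_set (Ioc_subset_Ioc_left hσ.1)).trans' ?_
    refine setLIntegral_mono' measurableSet_Ioc fun s hs => ?_
    rw [if_pos (by linarith [foot_nonneg ha h1 ⟨hs.1.le, hs.2⟩]), abs_mul, Real.abs_exp,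
      ENNReal.ofReal_mul (Real.exp_nonneg _)]

/-- Comparison of exponential moments for damped transport. Grains of class `n` move outwards
with speed less than `n`, which costs the factor `e^{p n t}`. -/
lemma Solves.expMoment_le (h : Solves β T Γ Q g f) (hΓ : Continuous Γ) (hQ : JointCont Q)
    (hf : JointCont f) {n : ℕ} (hn : 2 ≤ n) {t B C p : ℝ} (ht : t ∈ Icc 0 T) (hp : 0 ≤ p)
    (hB : 0 ≤ B) (hκ : ∀ s ∈ Icc 0 t, 0 ≤ lam β n * Γ s + C)
    (hg : expMoment p (g n) ≤ ENNReal.ofReal B)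
    (hb : ∀ s ∈ Icc 0 t, expMoment p (Q s n) ≤
      ENNReal.ofReal ((lam β n * Γ s + C) * Real.exp (C * s) * (Real.exp (p * n * s) * B))) :
    expMoment p (f t n) ≤ ENNReal.ofReal (Real.exp (C * t) * (Real.exp (p * n * t) * B)) := by
  have hd := continuous_damp (β := β) hΓ n
  set c : ℝ := (n : ℝ) - 6 with hc
  set E : ℝ → ℝ≥0∞ := fun a => ENNReal.ofReal (Real.exp (p * a)) with hE
  have hEm : Measurable E := by fun_prop
  set V : ℝ → ℝ := fun s => Real.exp (damp β Γ n s - damp β Γ n t) with hV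
  have hf0 : Measurable (f 0 n) := (hf.comp hn continuous_const continuous_id).measurable
  have hQm : Measurable fun p : ℝ × ℝ => Q p.1 n p.2 := (hQ n hn).measurable
  -- the contribution of the source, before and after exchanging the order of integration
  set S : ℝ → ℝ → ℝ≥0∞ := fun a s => if c * (t - s) ≤ a then
    E a * (ENNReal.ofReal (V s) * ENNReal.ofReal |Q s n (a - c * (t - s))|) else 0 with hS
  have hSm : Measurable (Function.uncurry S) := by
    refine Measurable.ite ?_ ?_ measurable_const
    · exact measurableSet_le (by fun_prop) (by fun_prop)
    · have h1 : Measurable fun x : ℝ × ℝ => Q x.2 n (x.1 - c * (t - x.2)) :=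
        (hQ.comp hn (by fun_prop) (by fun_prop)).measurable
      have h2 : Measurable V := (by fun_prop : Continuous V).measurable
      fun_prop
  have step1 : expMoment p (f t n) ≤
      (∫⁻ a in Ioi (0 : ℝ), (if c * t ≤ a then E a * (ENNReal.ofReal (V 0) *
        ENNReal.ofReal |f 0 n (a - c * t)|) else 0)) +
      ∫⁻ a in Ioi (0 : ℝ), ∫⁻ s in Ioc 0 t, S a s := by
    rw [← lintegral_add_left (by
      refine Measurable.ite ?_ ?_ measurable_const
      · exact measurableSet_le (by fun_prop) (by fun_prop)
      · fun_prop)]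
    refine setLIntegral_mono' measurableSet_Ioi fun a ha => ?_
    refine (mul_le_mul_right (h.ofReal_abs_le hn ht (le_of_lt ha)) _).trans ?_
    rw [mul_add, ← lintegral_const_mul' _ _ ENNReal.ofReal_ne_top]
    refine add_le_add (le_of_eq ?_) (le_of_eq (lintegral_congr fun s => ?_))
    · simp only [mul_ite, mul_zero, hV, hE, hc]; simp [damp]
    · simp only [mul_ite, mul_zero, hS, hE, hV, hc]
  have step2 : (∫⁻ a in Ioi (0 : ℝ), (if c * t ≤ a then E a * (ENNReal.ofReal (V 0) *
        ENNReal.ofReal |f 0 n (a - c * t)|) else 0)) ≤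
      ENNReal.ofReal (V 0 * (Real.exp (p * n * t) * B)) := by
    refine (expMoment_shift_le (U := fun a => ENNReal.ofReal (V 0) * ENNReal.ofReal |f 0 n a|)
      (by fun_prop)).trans ?_
    have e : ∫⁻ a in Ioi (0 : ℝ), ENNReal.ofReal (Real.exp (p * a)) *
        (ENNReal.ofReal (V 0) * ENNReal.ofReal |f 0 n a|) =
        ENNReal.ofReal (V 0) * expMoment p (f 0 n) := by
      unfold expMoment
      rw [← lintegral_const_mul' _ _ ENNReal.ofReal_ne_top]
      exact lintegral_congr fun a => by ring
    rw [e, expMoment_congr (h.init n hn)]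
    refine (mul_le_mul_right (mul_le_mul_right hg _) _).trans ?_
    have hV0 : 0 ≤ V 0 := Real.exp_nonneg _
    rw [← ENNReal.ofReal_mul hV0, ← ENNReal.ofReal_mul (Real.exp_nonneg _)]
    refine ENNReal.ofReal_le_ofReal ?_
    have : Real.exp (p * (c * t)) ≤ Real.exp (p * n * t) := by
      rw [Real.exp_le_exp, hc]
      nlinarith [mul_nonneg hp ht.1]
    nlinarith [mul_le_mul_of_nonneg_right this (mul_nonneg hV0 hB)]
  have step3 : ∫⁻ a in Ioi (0 : ℝ), ∫⁻ s in Ioc 0 t, S a s ≤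
      ∫⁻ s in Ioc 0 t, ENNReal.ofReal (V s * ((lam β n * Γ s + C) * Real.exp (C * s)) *
        (Real.exp (p * n * t) * B)) := by
    rw [lintegral_lintegral_swap hSm.aemeasurable]
    refine setLIntegral_mono' measurableSet_Ioc fun s hs => ?_
    have hs' : s ∈ Icc 0 t := ⟨hs.1.le, hs.2⟩
    refine (expMoment_shift_le (U := fun a => ENNReal.ofReal (V s) * ENNReal.ofReal |Q s n a|)
      ?_).trans ?_
    · have : Measurable (Q s n) := (hQ.comp hn continuous_const continuous_id).measurable
      fun_prop
    have e : ∫⁻ a in Ioi (0 : ℝ), ENNReal.ofReal (Real.exp (p * a)) *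
        (ENNReal.ofReal (V s) * ENNReal.ofReal |Q s n a|) =
        ENNReal.ofReal (V s) * expMoment p (Q s n) := by
      unfold expMoment
      rw [← lintegral_const_mul' _ _ ENNReal.ofReal_ne_top]
      exact lintegral_congr fun a => by ring
    rw [e]
    refine (mul_le_mul_right (mul_le_mul_right (hb s hs') _) _).trans ?_
    have hVs : 0 ≤ V s := Real.exp_nonneg _
    rw [← ENNReal.ofReal_mul hVs, ← ENNReal.ofReal_mul (Real.exp_nonneg _)]
    refine ENNReal.ofReal_le_ofReal ?_
    have h1 : Real.exp (p * (c * (t - s))) * Real.exp (p * n * s) ≤ Real.exp (p * n * t) := by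
      rw [← Real.exp_add, Real.exp_le_exp, hc]
      nlinarith [mul_nonneg hp (sub_nonneg.2 hs'.2)]
    have h2 : 0 ≤ V s * ((lam β n * Γ s + C) * Real.exp (C * s)) * B := by
      have := hκ s hs'
      positivity
    nlinarith [mul_le_mul_of_nonneg_right h1 h2]
  have step4 : ∫⁻ s in Ioc 0 t, ENNReal.ofReal (V s * ((lam β n * Γ s + C) *
      Real.exp (C * s)) * (Real.exp (p * n * t) * B)) =
      ENNReal.ofReal ((Real.exp (C * t) - V 0) * (Real.exp (p * n * t) * B)) := by
    have hcont : Continuous fun s => V s * ((lam β n * Γ s + C) * Real.exp (C * s)) *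
        (Real.exp (p * n * t) * B) := by fun_prop
    rw [← ofReal_integral_eq_lintegral_ofReal (hcont.integrableOn_Ioc)
      (by
        filter_upwards [ae_restrict_mem measurableSet_Ioc] with s hs
        have := hκ s ⟨hs.1.le, hs.2⟩
        positivity), ← intervalIntegral.integral_of_le ht.1,
      intervalIntegral.integral_mul_const,
      integral_exp_damped (hasDerivAt_damp hΓ n) (by fun_prop)]
    simp [hV]
  refine step1.trans ((add_le_add step2 (step3.trans step4.le)).trans ?_)
  have hV1 : V 0 ≤ Real.exp (C * t) := by
    have := integral_exp_damped (hasDerivAt_damp (β := β) hΓ n) (by fun_prop) C 0 t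
    have h2 : 0 ≤ ∫ s in (0 : ℝ)..t, Real.exp (damp β Γ n s - damp β Γ n t) *
        ((lam β n * Γ s + C) * Real.exp (C * s)) :=
      intervalIntegral.integral_nonneg ht.1 fun s hs => by
        have := hκ s hs
        positivity
    rw [this] at h2
    simpa [hV] using h2
  have hX : 0 ≤ Real.exp (p * n * t) * B := by positivity
  have hV0 : 0 ≤ V 0 := Real.exp_nonneg _
  rw [← ENNReal.ofReal_add (by positivity) (mul_nonneg (by linarith) hX)]
  exact ENNReal.ofReal_le_ofReal (le_of_eq (by ring))

end

section
variable {β T : ℝ} {Γ : ℝ → ℝ} {Q : ℝ → State} {g : State}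

/-! ### Construction of damped solutions -/

/-- The time at which the characteristic through `(t, a)` enters the quadrant. -/
noncomputable def entryTime (n : ℕ) (t a : ℝ) : ℝ :=
  if 6 < n then max 0 (t - a / ((n : ℝ) - 6)) else 0

/-- The solution of the damped transport equation with source `Q`, frozen for negative
times and areas. -/
noncomputable def dampedSol (β : ℝ) (Γ : ℝ → ℝ) (Q : ℝ → State) (g : State) : ℝ → State :=
  fun t n a =>
    Real.exp (- damp β Γ n (max t 0)) *
      (if ((n : ℝ) - 6) * max t 0 ≤ max a 0 then g n (max a 0 - ((n : ℝ) - 6) * max t 0) else 0) +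
    ∫ s in entryTime n (max t 0) (max a 0)..max t 0,
      Real.exp (damp β Γ n s - damp β Γ n (max t 0)) *
        Q s n (max a 0 - ((n : ℝ) - 6) * (max t 0 - s))

lemma dampedSol_clamp (t : ℝ) (n : ℕ) (a : ℝ) :
    dampedSol β Γ Q g t n a = dampedSol β Γ Q g (max t 0) n (max a 0) := by
  simp [dampedSol]

lemma dampedSol_solves (hΓ : Continuous Γ) (hQ : JointCont Q)
    (hg : ∀ n, 6 < n → g n 0 = 0) : Solves β T Γ Q g (dampedSol β Γ Q g) where
  init n hn a ha := by
    have : entryTime n 0 a = 0 := by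
      unfold entryTime
      split_ifs with h
      · have : (6 : ℝ) < n := by exact_mod_cast h
        have : 0 ≤ a / ((n : ℝ) - 6) := div_nonneg ha (by linarith)
        rw [max_eq_left (by linarith)]
      · rfl
    simp [dampedSol, ha, this, damp]
  boundary n hn t ht := by
    have h6 : (6 : ℝ) < n := by exact_mod_cast hn
    have : entryTime n t 0 = t := by simp [entryTime, hn, ht.1]
    simp only [dampedSol, max_self, max_eq_left ht.1, this, intervalIntegral.integral_same,
      add_zero]
    split_ifs with h
    · have : ((n : ℝ) - 6) * t = 0 := le_antisymm h (mul_nonneg (by linarith) ht.1)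
      rw [this, sub_zero, hg n hn, mul_zero]
    · simp
  duhamel n hn τ t a h0 h1 h2 h3 h4 := by
    have hd := continuous_damp (β := β) hΓ n
    have ht : 0 ≤ t := h0.trans h1
    have hen : entryTime n τ (a - ((n : ℝ) - 6) * (t - τ)) = entryTime n t a := by
      unfold entryTime
      split_ifs with h
      · have : (n : ℝ) - 6 ≠ 0 := by
          have : (6 : ℝ) < n := by exact_mod_cast h
          linarith
        congr 1
        field_simp
        ring
      · rfl
    have hif : (((n : ℝ) - 6) * t ≤ a) = (((n : ℝ) - 6) * τ ≤ a - ((n : ℝ) - 6) * (t - τ)) := by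
      apply propext; constructor <;> intro h <;> linarith
    simp only [dampedSol, max_eq_left ht, max_eq_left h0, max_eq_left h3, max_eq_left h4, hen, hif]
    have hc : Continuous fun s => Real.exp (damp β Γ n s - damp β Γ n t) *
        Q s n (a - ((n : ℝ) - 6) * (t - s)) :=
      Continuous.mul (by fun_prop) (hQ.comp hn continuous_id (by fun_prop))
    rw [← intervalIntegral.integral_add_adjacent_intervals (b := τ)
      (hc.intervalIntegrable _ _) (hc.intervalIntegrable _ _), mul_add, ← mul_assoc,
      ← Real.exp_add, ← intervalIntegral.integral_const_mul, add_assoc]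
    congr 1
    · rw [show a - ((n : ℝ) - 6) * (t - τ) - ((n : ℝ) - 6) * τ = a - ((n : ℝ) - 6) * t by ring]
      congr 2; ring
    · congr 1
      congr 1; funext s
      rw [← mul_assoc, ← Real.exp_add]
      congr 2
      · ring
      · ring

/-! ### Norms of states -/

lemma expMoment_gain_le {p : ℝ} {u : State} {b : ℕ → ℝ} (hβ : 0 < β) {n : ℕ} (hn : 2 ≤ n)
    (hu : ∀ m, 2 ≤ m → Measurable (u m)) (hb : ∀ m, 2 ≤ m → 0 ≤ b m)
    (h : ∀ m, 2 ≤ m → expMoment p (u m) ≤ ENNReal.ofReal (b m)) :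
    expMoment p (fun a => gain β (fun m => u m a) n) ≤ ENNReal.ofReal (gain β b n) := by
  have hn' : (2 : ℝ) ≤ n := by exact_mod_cast hn
  have aux : ∀ c : ℝ, 0 ≤ c → ∀ m, 2 ≤ m →
      expMoment p (fun a => c * u m a) ≤ ENNReal.ofReal (c * b m) := fun c hc m hm => by
    rw [expMoment_const_mul, abs_of_nonneg hc, ENNReal.ofReal_mul hc]
    exact mul_le_mul_right (h m hm) _
  have h1 := aux ((β + 1) * (n + 1)) (by positivity) (n + 1) (by omega)
  unfold gain
  split_ifs with h2
  · simpa using h1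
  · have h3 : 0 ≤ β * ((n : ℝ) - 1) := mul_nonneg hβ.le (by linarith)
    have h4 := aux (β * (n - 1)) h3 (n - 1) (by omega)
    refine (expMoment_add_le ((hu _ (by omega)).const_mul _)).trans ?_
    rw [ENNReal.ofReal_add (mul_nonneg (by positivity) (hb _ (by omega)))
      (mul_nonneg h3 (hb _ (by omega)))]
    exact add_le_add h1 h4

lemma lintegral_exp_neg_mul {q : ℝ} (hq : 0 < q) :
    ∫⁻ a in Ioi (0 : ℝ), ENNReal.ofReal (Real.exp (-q * a)) = ENNReal.ofReal (1 / q) := by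
  rw [← ofReal_integral_eq_lintegral_ofReal
    (integrableOn_exp_mul_Ioi (by linarith) 0) (ae_of_all _ fun a => Real.exp_nonneg _),
    integral_exp_mul_Ioi (by linarith)]
  congr 1; simp

/-- Interpolation between the supremum norm and an exponential moment: by Young's inequality
`e^{qa} |w| ≤ √ε e^{qa} √|w| ≤ √ε (e^{-qa} + e^{3qa} |w|)`. -/
lemma expMoment_le_sqrt {q ε : ℝ} (hq : 0 < q) {w : ℝ → ℝ}
    (hw : ∀ a, 0 ≤ a → |w a| ≤ ε) :
    expMoment q w ≤ ENNReal.ofReal (√ε) * (ENNReal.ofReal (1 / q) + expMoment (3 * q) w) := by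
  have hε : 0 ≤ ε := (abs_nonneg _).trans (hw 0 le_rfl)
  rw [← lintegral_exp_neg_mul hq]
  unfold expMoment
  rw [← lintegral_add_left (by fun_prop), ← lintegral_const_mul' _ _ ENNReal.ofReal_ne_top]
  refine setLIntegral_mono' measurableSet_Ioi fun a ha => ?_
  rw [← ENNReal.ofReal_mul (Real.exp_nonneg _), ← ENNReal.ofReal_mul (Real.exp_nonneg _),
    ← ENNReal.ofReal_add (by positivity) (by positivity), ← ENNReal.ofReal_mul (by positivity)]
  refine ENNReal.ofReal_le_ofReal ?_
  have h1 : |w a| ≤ √ε * √|w a| := by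
    rw [← Real.sqrt_mul hε, Real.le_sqrt (abs_nonneg _) (by positivity)]
    nlinarith [hw a (le_of_lt ha), abs_nonneg (w a)]
  have h2 : Real.exp (q * a) * √|w a| ≤
      Real.exp (-q * a) + Real.exp (3 * q * a) * |w a| := by
    set x := Real.exp (-q * a / 2) with hx
    set y := Real.exp (3 * q * a / 2) with hy
    have e1 : Real.exp (q * a) = x * y := by rw [hx, hy, ← Real.exp_add]; ring_nf
    have e2 : Real.exp (-q * a) = x ^ 2 := by rw [hx, ← Real.exp_nat_mul]; ring_nf
    have e3 : Real.exp (3 * q * a) = y ^ 2 := by rw [hy, ← Real.exp_nat_mul]; ring_nf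
    have e4 : |w a| = √|w a| ^ 2 := (Real.sq_sqrt (abs_nonneg _)).symm
    have hx0 : 0 ≤ x := Real.exp_nonneg _
    have hy0 : 0 ≤ y := Real.exp_nonneg _
    rw [e1, e2, e3]
    nth_rw 2 [e4]
    nlinarith [sq_nonneg (x - y * √|w a|), Real.sqrt_nonneg |w a|,
      mul_nonneg (mul_nonneg hx0 hy0) (Real.sqrt_nonneg |w a|)]
  calc Real.exp (q * a) * |w a| ≤ Real.exp (q * a) * (√ε * √|w a|) := by gcongr
    _ = √ε * (Real.exp (q * a) * √|w a|) := by ring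
    _ ≤ _ := by gcongr

/-- The first moment of a state in the number of edges,
`∑_{n ≥ 2} n ∫_0^∞ e^{q a} |f_n(a)| da`, with an exponential weight in the area. -/
noncomputable def edgeMoment (q : ℝ) (u : State) : ℝ≥0∞ :=
  ∑' k : ℕ, ENNReal.ofReal ((k + 2 : ℕ) : ℝ) * expMoment q (u (k + 2))

lemma edgeMoment_congr {q : ℝ} {u v : State} (h : ∀ n, 2 ≤ n → ∀ a, 0 ≤ a → u n a = v n a) :
    edgeMoment q u = edgeMoment q v :=
  tsum_congr fun k => by rw [expMoment_congr (h (k + 2) (by omega))]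

lemma one_add_le_exp {q a : ℝ} (hq : 0 < q) (hq1 : q ≤ 1) :
    1 + a ≤ q⁻¹ * Real.exp (q * a) := by
  rw [inv_mul_eq_div, le_div_iff₀ hq]
  nlinarith [Real.add_one_le_exp (q * a)]

lemma lNorm_le_edgeMoment {q : ℝ} (hq : 0 < q) (hq1 : q ≤ 1) (u : State) :
    lNorm u ≤ ENNReal.ofReal q⁻¹ * edgeMoment q u := by
  unfold lNorm edgeMoment
  rw [← ENNReal.tsum_mul_left]
  refine ENNReal.tsum_le_tsum fun k => ?_
  unfold expMoment
  rw [← lintegral_const_mul' _ _ ENNReal.ofReal_ne_top,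
    ← lintegral_const_mul' _ _ ENNReal.ofReal_ne_top]
  refine setLIntegral_mono' measurableSet_Ioi fun a ha => ?_
  rw [← ENNReal.ofReal_mul (Real.exp_nonneg _), ← ENNReal.ofReal_mul (Nat.cast_nonneg _),
    ← ENNReal.ofReal_mul (by positivity)]
  refine ENNReal.ofReal_le_ofReal ?_
  have ha' : 0 ≤ a := le_of_lt ha
  have h1 := one_add_le_exp (a := a) hq hq1
  have h2 : (1 : ℝ) ≤ ((k + 2 : ℕ) : ℝ) := by exact_mod_cast (by omega : 1 ≤ k + 2)
  have h3 : ((k + 2 : ℕ) : ℝ) + a ≤ ((k + 2 : ℕ) : ℝ) * (q⁻¹ * Real.exp (q * a)) := by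
    nlinarith
  calc _ ≤ ((k + 2 : ℕ) : ℝ) * (q⁻¹ * Real.exp (q * a)) * |u (k + 2) a| := by gcongr
    _ = _ := by ring

lemma edgeMoment_zero_le_lNorm (u : State) : edgeMoment 0 u ≤ lNorm u := by
  unfold lNorm edgeMoment
  refine ENNReal.tsum_le_tsum fun k => ?_
  unfold expMoment
  rw [← lintegral_const_mul' _ _ ENNReal.ofReal_ne_top]
  refine setLIntegral_mono' measurableSet_Ioi fun a ha => ?_
  have ha' : 0 ≤ a := le_of_lt ha
  rw [zero_mul, Real.exp_zero, ENNReal.ofReal_one, one_mul,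
    ← ENNReal.ofReal_mul (Nat.cast_nonneg _)]
  exact ENNReal.ofReal_le_ofReal (by gcongr; linarith)

lemma tsum_ofReal_lt_top {b : ℕ → ℝ} (hb : ∀ k, 0 ≤ b k) (hs : Summable b) :
    ∑' k, ENNReal.ofReal (b k) < ⊤ := by
  rw [← ENNReal.ofReal_tsum_of_nonneg hb hs]; exact ENNReal.ofReal_lt_top

/-- Uniform convergence of the components, together with a summable bound on exponential moments,
implies convergence of weighted `L¹` norms. -/
lemma tendsto_edgeMoment {ι : Type*} {l : Filter ι} [l.IsCountablyGenerated] {w : ι → State}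
    {q : ℝ} (hq : 0 < q) {E : ℕ → ℝ} (hE : ∀ n, 0 ≤ E n)
    (hs : Summable fun n : ℕ => (n : ℝ) * E n)
    (h1 : ∀ n, 2 ≤ n → ∀ ε > 0, ∀ᶠ s in l, ∀ a, 0 ≤ a → |w s n a| ≤ ε)
    (h2 : ∀ᶠ s in l, ∀ n, 2 ≤ n → expMoment (3 * q) (w s n) ≤ ENNReal.ofReal (E n)) :
    Tendsto (fun s => edgeMoment q (w s)) l (𝓝 0) := by
  have e : ∀ s, edgeMoment q (w s) =
      ∫⁻ k : ℕ, ENNReal.ofReal ((k + 2 : ℕ) : ℝ) * expMoment q (w s (k + 2)) ∂Measure.count :=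
    fun s => (lintegral_count _).symm
  simp_rw [e]
  have hfin : ∫⁻ k : ℕ, ENNReal.ofReal (((k + 2 : ℕ) : ℝ) * E (k + 2)) ∂Measure.count ≠ ⊤ := by
    rw [lintegral_count]
    exact (tsum_ofReal_lt_top (fun k => mul_nonneg (Nat.cast_nonneg _) (hE _))
      ((summable_nat_add_iff 2).2 hs)).ne
  have := tendsto_lintegral_filter_of_dominated_convergence (μ := Measure.count) (l := l)
    (F := fun s (k : ℕ) => ENNReal.ofReal ((k + 2 : ℕ) : ℝ) * expMoment q (w s (k + 2)))
    (f := fun _ => 0)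
    (fun k : ℕ => ENNReal.ofReal (((k + 2 : ℕ) : ℝ) * E (k + 2)))
    (Eventually.of_forall fun _ => measurable_of_countable _) ?_ hfin (ae_of_all _ fun k => ?_)
  · simpa using this
  · filter_upwards [h2] with s hs'
    refine ae_of_all _ fun k => ?_
    rw [ENNReal.ofReal_mul (Nat.cast_nonneg _)]
    exact mul_le_mul_right ((expMoment_mono_exponent (by linarith) _).trans
      (hs' (k + 2) (by omega))) _
  · set A : ℝ≥0∞ := ENNReal.ofReal ((k + 2 : ℕ) : ℝ) *
      (ENNReal.ofReal (1 / q) + ENNReal.ofReal (E (k + 2))) with hA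
    have hA' : A ≠ ⊤ := ENNReal.mul_ne_top ENNReal.ofReal_ne_top
      (ENNReal.add_ne_top.2 ⟨ENNReal.ofReal_ne_top, ENNReal.ofReal_ne_top⟩)
    have hlim : Tendsto (fun ε : ℝ => ENNReal.ofReal (√ε) * A) (𝓝[>] 0) (𝓝 0) := by
      have : Tendsto (fun ε : ℝ => ENNReal.ofReal (√ε)) (𝓝[>] 0) (𝓝 (ENNReal.ofReal (√0))) :=
        (ENNReal.continuous_ofReal.comp Real.continuous_sqrt).continuousAt.tendsto.mono_left
          nhdsWithin_le_nhds
      have := ENNReal.Tendsto.mul_const this (Or.inr hA')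
      simpa using this
    rw [ENNReal.tendsto_nhds_zero]
    intro η hη
    obtain ⟨ε, h3, h4⟩ := ((hlim.eventually_le_const (hη)).and
      (eventually_mem_nhdsWithin)).exists
    filter_upwards [h1 (k + 2) (by omega) ε h4, h2] with s h5 h6
    refine le_trans ?_ h3
    calc _ ≤ ENNReal.ofReal ((k + 2 : ℕ) : ℝ) * (ENNReal.ofReal (√ε) *
          (ENNReal.ofReal (1 / q) + ENNReal.ofReal (E (k + 2)))) := by
          refine mul_le_mul_right ((expMoment_le_sqrt hq h5).trans ?_) _
          exact mul_le_mul_right (add_le_add le_rfl (h6 (k + 2) (by omega))) _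
      _ = _ := by rw [hA]; ring

lemma integrable_of_expMoment {p : ℝ} (hp : 0 ≤ p) {u : ℝ → ℝ}
    (hu : AEStronglyMeasurable u (volume.restrict (Ioi 0)))
    (h : expMoment p u < ⊤) : IntegrableOn u (Ioi 0) := by
  refine ⟨hu, ?_⟩
  rw [hasFiniteIntegral_iff_enorm]
  have : ∫⁻ a in Ioi (0 : ℝ), ‖u a‖ₑ = expMoment 0 u := by
    unfold expMoment
    refine lintegral_congr fun a => ?_
    simp [← ofReal_norm, Real.norm_eq_abs]
  rw [this]
  exact (expMoment_mono_exponent hp u).trans_lt h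

lemma abs_integral_le_expMoment {u : ℝ → ℝ} (h : expMoment 0 u < ⊤) :
    |∫ a in Ioi (0 : ℝ), u a| ≤ (expMoment 0 u).toReal := by
  have h1 := enorm_integral_le_lintegral_enorm (μ := volume.restrict (Ioi (0 : ℝ))) u
  have : ∫⁻ a in Ioi (0 : ℝ), ‖u a‖ₑ = expMoment 0 u := by
    unfold expMoment
    refine lintegral_congr fun a => ?_
    simp [← ofReal_norm, Real.norm_eq_abs]
  rw [this, ← ofReal_norm, Real.norm_eq_abs] at h1
  rw [← ENNReal.ofReal_le_iff_le_toReal h.ne]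
  exact h1

lemma expMoment_lt_top_of_edgeMoment {q : ℝ} {u : State} (h : edgeMoment q u < ⊤) {n : ℕ}
    (hn : 2 ≤ n) : expMoment q (u n) < ⊤ := by
  obtain ⟨k, rfl⟩ : ∃ k, n = k + 2 := ⟨n - 2, by omega⟩
  have h1 := (ENNReal.le_tsum k).trans_lt h
  refine lt_of_le_of_lt ?_ h1
  have : (1 : ℝ≥0∞) ≤ ENNReal.ofReal ((k + 2 : ℕ) : ℝ) := by
    rw [ENNReal.one_le_ofReal]; exact_mod_cast (by omega : 1 ≤ k + 2)
  calc _ = 1 * expMoment q (u (k + 2)) := (one_mul _).symm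
    _ ≤ _ := mul_le_mul_left this _

lemma hasSum_toReal_edgeMoment {u : State} (h : edgeMoment 0 u < ⊤) :
    HasSum (fun k : ℕ => ((k + 2 : ℕ) : ℝ) * (expMoment 0 (u (k + 2))).toReal)
      (edgeMoment 0 u).toReal := by
  have e : ∀ k : ℕ, ((k + 2 : ℕ) : ℝ) * (expMoment 0 (u (k + 2))).toReal =
      (ENNReal.ofReal ((k + 2 : ℕ) : ℝ) * expMoment 0 (u (k + 2))).toReal := fun k => by
    rw [ENNReal.toReal_mul, ENNReal.toReal_ofReal (Nat.cast_nonneg _)]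
  simp_rw [e]
  have h1 := ENNReal.hasSum_toReal (f := fun k : ℕ => ENNReal.ofReal ((k + 2 : ℕ) : ℝ) *
    expMoment 0 (u (k + 2))) h.ne
  rwa [← ENNReal.tsum_toReal_eq fun k => ((ENNReal.le_tsum k).trans_lt h).ne] at h1

lemma summable_edge_integral {u : State} (h : edgeMoment 0 u < ⊤) :
    Summable fun k : ℕ => ((k + 2 : ℕ) : ℝ) * ∫ a in Ioi (0 : ℝ), u (k + 2) a := by
  refine Summable.of_norm_bounded (hasSum_toReal_edgeMoment h).summable fun k => ?_
  rw [Real.norm_eq_abs, abs_mul, abs_of_nonneg (Nat.cast_nonneg (k + 2))]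
  exact mul_le_mul_of_nonneg_left (abs_integral_le_expMoment
    (expMoment_lt_top_of_edgeMoment h (by omega))) (Nat.cast_nonneg _)

lemma abs_weightDen_le (hβ : 0 < β) {u : State} (h : edgeMoment 0 u < ⊤) :
    |weightDen β u| ≤ (β + 2) * (edgeMoment 0 u).toReal := by
  have h1 := hasSum_toReal_edgeMoment h
  have h2 : |∑' k : ℕ, ((k + 2 : ℕ) : ℝ) * ∫ a in Ioi (0 : ℝ), u (k + 2) a| ≤
      (edgeMoment 0 u).toReal := by
    rw [← Real.norm_eq_abs]
    refine tsum_of_norm_bounded h1 fun k => ?_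
    rw [Real.norm_eq_abs, abs_mul, abs_of_nonneg (Nat.cast_nonneg (k + 2))]
    exact mul_le_mul_of_nonneg_left (abs_integral_le_expMoment
      (expMoment_lt_top_of_edgeMoment h (by omega))) (Nat.cast_nonneg _)
  have h3 : 2 * |∫ a in Ioi (0 : ℝ), u 2 a| ≤ (edgeMoment 0 u).toReal := by
    have := h1.summable.le_tsum 0 (fun k _ => by positivity)
    rw [h1.tsum_eq] at this
    refine le_trans ?_ this
    have h4 := abs_integral_le_expMoment (expMoment_lt_top_of_edgeMoment h le_rfl)
    push_cast
    linarith
  unfold weightDen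
  refine (abs_sub _ _).trans ?_
  rw [abs_mul, abs_of_nonneg (by positivity : 0 ≤ 2 * (β + 1))]
  nlinarith

lemma edgeMoment_sub_lt_top {u v : State} {q : ℝ}
    (hu : ∀ n, 2 ≤ n → AEStronglyMeasurable (u n) (volume.restrict (Ioi 0)))
    (h : edgeMoment q u < ⊤) (h' : edgeMoment q v < ⊤) : edgeMoment q (u - v) < ⊤ := by
  refine lt_of_le_of_lt ?_ (ENNReal.add_lt_top.2 ⟨h, h'⟩)
  unfold edgeMoment
  rw [← ENNReal.tsum_add]
  refine ENNReal.tsum_le_tsum fun k => ?_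
  rw [← mul_add]
  refine mul_le_mul_right ?_ _
  unfold expMoment
  have hm := (hu (k + 2) (by omega)).aemeasurable
  rw [← lintegral_add_left' (by fun_prop)]
  refine lintegral_mono fun a => ?_
  rw [← mul_add, ← ENNReal.ofReal_add (abs_nonneg _) (abs_nonneg _)]
  gcongr; exact abs_sub _ _

lemma abs_weightDen_sub_le (hβ : 0 < β) {u v : State}
    (hu : ∀ n, 2 ≤ n → AEStronglyMeasurable (u n) (volume.restrict (Ioi 0)))
    (hv : ∀ n, 2 ≤ n → AEStronglyMeasurable (v n) (volume.restrict (Ioi 0)))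
    (h : edgeMoment 0 u < ⊤) (h' : edgeMoment 0 v < ⊤) :
    |weightDen β u - weightDen β v| ≤ (β + 2) * (edgeMoment 0 (u - v)).toReal := by
  refine le_trans (le_of_eq ?_) (abs_weightDen_le hβ (edgeMoment_sub_lt_top hu h h'))
  congr 1
  have e : ∀ n, 2 ≤ n → ∫ a in Ioi (0 : ℝ), (u - v) n a =
      (∫ a in Ioi (0 : ℝ), u n a) - ∫ a in Ioi (0 : ℝ), v n a := fun n hn =>
    integral_sub (integrable_of_expMoment le_rfl (hu n hn) (expMoment_lt_top_of_edgeMoment h hn))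
      (integrable_of_expMoment le_rfl (hv n hn) (expMoment_lt_top_of_edgeMoment h' hn))
  unfold weightDen
  rw [e 2 le_rfl]
  have : ∑' k : ℕ, ((k + 2 : ℕ) : ℝ) * ∫ a in Ioi (0 : ℝ), (u - v) (k + 2) a =
      (∑' k : ℕ, ((k + 2 : ℕ) : ℝ) * ∫ a in Ioi (0 : ℝ), u (k + 2) a) -
        ∑' k : ℕ, ((k + 2 : ℕ) : ℝ) * ∫ a in Ioi (0 : ℝ), v (k + 2) a := by
    rw [← (summable_edge_integral h).tsum_sub (summable_edge_integral h')]
    exact tsum_congr fun k => by rw [e (k + 2) (by omega), mul_sub]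
  rw [this]; ring

lemma weightDen_congr {u v : State} (h : ∀ n, 2 ≤ n → ∀ a, 0 ≤ a → u n a = v n a) :
    weightDen β u = weightDen β v := by
  have e : ∀ n, 2 ≤ n → ∫ a in Ioi (0 : ℝ), u n a = ∫ a in Ioi (0 : ℝ), v n a := fun n hn =>
    setIntegral_congr_fun measurableSet_Ioi fun a ha => h n hn a (le_of_lt ha)
  unfold weightDen
  rw [e 2 le_rfl]
  congr 1
  exact tsum_congr fun k => by rw [e (k + 2) (by omega)]

end

/-! ### The class of approximate solutions -/

/-- The quantitative properties of the initial state that enter the construction; `M` stands for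
`‖g‖_β`. -/
structure Data (β M : ℝ) (g : State) : Prop where
  nonneg : ∀ n, 2 ≤ n → ∀ a, 0 ≤ a → 0 ≤ g n a
  le : ∀ n, 2 ≤ n → ∀ a, 0 ≤ a → g n a ≤ M * phi β n
  boundary : ∀ n, 6 < n → g n 0 = 0
  equi : ∀ ε : ℝ, 0 < ε → ∃ δ₀ : ℝ, 0 < δ₀ ∧ ∀ δ, 0 ≤ δ → δ ≤ δ₀ → ∀ n, 2 ≤ n →
    ∀ a, 0 ≤ a → |g n (a + δ) - g n a| ≤ ε * phi β n
  expTail : ∃ d D : ℝ, 0 < d ∧ 0 ≤ D ∧ ∀ n, 2 ≤ n → expMoment d (g n) ≤ ENNReal.ofReal D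

/-- The numerator `∑ (n - 6)² f_n(0)` of the coupling weight of a state with `f_n(0) = 0` for
`n > 6`. -/
def boundaryFlux (u : State) : ℝ := 16 * u 2 0 + 9 * u 3 0 + 4 * u 4 0 + u 5 0

/-- The coupling weight, with its denominator cut off from below at `c₀ e^{-2t}`. The
decay of the cut-off is that of the lower bound on the denominator, which comes from the
growth `e^{2t}` of the second moment of the area. -/
noncomputable def clipWeight (β c₀ : ℝ) (f : ℝ → State) (t : ℝ) : ℝ :=
  boundaryFlux (f t) / max (weightDen β (f t)) (c₀ * Real.exp (-2 * t))

/-- The bound on the clipped weight up to time `T` for states below `M φ`. -/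
noncomputable def weightBound (β M c₀ T : ℝ) : ℝ :=
  M * boundaryFlux (fun n _ => phi β n) / (c₀ * Real.exp (-2 * T))

/-- Curves of states obeying all a priori bounds satisfied by the approximate solutions;
they are frozen for negative times and areas. In `equi` any modulus of continuity of `g` in the
area is inherited up to time `T`, with a loss that is linear in the displacement. In `moment` the
bound at time `t` is a multiple of `ψ(ρ e^{pt})_n`. The constants depend on `g`, but not on the
curve, so that these properties are stable under the iteration and under limits. -/
structure Curve (β M c₀ : ℝ) (g : State) (f : ℝ → State) : Prop where
  clamp : ∀ t n a, f t n a = f (max t 0) n (max a 0)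
  nonneg : ∀ t n, 2 ≤ n → ∀ a, 0 ≤ f t n a
  le : ∀ t n, 2 ≤ n → ∀ a, f t n a ≤ M * phi β n
  equi : ∀ T ε δ : ℝ, 0 ≤ T → 0 ≤ ε → 0 ≤ δ →
    (∀ δ', 0 ≤ δ' → δ' ≤ δ → ∀ n, 2 ≤ n → ∀ a, 0 ≤ a → |g n (a + δ') - g n a| ≤ ε * phi β n) →
    ∀ t ∈ Icc 0 T, ∀ n, 2 ≤ n → ∀ a, 0 ≤ a → |f t n (a + δ) - f t n a| ≤
      (ε + 7 * (2 * β + 1) * M * weightBound β M c₀ T * δ) * phi β n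
  timeCont : ∀ n, 2 ≤ n → ∀ t ε : ℝ, 0 < ε → ∀ᶠ s in 𝓝 t, ∀ a, |f s n a - f t n a| ≤ ε
  moment : ∀ T p ρ D : ℝ, 0 ≤ T → 0 ≤ p → ratio β ≤ ρ → ρ * Real.exp (p * T) ≤ 1 → 0 ≤ D →
    (∀ n, 2 ≤ n → expMoment p (g n) ≤ ENNReal.ofReal (D * psi ρ n)) →
    ∀ t ∈ Icc 0 T, ∀ n, 2 ≤ n → expMoment p (f t n) ≤
      ENNReal.ofReal (Real.exp (2 * (β + 1) * weightBound β M c₀ T * t) *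
        (Real.exp (p * n * t) * (D * psi ρ n)))

section
variable {β M c₀ : ℝ} {g : State} {f : ℝ → State}

lemma exp_mul_psi (ρ p t : ℝ) (n : ℕ) :
    Real.exp (p * n * t) * psi ρ n = psi (ρ * Real.exp (p * t)) n := by
  unfold psi
  rw [mul_pow, ← Real.exp_nat_mul, show (n : ℝ) * (p * t) = p * n * t by ring]; ring

lemma phi_le (hβ : 0 < β) {n : ℕ} (hn : 2 ≤ n) : phi β n ≤ ratio β ^ n / β := by
  rw [phi_eq]
  have : (1 : ℝ) ≤ n := by exact_mod_cast (by omega : 1 ≤ n)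
  have h := pow_nonneg (ratio_pos hβ).le n
  unfold psi
  gcongr
  exact div_le_self h this

/-- By interpolation with the bound `M φ`, the exponential tails of the initial state in the area
yield joint exponential tails in area and number of edges. -/
lemma Data.exists_moment (hβ : 0 < β) (hM : 0 ≤ M) (hg : Data β M g) {T : ℝ} (hT : 0 ≤ T) :
    ∃ p ρ D : ℝ, 0 < p ∧ p ≤ 1 ∧ ratio β ≤ ρ ∧ ρ * Real.exp (p * T) < 1 ∧ 0 ≤ D ∧
      ∀ n, 2 ≤ n → expMoment p (g n) ≤ ENNReal.ofReal (D * psi ρ n) := by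
  obtain ⟨d, D, hd, hD, h⟩ := hg.expTail
  have hr0 := ratio_pos hβ
  have hr1 := ratio_lt_one hβ
  set x := √(ratio β) with hx
  have hx0 : 0 < x := Real.sqrt_pos.2 hr0
  have hx2 : x ^ 2 = ratio β := Real.sq_sqrt hr0.le
  have hx1 : x < 1 := by nlinarith
  obtain ⟨ρ, hρ1, hρ2⟩ := exists_between hx1
  have hρ0 : 0 < ρ := hx0.trans hρ1
  obtain ⟨C, hC, hC'⟩ := exists_pow_mul_le hx0.le hρ1 1
  have hlog : 0 < - Real.log ρ := by linarith [Real.log_neg hρ0 hρ2]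
  -- `3 p ≤ d` lets the interpolation use the tails of `g`, and `p (T + 1) ≤ -log ρ` keeps
  -- `ρ e^{pT} < 1`; the density `√φ_n ≲ √(ratio β) ^ n` forces `ρ > √(ratio β)`
  set p : ℝ := min (min 1 (d / 3)) (- Real.log ρ / (T + 1)) with hp
  have hp0 : 0 < p := by positivity
  have hp1 : p ≤ 1 := (min_le_left _ _).trans (min_le_left _ _)
  have hp2 : 3 * p ≤ d := by
    have : p ≤ d / 3 := (min_le_left _ _).trans (min_le_right _ _)
    linarith
  have hp3 : p * (T + 1) ≤ - Real.log ρ := by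
    have : p ≤ - Real.log ρ / (T + 1) := min_le_right _ _
    rwa [le_div_iff₀ (by linarith)] at this
  refine ⟨p, ρ, √(M / β) * (1 / p + D) * C, hp0, hp1, ?_, ?_, by positivity, fun n hn => ?_⟩
  · nlinarith
  · calc ρ * Real.exp (p * T) < ρ * Real.exp (- Real.log ρ) := by
          gcongr; nlinarith
      _ = 1 := by rw [Real.exp_neg, Real.exp_log hρ0]; field_simp
  · have h1 := expMoment_le_sqrt hp0 (w := g n) (ε := M * phi β n) fun a ha => by
      rw [abs_of_nonneg (hg.nonneg n hn a ha)]; exact hg.le n hn a ha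
    refine h1.trans ?_
    have h2 : expMoment (3 * p) (g n) ≤ ENNReal.ofReal D :=
      (expMoment_mono_exponent hp2 _).trans (h n hn)
    refine (mul_le_mul_right (add_le_add le_rfl h2) _).trans ?_
    rw [← ENNReal.ofReal_add (by positivity) hD, ← ENNReal.ofReal_mul (by positivity)]
    refine ENNReal.ofReal_le_ofReal ?_
    have hn0 : (0 : ℝ) < n := by exact_mod_cast (by omega : 0 < n)
    have h3 : √(M * phi β n) ≤ √(M / β) * x ^ n := by
      have : M * phi β n ≤ M / β * (x ^ n) ^ 2 := by
        rw [← pow_mul, mul_comm n 2, pow_mul, hx2]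
        calc M * phi β n ≤ M * (ratio β ^ n / β) := by gcongr; exact phi_le hβ hn
          _ = _ := by ring
      calc _ ≤ √(M / β * (x ^ n) ^ 2) := Real.sqrt_le_sqrt this
        _ = _ := by rw [Real.sqrt_mul (by positivity), Real.sqrt_sq (by positivity)]
    have h4 : x ^ n ≤ C * psi ρ n := by
      have := hC' n
      unfold psi
      rw [mul_div_assoc', le_div_iff₀ hn0]
      linarith
    calc √(M * phi β n) * (1 / p + D) ≤ √(M / β) * (C * psi ρ n) * (1 / p + D) := by
          gcongr; exact h3.trans (by gcongr)
      _ = _ := by ring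

lemma weightBound_nonneg (hβ : 0 < β) (hM : 0 ≤ M) (hc : 0 < c₀) (T : ℝ) :
    0 ≤ weightBound β M c₀ T := by
  unfold weightBound boundaryFlux
  have := phi_pos hβ (n := 2) (by omega)
  have := phi_pos hβ (n := 3) (by omega)
  have := phi_pos hβ (n := 4) (by omega)
  have := phi_pos hβ (n := 5) (by omega)
  positivity

lemma Curve.boundaryFlux_nonneg (hf : Curve β M c₀ g f) (t : ℝ) : 0 ≤ boundaryFlux (f t) := by
  unfold boundaryFlux
  have := hf.nonneg t 2 (by omega) 0
  have := hf.nonneg t 3 (by omega) 0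
  have := hf.nonneg t 4 (by omega) 0
  have := hf.nonneg t 5 (by omega) 0
  positivity

lemma Curve.clipWeight_nonneg (hf : Curve β M c₀ g f) (hc : 0 < c₀) (t : ℝ) :
    0 ≤ clipWeight β c₀ f t :=
  div_nonneg (hf.boundaryFlux_nonneg t) (le_max_of_le_right (by positivity))

lemma Curve.boundaryFlux_le (hf : Curve β M c₀ g f) (t : ℝ) :
    boundaryFlux (f t) ≤ M * boundaryFlux (fun n _ => phi β n) := by
  unfold boundaryFlux
  have := hf.le t 2 (by omega) 0
  have := hf.le t 3 (by omega) 0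
  have := hf.le t 4 (by omega) 0
  have := hf.le t 5 (by omega) 0
  linarith

lemma Curve.clipWeight_le (hf : Curve β M c₀ g f) (hc : 0 < c₀) {t T : ℝ} (h : t ≤ T) :
    clipWeight β c₀ f t ≤ weightBound β M c₀ T := by
  unfold clipWeight weightBound
  have h0 := hf.boundaryFlux_nonneg t
  have h1 := hf.boundaryFlux_le t
  refine div_le_div₀ (h0.trans h1) h1 (by positivity) (le_max_of_le_right ?_)
  exact mul_le_mul_of_nonneg_left (Real.exp_le_exp.2 (by linarith)) hc.le

lemma abs_max_sub_max_le (x y : ℝ) : |max x 0 - max y 0| ≤ |x - y| :=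
  abs_max_sub_max_le_abs x y 0

/-- A one-sided modulus of continuity is a modulus of continuity. -/
lemma abs_sub_le_of_modulus {u : ℝ → ℝ} {ε δ₀ : ℝ}
    (h : ∀ δ, 0 ≤ δ → δ ≤ δ₀ → ∀ a, 0 ≤ a → |u (a + δ) - u a| ≤ ε) {x y : ℝ} (hx : 0 ≤ x)
    (hy : 0 ≤ y) (hxy : |x - y| ≤ δ₀) : |u x - u y| ≤ ε := by
  rcases le_total y x with h1 | h1
  · have := h (x - y) (by linarith) ((le_abs_self _).trans hxy) y hy
    rwa [add_sub_cancel] at this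
  · have := h (y - x) (by linarith) (by rw [abs_sub_comm] at hxy; exact (le_abs_self _).trans hxy)
      x hx
    rwa [add_sub_cancel, abs_sub_comm] at this

/-- Equicontinuity in the area, uniformly up to time `T`. The hypothesis on `f` is the property
`Curve.equi`, stated for a single `T` so that it applies to the image of a curve under the iteration
step before that is known to be a curve. -/
lemma exists_modulus (hβ : 0 < β) (hM : 0 ≤ M) (hc : 0 < c₀) (hg : Data β M g)
    {T : ℝ} {f : ℝ → State}
    (hf : ∀ ε δ : ℝ, 0 ≤ ε → 0 ≤ δ →
    (∀ δ', 0 ≤ δ' → δ' ≤ δ → ∀ n, 2 ≤ n → ∀ a, 0 ≤ a → |g n (a + δ') - g n a| ≤ ε * phi β n) →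
    ∀ t ∈ Icc 0 T, ∀ n, 2 ≤ n → ∀ a, 0 ≤ a → |f t n (a + δ) - f t n a| ≤
      (ε + 7 * (2 * β + 1) * M * weightBound β M c₀ T * δ) * phi β n)
    {ε : ℝ} (hε : 0 < ε) :
    ∃ δ₀ : ℝ, 0 < δ₀ ∧ ∀ δ, 0 ≤ δ → δ ≤ δ₀ → ∀ t ∈ Icc 0 T, ∀ n, 2 ≤ n → ∀ a, 0 ≤ a →
      |f t n (a + δ) - f t n a| ≤ ε * phi β n := by
  obtain ⟨δ₁, hδ₁, h1⟩ := hg.equi (ε / 2) (by positivity)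
  set L := 7 * (2 * β + 1) * M * weightBound β M c₀ T with hL
  have hL0 : 0 ≤ L := by have := weightBound_nonneg hβ hM hc T; positivity
  refine ⟨min δ₁ (ε / (2 * (L + 1))), by positivity, fun δ h0 h2 t ht n hn a ha => ?_⟩
  have h3 := hf (ε / 2) δ (by positivity) h0
    (fun δ' h0' h4 => h1 δ' h0' (h4.trans (h2.trans (min_le_left _ _)))) t ht n hn a ha
  refine h3.trans ?_
  have hφ := (phi_pos hβ hn).le
  gcongr
  have h5 : δ ≤ ε / (2 * (L + 1)) := h2.trans (min_le_right _ _)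
  rw [le_div_iff₀ (by positivity)] at h5
  nlinarith

lemma continuous_of_modulus {u : ℝ → ℝ} (hu : ∀ a, u a = u (max a 0))
    (h : ∀ ε, 0 < ε → ∃ δ₀ : ℝ, 0 < δ₀ ∧ ∀ δ, 0 ≤ δ → δ ≤ δ₀ → ∀ a, 0 ≤ a →
      |u (a + δ) - u a| ≤ ε) : Continuous u := by
  rw [Metric.continuous_iff]
  intro b ε hε
  obtain ⟨δ₀, h0, h1⟩ := h (ε / 2) (by positivity)
  refine ⟨δ₀, h0, fun a hab => ?_⟩
  rw [Real.dist_eq] at hab ⊢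
  rw [hu a, hu b]
  have := abs_sub_le_of_modulus h1 (le_max_right a 0) (le_max_right b 0)
    ((abs_max_sub_max_le a b).trans hab.le)
  linarith

/-- Joint continuity from uniform continuity in time and continuity in the area. -/
lemma continuous_of_timeCont {F : ℝ → ℝ → ℝ} (h1 : ∀ t, Continuous (F t))
    (h2 : ∀ t ε : ℝ, 0 < ε → ∀ᶠ s in 𝓝 t, ∀ a, |F s a - F t a| ≤ ε) :
    Continuous fun p : ℝ × ℝ => F p.1 p.2 := by
  rw [continuous_iff_continuousAt]
  rintro ⟨t, a⟩
  rw [ContinuousAt, Metric.tendsto_nhds]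
  intro ε hε
  have h3 := h2 t (ε / 3) (by positivity)
  have h4 := Metric.tendsto_nhds.1 ((h1 t).tendsto a) (ε / 3) (by positivity)
  rw [nhds_prod_eq]
  filter_upwards [h3.prod_mk h4] with p hp
  have h5 := hp.1 p.2
  have h6 := hp.2
  rw [Real.dist_eq] at h6 ⊢
  calc |F p.1 p.2 - F t a| = |(F p.1 p.2 - F t p.2) + (F t p.2 - F t a)| := by ring_nf
    _ ≤ _ := abs_add_le _ _
    _ < ε := by linarith

lemma Curve.clamp_left (hf : Curve β M c₀ g f) (t : ℝ) : f t = f (max t 0) := by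
  funext n a
  rw [hf.clamp t n a, hf.clamp (max t 0) n a]; simp

lemma Curve.continuous_area (hβ : 0 < β) (hM : 0 ≤ M) (hc : 0 < c₀) (hg : Data β M g)
    (hf : Curve β M c₀ g f) {n : ℕ} (hn : 2 ≤ n) (t : ℝ) : Continuous (f t n) := by
  refine continuous_of_modulus (fun a => by rw [hf.clamp t n a, hf.clamp t n (max a 0)]; simp)
    fun ε hε => ?_
  have hφ := phi_pos hβ hn
  have ht : (0 : ℝ) ≤ max t 0 := le_max_right _ _
  obtain ⟨δ₀, h0, h1⟩ := exists_modulus (ε := ε / phi β n) hβ hM hc hg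
    (fun ε δ => hf.equi (max t 0) ε δ ht) (by positivity)
  refine ⟨δ₀, h0, fun δ h2 h3 a ha => ?_⟩
  have := h1 δ h2 h3 (max t 0) ⟨ht, le_rfl⟩ n hn a ha
  rwa [← hf.clamp_left, div_mul_cancel₀ _ hφ.ne'] at this

lemma Curve.jointCont (hβ : 0 < β) (hM : 0 ≤ M) (hc : 0 < c₀) (hg : Data β M g)
    (hf : Curve β M c₀ g f) : JointCont f := fun n hn =>
  continuous_of_timeCont (fun t => hf.continuous_area hβ hM hc hg hn t) (hf.timeCont n hn)

/-- Geometric decay of the exponential moments, with constants common to all curves. -/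
lemma Curve.exists_moment (hβ : 0 < β) (hM : 0 ≤ M) (hc : 0 < c₀) (hg : Data β M g)
    {T : ℝ} (hT : 0 ≤ T) : ∃ q A ρ : ℝ, 0 < q ∧ q ≤ 1 ∧ 0 ≤ A ∧ ratio β ≤ ρ ∧ ρ < 1 ∧
      ∀ f, Curve β M c₀ g f → ∀ t, t ≤ T → ∀ n, 2 ≤ n →
        expMoment q (f t n) ≤ ENNReal.ofReal (A * psi ρ n) := by
  obtain ⟨p, ρ, D, hp, hp1, hρ, hρ1, hD, h⟩ := hg.exists_moment hβ hM hT
  have hρ0 : 0 < ρ := (ratio_pos hβ).trans_le hρ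
  set C := 2 * (β + 1) * weightBound β M c₀ T with hC
  have hC0 : 0 ≤ C := by have := weightBound_nonneg hβ hM hc T; positivity
  refine ⟨p, Real.exp (C * T) * D, ρ * Real.exp (p * T), hp, hp1, by positivity, ?_, hρ1,
    fun f hf t ht n hn => ?_⟩
  · have : 1 ≤ Real.exp (p * T) := Real.one_le_exp (by positivity)
    nlinarith
  · have ht' : max t 0 ∈ Icc 0 T := ⟨le_max_right _ _, max_le ht hT⟩
    rw [hf.clamp_left]
    refine (hf.moment T p ρ D hT hp.le hρ hρ1.le hD h _ ht' n hn).trans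
      (ENNReal.ofReal_le_ofReal ?_)
    have hψ := psi_nonneg hρ0.le n
    rw [← exp_mul_psi]
    have h1 : Real.exp (C * max t 0) ≤ Real.exp (C * T) := by
      gcongr; exact ht'.2
    have h2 : Real.exp (p * n * max t 0) ≤ Real.exp (p * n * T) := by
      gcongr; exact ht'.2
    calc _ ≤ Real.exp (C * T) * (Real.exp (p * n * T) * (D * psi ρ n)) := by gcongr
      _ = _ := by ring

lemma summable_mul_psi {ρ : ℝ} (h0 : 0 ≤ ρ) (h1 : ρ < 1) (A : ℝ) :
    Summable fun n : ℕ => (n : ℝ) * (A * psi ρ n) := by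
  refine ((summable_geometric_of_lt_one h0 h1).mul_left |A|).of_norm_bounded fun n => ?_
  rcases Nat.eq_zero_or_pos n with rfl | hn
  · simp
  · rw [mul_left_comm, mul_psi ρ hn, norm_mul, Real.norm_eq_abs, Real.norm_eq_abs,
      abs_of_nonneg (pow_nonneg h0 n)]

lemma edgeMoment_lt_top {q A ρ : ℝ} {u : State} (h0 : 0 ≤ ρ) (h1 : ρ < 1) (hA : 0 ≤ A)
    (h : ∀ n, 2 ≤ n → expMoment q (u n) ≤ ENNReal.ofReal (A * psi ρ n)) :
    edgeMoment q u < ⊤ := by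
  refine lt_of_le_of_lt (ENNReal.tsum_le_tsum fun k => mul_le_mul_right (h (k + 2) (by omega)) _) ?_
  have h2 : ∀ k : ℕ, 0 ≤ ((k + 2 : ℕ) : ℝ) * (A * psi ρ (k + 2)) := fun k =>
    mul_nonneg (Nat.cast_nonneg _) (mul_nonneg hA (psi_nonneg h0 _))
  have := tsum_ofReal_lt_top h2 ((summable_nat_add_iff 2).2 (summable_mul_psi h0 h1 A))
  simpa only [← ENNReal.ofReal_mul (Nat.cast_nonneg _)] using this

lemma Curve.measurable (hβ : 0 < β) (hM : 0 ≤ M) (hc : 0 < c₀) (hg : Data β M g)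
    (hf : Curve β M c₀ g f) (t : ℝ) (n : ℕ) (hn : 2 ≤ n) :
    AEStronglyMeasurable (f t n) (volume.restrict (Ioi 0)) :=
  (hf.continuous_area hβ hM hc hg hn t).aestronglyMeasurable

lemma Curve.edgeMoment_lt_top (hβ : 0 < β) (hM : 0 ≤ M) (hc : 0 < c₀) (hg : Data β M g)
    (hf : Curve β M c₀ g f) (t : ℝ) : ∃ q, 0 < q ∧ q ≤ 1 ∧ edgeMoment q (f t) < ⊤ := by
  obtain ⟨q, A, ρ, hq, hq1, hA, hρ, hρ1, h⟩ :=
    Curve.exists_moment hβ hM hc hg (le_max_right t 0)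
  exact ⟨q, hq, hq1, GrainGrowth.edgeMoment_lt_top ((ratio_pos hβ).le.trans hρ) hρ1 hA
    (h f hf t (le_max_left _ _))⟩

lemma edgeMoment_mono_exponent {p q : ℝ} (h : p ≤ q) (u : State) :
    edgeMoment p u ≤ edgeMoment q u :=
  ENNReal.tsum_le_tsum fun _ => mul_le_mul_right (expMoment_mono_exponent h _) _

lemma Curve.edgeMoment_zero_lt_top (hβ : 0 < β) (hM : 0 ≤ M) (hc : 0 < c₀) (hg : Data β M g)
    (hf : Curve β M c₀ g f) (t : ℝ) : edgeMoment 0 (f t) < ⊤ := by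
  obtain ⟨q, hq, -, h⟩ := hf.edgeMoment_lt_top hβ hM hc hg t
  exact (edgeMoment_mono_exponent hq.le _).trans_lt h

lemma Curve.tendsto_edgeMoment (hβ : 0 < β) (hM : 0 ≤ M) (hc : 0 < c₀) (hg : Data β M g)
    (hf : Curve β M c₀ g f) (t : ℝ) :
    ∃ q, 0 < q ∧ q ≤ 1 ∧ Tendsto (fun s => edgeMoment q (f s - f t)) (𝓝 t) (𝓝 0) := by
  have hT : 0 ≤ max t 0 + 1 := by positivity
  obtain ⟨q, A, ρ, hq, hq1, hA, hρ, hρ1, h⟩ := Curve.exists_moment hβ hM hc hg hT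
  have hρ0 : 0 ≤ ρ := (ratio_pos hβ).le.trans hρ
  refine ⟨q / 3, by positivity, by linarith, GrainGrowth.tendsto_edgeMoment (by positivity)
    (E := fun n => 2 * A * psi ρ n)
    (fun n => mul_nonneg (by positivity) (psi_nonneg hρ0 _)) (summable_mul_psi hρ0 hρ1 _)
    (fun n hn ε hε => ?_) ?_⟩
  · filter_upwards [hf.timeCont n hn t ε hε] with s hs a ha using hs a
  · have h1 : ∀ᶠ s in 𝓝 t, s ≤ max t 0 + 1 :=
      Iic_mem_nhds (by have := le_max_left t 0; linarith)
    filter_upwards [h1] with s hs n hn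
    rw [show 3 * (q / 3) = q by ring]
    have e : (f s - f t) n = fun a => f s n a + (-1) * f t n a := by
      funext a; simp [sub_eq_add_neg]
    rw [e]
    refine (expMoment_add_le (hf.continuous_area hβ hM hc hg hn s).measurable).trans ?_
    rw [expMoment_const_mul, abs_neg, abs_one, ENNReal.ofReal_one, one_mul]
    refine (add_le_add (h f hf s hs n hn) (h f hf t (by have := le_max_left t 0; linarith) n
      hn)).trans (le_of_eq ?_)
    have := mul_nonneg hA (psi_nonneg hρ0 n)
    rw [← ENNReal.ofReal_add this this]
    congr 1; ring

lemma Curve.continuous_weightDen (hβ : 0 < β) (hM : 0 ≤ M) (hc : 0 < c₀) (hg : Data β M g)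
    (hf : Curve β M c₀ g f) : Continuous fun t => weightDen β (f t) := by
  rw [continuous_iff_continuousAt]
  intro t
  obtain ⟨q, hq, -, h⟩ := hf.tendsto_edgeMoment hβ hM hc hg t
  rw [ContinuousAt, tendsto_iff_dist_tendsto_zero]
  have h1 : Tendsto (fun s => edgeMoment 0 (f s - f t)) (𝓝 t) (𝓝 0) :=
    tendsto_of_tendsto_of_tendsto_of_le_of_le tendsto_const_nhds h (fun _ => zero_le)
      fun s => edgeMoment_mono_exponent hq.le _
  have h2 := ((ENNReal.tendsto_toReal ENNReal.zero_ne_top).comp h1).const_mul (β + 2)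
  simp only [ENNReal.toReal_zero, mul_zero] at h2
  refine squeeze_zero (fun _ => dist_nonneg) (fun s => ?_) h2
  rw [Real.dist_eq]
  exact abs_weightDen_sub_le hβ (hf.measurable hβ hM hc hg s) (hf.measurable hβ hM hc hg t)
    (hf.edgeMoment_zero_lt_top hβ hM hc hg s) (hf.edgeMoment_zero_lt_top hβ hM hc hg t)

lemma Curve.continuous_clipWeight (hβ : 0 < β) (hM : 0 ≤ M) (hc : 0 < c₀) (hg : Data β M g)
    (hf : Curve β M c₀ g f) : Continuous (clipWeight β c₀ f) := by
  have hj := hf.jointCont hβ hM hc hg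
  have h : ∀ n, 2 ≤ n → Continuous fun t => f t n 0 := fun n hn =>
    hj.comp hn continuous_id continuous_const
  have := h 2 (by omega)
  have := h 3 (by omega)
  have := h 4 (by omega)
  have := h 5 (by omega)
  have := hf.continuous_weightDen hβ hM hc hg
  refine Continuous.div ?_ (by fun_prop) fun t => ?_
  · unfold boundaryFlux; fun_prop
  · exact (lt_max_of_lt_right (by positivity)).ne'

end

/-! ### The iteration step preserves the a priori bounds -/

/-- The gain term of the equation with the clipped weight. -/
noncomputable def stepSource (β c₀ : ℝ) (f : ℝ → State) : ℝ → State :=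
  fun s n a => clipWeight β c₀ f s * gain β (fun m => f s m a) n

/-- One step of the iteration: the loss term is treated as damping, the gain term as a source. -/
noncomputable def step (β c₀ : ℝ) (g : State) (f : ℝ → State) : ℝ → State :=
  dampedSol β (clipWeight β c₀ f) (stepSource β c₀ f) g

section
variable {β M c₀ T : ℝ} {g : State} {f : ℝ → State} {Γ : ℝ → ℝ} {Q : ℝ → State}

lemma JointCont.gain (hf : JointCont f) :
    JointCont fun s n a => GrainGrowth.gain β (fun m => f s m a) n := by
  intro n hn
  unfold GrainGrowth.gain
  have h1 := hf (n + 1) (by omega)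
  by_cases h2 : n = 2
  · simp only [if_pos h2]; fun_prop
  · simp only [if_neg h2]
    have h3 := hf (n - 1) (by omega)
    fun_prop

lemma JointCont.mul_time (hf : JointCont f) (hΓ : Continuous Γ) :
    JointCont fun s n a => Γ s * f s n a := by
  intro n hn
  have := hf n hn
  fun_prop

lemma Curve.jointCont_stepSource (hβ : 0 < β) (hM : 0 ≤ M) (hc : 0 < c₀) (hg : Data β M g)
    (hf : Curve β M c₀ g f) : JointCont (stepSource β c₀ f) :=
  (hf.jointCont hβ hM hc hg).gain.mul_time (hf.continuous_clipWeight hβ hM hc hg)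

lemma Curve.step_solves (hβ : 0 < β) (hM : 0 ≤ M) (hc : 0 < c₀) (hg : Data β M g)
    (hf : Curve β M c₀ g f) (T : ℝ) :
    Solves β T (clipWeight β c₀ f) (stepSource β c₀ f) g (step β c₀ g f) :=
  dampedSol_solves (hf.continuous_clipWeight hβ hM hc hg)
    (hf.jointCont_stepSource hβ hM hc hg) hg.boundary

lemma Curve.stepSource_nonneg (hβ : 0 < β) (hc : 0 < c₀)
    (hf : Curve β M c₀ g f) (s : ℝ) {n : ℕ} (hn : 2 ≤ n) (a : ℝ) : 0 ≤ stepSource β c₀ f s n a :=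
  mul_nonneg (hf.clipWeight_nonneg hc s) (gain_nonneg hβ hn fun m hm => hf.nonneg s m hm a)

lemma Curve.stepSource_le (hβ : 0 < β) (hc : 0 < c₀)
    (hf : Curve β M c₀ g f) (s : ℝ) {n : ℕ} (hn : 2 ≤ n) (a : ℝ) :
    stepSource β c₀ f s n a ≤ clipWeight β c₀ f s * (lam β n * (M * phi β n)) := by
  refine mul_le_mul_of_nonneg_left ?_ (hf.clipWeight_nonneg hc s)
  refine (gain_mono hβ hn fun m hm => hf.le s m hm a).trans (le_of_eq ?_)
  rw [gain_const_mul, gain_phi hβ hn]; ring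

lemma step_clamp (t : ℝ) (n : ℕ) (a : ℝ) :
    step β c₀ g f t n a = step β c₀ g f (max t 0) n (max a 0) := dampedSol_clamp t n a

lemma Curve.step_nonneg (hβ : 0 < β) (hM : 0 ≤ M) (hc : 0 < c₀) (hg : Data β M g)
    (hf : Curve β M c₀ g f) (t : ℝ) (n : ℕ) (hn : 2 ≤ n) (a : ℝ) : 0 ≤ step β c₀ g f t n a := by
  rw [step_clamp]
  exact (hf.step_solves hβ hM hc hg (max t 0)).nonneg hn ⟨le_max_right _ _, le_rfl⟩
    (hg.nonneg n hn) (fun s _ a _ => hf.stepSource_nonneg hβ hc s hn a) (le_max_right _ _)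

lemma Curve.step_le (hβ : 0 < β) (hM : 0 ≤ M) (hc : 0 < c₀) (hg : Data β M g)
    (hf : Curve β M c₀ g f) (t : ℝ) (n : ℕ) (hn : 2 ≤ n) (a : ℝ) :
    step β c₀ g f t n a ≤ M * phi β n := by
  rw [step_clamp]
  have hφ := (phi_pos hβ hn).le
  have := (hf.step_solves hβ hM hc hg (max t 0)).abs_le (B := M * phi β n) (C := 0)
    (hf.continuous_clipWeight hβ hM hc hg) hn ⟨le_max_right _ _, le_rfl⟩ (by positivity)
    (fun a ha => by rw [abs_of_nonneg (hg.nonneg n hn a ha)]; exact hg.le n hn a ha)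
    (fun s _ a _ => by
      rw [abs_of_nonneg (hf.stepSource_nonneg hβ hc s hn a)]
      refine (hf.stepSource_le hβ hc s hn a).trans (le_of_eq ?_)
      simp; ring) (le_max_right a 0)
  refine (le_abs_self _).trans (this.trans ?_)
  simp

/-- Without damping, a solution changes along a characteristic at most at the rate of its source. -/
lemma Solves.abs_sub_foot_le (h : Solves β T (fun _ => 0) Q g f) {n : ℕ} (hn : 2 ≤ n)
    {τ t a B : ℝ} (h0 : 0 ≤ τ) (h1 : τ ≤ t) (h2 : t ≤ T) (h3 : 0 ≤ a)
    (h4 : 0 ≤ a - ((n : ℝ) - 6) * (t - τ))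
    (hB : ∀ s ∈ Icc τ t, ∀ a, 0 ≤ a → |Q s n a| ≤ B) :
    |f t n a - f τ n (a - ((n : ℝ) - 6) * (t - τ))| ≤ B * (t - τ) := by
  rw [h.duhamel n hn τ t a h0 h1 h2 h3 h4]
  simp only [damp, intervalIntegral.integral_zero, mul_zero, sub_zero, Real.exp_zero, one_mul,
    add_sub_cancel_left]
  have := intervalIntegral.norm_integral_le_of_norm_le_const (a := τ) (b := t) (C := B)
    (f := fun s => Q s n (a - ((n : ℝ) - 6) * (t - s))) fun s hs => by
      rw [uIoc_of_le h1] at hs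
      exact hB s ⟨hs.1.le, hs.2⟩ _ (foot_nonneg h3 h4 ⟨hs.1.le, hs.2⟩)
  rwa [Real.norm_eq_abs, abs_of_nonneg (sub_nonneg.2 h1)] at this

/-- The step solves the undamped transport equation with a bounded source. -/
lemma Curve.step_undamped (hβ : 0 < β) (hM : 0 ≤ M) (hc : 0 < c₀) (hg : Data β M g)
    (hf : Curve β M c₀ g f) (T : ℝ) : ∃ Q, Solves β T (fun _ => 0) Q g (step β c₀ g f) ∧
      ∀ s, s ≤ T → ∀ n, 2 ≤ n → ∀ a, |Q s n a| ≤
        lam β n * weightBound β M c₀ T * (M * phi β n) := by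
  refine ⟨_, (hf.step_solves hβ hM hc hg T).change_damping
    (hf.continuous_clipWeight hβ hM hc hg) continuous_const
    (hf.jointCont_stepSource hβ hM hc hg), fun s hs n hn a => ?_⟩
  have hφ : 0 ≤ M * phi β n := mul_nonneg hM (phi_pos hβ hn).le
  have hΓ0 := hf.clipWeight_nonneg hc s
  have hΓ1 := hf.clipWeight_le hc hs
  have hl := lam_nonneg hβ n
  have h1 := hf.stepSource_nonneg hβ hc s hn a
  have h2 := hf.stepSource_le hβ hc s hn a
  have h3 := hf.step_nonneg hβ hM hc hg s n hn a
  have h4 := hf.step_le hβ hM hc hg s n hn a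
  have h5 : 0 ≤ lam β n * clipWeight β c₀ f s * step β c₀ g f s n a := by positivity
  have h6 : lam β n * clipWeight β c₀ f s * step β c₀ g f s n a ≤
      lam β n * clipWeight β c₀ f s * (M * phi β n) := by gcongr
  have h7 : lam β n * clipWeight β c₀ f s * (M * phi β n) ≤
      lam β n * weightBound β M c₀ T * (M * phi β n) := by gcongr
  rw [abs_le]
  constructor <;> nlinarith

/-- Near the boundary the densities of the classes `n > 6` are small. -/
lemma Curve.step_boundary_layer (hβ : 0 < β) (hM : 0 ≤ M) (hc : 0 < c₀) (hg : Data β M g)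
    (hf : Curve β M c₀ g f) {T ε δ : ℝ} (hε : 0 ≤ ε) (hδ : 0 ≤ δ)
    (h : ∀ δ', 0 ≤ δ' → δ' ≤ δ → ∀ n, 2 ≤ n → ∀ a, 0 ≤ a →
      |g n (a + δ') - g n a| ≤ ε * phi β n) {t : ℝ} (ht : t ∈ Icc 0 T) {n : ℕ} (hn : 6 < n) :
    |step β c₀ g f t n δ| ≤ (ε + 7 * (2 * β + 1) * M * weightBound β M c₀ T * δ) * phi β n := by
  have hn2 : 2 ≤ n := by omega
  have hn7 : (7 : ℝ) ≤ n := by exact_mod_cast hn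
  obtain ⟨Q, hS, hQ⟩ := hf.step_undamped hβ hM hc hg T
  obtain ⟨σ, hσ, h1, h2⟩ := exists_entry (n := n) ht.1 hδ
  have h3 := hS.abs_sub_foot_le hn2 hσ.1 hσ.2 ht.2 hδ h1
    (fun s hs a _ => hQ s (hs.2.trans ht.2) n hn2 a)
  have hφ := (phi_pos hβ hn2).le
  have hW := weightBound_nonneg hβ hM hc T
  have h4 : |step β c₀ g f σ n (δ - ((n : ℝ) - 6) * (t - σ))| ≤ ε * phi β n := by
    rcases h2 with rfl | ⟨-, -, h5⟩
    · rw [hS.init n hn2 _ h1]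
      have h6 := h (δ - ((n : ℝ) - 6) * (t - 0)) h1 (by nlinarith [ht.1]) n hn2 0 le_rfl
      rwa [zero_add, hg.boundary n hn, sub_zero] at h6
    · rw [h5, hS.boundary n hn σ ⟨hσ.1, hσ.2.trans ht.2⟩, abs_zero]; positivity
  -- the speed `n - 6` is at least `n / 7` for `n ≥ 7`, so that the time spent in the layer
  -- compensates the factor `n` in the source
  have h5 : lam β n * (t - σ) ≤ 7 * (2 * β + 1) * δ := by
    have h6 : lam β n * (t - σ) ≤ (2 * β + 1) * n * (t - σ) :=
      mul_le_mul_of_nonneg_right (lam_le hβ n) (sub_nonneg.2 hσ.2)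
    have h7 : (n : ℝ) * (t - σ) ≤ 7 * δ := by nlinarith [sub_nonneg.2 hσ.2]
    nlinarith
  have h6 : lam β n * weightBound β M c₀ T * (M * phi β n) * (t - σ) ≤
      7 * (2 * β + 1) * M * weightBound β M c₀ T * δ * phi β n := by
    have := mul_le_mul_of_nonneg_left h5
      (by positivity : 0 ≤ weightBound β M c₀ T * M * phi β n)
    linarith
  have h7 := abs_add_le (step β c₀ g f t n δ - step β c₀ g f σ n (δ - ((n : ℝ) - 6) * (t - σ)))
    (step β c₀ g f σ n (δ - ((n : ℝ) - 6) * (t - σ)))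
  rw [sub_add_cancel] at h7
  linarith

/-- The difference between the solution and its translate satisfies the same damped equation along
characteristics. Its source is controlled by `Curve.equi` for the given curve, its initial values
by the modulus of `g`, and its boundary values by `Curve.step_boundary_layer`; so the multiple of
the equilibrium `φ` is again a supersolution. -/
lemma Curve.step_equi (hβ : 0 < β) (hM : 0 ≤ M) (hc : 0 < c₀) (hg : Data β M g)
    (hf : Curve β M c₀ g f) (T ε δ : ℝ) (hT : 0 ≤ T) (hε : 0 ≤ ε) (hδ : 0 ≤ δ)
    (h : ∀ δ', 0 ≤ δ' → δ' ≤ δ → ∀ n, 2 ≤ n → ∀ a, 0 ≤ a →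
      |g n (a + δ') - g n a| ≤ ε * phi β n) (t : ℝ) (ht : t ∈ Icc 0 T) (n : ℕ) (hn : 2 ≤ n)
    (a : ℝ) (ha : 0 ≤ a) : |step β c₀ g f t n (a + δ) - step β c₀ g f t n a| ≤
      (ε + 7 * (2 * β + 1) * M * weightBound β M c₀ T * δ) * phi β n := by
  set E := ε + 7 * (2 * β + 1) * M * weightBound β M c₀ T * δ with hE
  have hW := weightBound_nonneg hβ hM hc T
  have hφ := (phi_pos hβ hn).le
  have hE0 : ε ≤ E := by rw [hE]; have : 0 ≤ 7 * (2 * β + 1) * M * weightBound β M c₀ T * δ := by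
                          positivity
                         linarith
  have hS := hf.step_solves hβ hM hc hg T
  have hΓ := hf.continuous_clipWeight hβ hM hc hg
  have hd := continuous_damp (β := β) hΓ n
  have hQ := hf.jointCont_stepSource hβ hM hc hg
  obtain ⟨σ, hσ, h1, h2⟩ := exists_entry (n := n) ht.1 ha
  have e1 : a + δ - ((n : ℝ) - 6) * (t - σ) = a - ((n : ℝ) - 6) * (t - σ) + δ := by ring
  rw [hS.duhamel n hn σ t a hσ.1 hσ.2 ht.2 ha h1,
    hS.duhamel n hn σ t (a + δ) hσ.1 hσ.2 ht.2 (by positivity) (by rw [e1]; positivity), e1,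
    add_sub_add_comm, ← mul_sub, ← intervalIntegral.integral_sub
      (Continuous.intervalIntegrable ?_ _ _) (Continuous.intervalIntegrable ?_ _ _)]
  rotate_left
  · exact Continuous.mul (by fun_prop) (hQ.comp hn continuous_id (by fun_prop))
  · exact Continuous.mul (by fun_prop) (hQ.comp hn continuous_id (by fun_prop))
  simp only [← mul_sub]
  have key := abs_damped_le (K := damp β (clipWeight β c₀ f) n)
    (κ := fun s => lam β n * clipWeight β c₀ f s)
    (q := fun s => stepSource β c₀ f s n (a + δ - ((n : ℝ) - 6) * (t - s)) -
      stepSource β c₀ f s n (a - ((n : ℝ) - 6) * (t - s)))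
    (y₀ := step β c₀ g f σ n (a - ((n : ℝ) - 6) * (t - σ) + δ) -
      step β c₀ g f σ n (a - ((n : ℝ) - 6) * (t - σ)))
    (hasDerivAt_damp hΓ n) (by fun_prop) (B := E * phi β n) (C := 0) hσ.2 ?_ fun s hs => ?_
  · simpa only [zero_mul, Real.exp_zero, one_mul] using key
  · rw [zero_mul, Real.exp_zero, one_mul]
    rcases h2 with rfl | ⟨h3, -, h4⟩
    · rw [hS.init n hn _ h1, hS.init n hn _ (by positivity)]
      refine (h δ hδ le_rfl n hn _ h1).trans (by gcongr)
    · have hσT : σ ∈ Icc 0 T := ⟨hσ.1, hσ.2.trans ht.2⟩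
      rw [h4, zero_add, hS.boundary n h3 σ hσT, sub_zero]
      exact hf.step_boundary_layer hβ hM hc hg hε hδ h hσT h3
  · have h3 := foot_nonneg ha h1 hs
    have h4 := hf.clipWeight_nonneg hc s
    have e2 : a + δ - ((n : ℝ) - 6) * (t - s) = a - ((n : ℝ) - 6) * (t - s) + δ := by ring
    have hs' : s ∈ Icc 0 T := ⟨hσ.1.trans hs.1, hs.2.trans ht.2⟩
    rw [e2]
    unfold stepSource
    rw [← mul_sub, ← gain_sub, abs_mul, abs_of_nonneg h4]
    have := abs_gain_le (v := fun m => E * phi β m) hβ hn fun m hm =>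
      hf.equi T ε δ hT hε hδ h s hs' m hm _ h3
    rw [gain_const_mul, gain_phi hβ hn] at this
    calc _ ≤ clipWeight β c₀ f s * (E * (lam β n * phi β n)) := by gcongr
      _ = _ := by simp; ring

/-- Continuity in time follows from that in the area, since the solution changes little along
characteristics, and on the boundary `a = 0` it vanishes at both times. -/
lemma Curve.step_timeCont (hβ : 0 < β) (hM : 0 ≤ M) (hc : 0 < c₀) (hg : Data β M g)
    (hf : Curve β M c₀ g f) (n : ℕ) (hn : 2 ≤ n) (t₀ ε : ℝ) (hε : 0 < ε) :
    ∀ᶠ s in 𝓝 t₀, ∀ a, |step β c₀ g f s n a - step β c₀ g f t₀ n a| ≤ ε := by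
  set T := max t₀ 0 + 1 with hT
  have hφ := phi_pos hβ hn
  obtain ⟨δ₀, hδ₀, h1⟩ := exists_modulus (T := T) (f := step β c₀ g f) (ε := ε / 2 / phi β n)
    hβ hM hc hg (fun ε δ => hf.step_equi hβ hM hc hg T ε δ (by positivity)) (by positivity)
  obtain ⟨Q, hS, hQ⟩ := hf.step_undamped hβ hM hc hg T
  set B := lam β n * weightBound β M c₀ T * (M * phi β n) with hB
  have hB0 : 0 ≤ B := by
    have := weightBound_nonneg hβ hM hc T
    have := lam_nonneg hβ n
    positivity
  set η := min 1 (min (δ₀ / (|(n : ℝ) - 6| + 1)) (ε / 2 / (B + 1))) with hη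
  have hη0 : 0 < η := by positivity
  have hη1 : |(n : ℝ) - 6| * η ≤ δ₀ := by
    have : η ≤ δ₀ / (|(n : ℝ) - 6| + 1) := (min_le_right _ _).trans (min_le_left _ _)
    rw [le_div_iff₀ (by positivity)] at this
    nlinarith
  have hη2 : B * η ≤ ε / 2 := by
    have : η ≤ ε / 2 / (B + 1) := (min_le_right _ _).trans (min_le_right _ _)
    rw [le_div_iff₀ (by positivity)] at this
    nlinarith
  have core : ∀ s t, 0 ≤ s → s ≤ t → t ≤ T → t - s ≤ η → ∀ a, 0 ≤ a →
      |step β c₀ g f t n a - step β c₀ g f s n a| ≤ ε := by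
    intro s t hs hst htT hd a ha
    obtain ⟨σ, hσ, h2, h3⟩ := exists_entry (n := n) hst ha
    have h4 := hS.abs_sub_foot_le hn (hs.trans hσ.1) hσ.2 htT ha h2
      (fun s hs a _ => hQ s (hs.2.trans htT) n hn a)
    have h5 : B * (t - σ) ≤ ε / 2 :=
      (mul_le_mul_of_nonneg_left (by linarith [hσ.1]) hB0).trans hη2
    have hmod : ∀ x y, 0 ≤ x → 0 ≤ y → |x - y| ≤ δ₀ →
        |step β c₀ g f s n x - step β c₀ g f s n y| ≤ ε / 2 := fun x y hx hy hxy =>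
      abs_sub_le_of_modulus (fun δ h0 h1' a ha => by
        have := h1 δ h0 h1' s ⟨hs, hst.trans htT⟩ n hn a ha
        rwa [div_mul_cancel₀ _ hφ.ne'] at this) hx hy hxy
    have h6 : |((n : ℝ) - 6) * (t - σ)| ≤ δ₀ := by
      rw [abs_mul, abs_of_nonneg (sub_nonneg.2 hσ.2)]
      exact (mul_le_mul_of_nonneg_left (by linarith [hσ.1]) (abs_nonneg _)).trans hη1
    have h7 : |step β c₀ g f σ n (a - ((n : ℝ) - 6) * (t - σ)) - step β c₀ g f s n a| ≤ ε / 2 := by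
      rcases h3 with rfl | ⟨h8, -, h9⟩
      · refine hmod _ _ h2 ha ?_
        rwa [sub_sub_cancel_left, abs_neg]
      · rw [h9, hS.boundary n h8 σ ⟨hs.trans hσ.1, hσ.2.trans htT⟩,
          ← hS.boundary n h8 s ⟨hs, hst.trans htT⟩]
        refine hmod _ _ le_rfl ha ?_
        rwa [zero_sub, abs_neg, show a = ((n : ℝ) - 6) * (t - σ) by linarith]
    calc _ = |(step β c₀ g f t n a - step β c₀ g f σ n (a - ((n : ℝ) - 6) * (t - σ))) +
          (step β c₀ g f σ n (a - ((n : ℝ) - 6) * (t - σ)) - step β c₀ g f s n a)| := by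
          congr 1; ring
      _ ≤ _ := abs_add_le _ _
      _ ≤ ε := by linarith
  filter_upwards [Metric.ball_mem_nhds t₀ hη0] with s hs a
  rw [Metric.mem_ball, Real.dist_eq] at hs
  have h2 := (abs_max_sub_max_le s t₀).trans hs.le
  rw [step_clamp s, step_clamp t₀]
  have h3 : η ≤ 1 := min_le_left _ _
  have h4 := abs_le.1 h2
  rcases le_total (max s 0) (max t₀ 0) with h | h
  · rw [abs_sub_comm]
    exact core _ _ (le_max_right _ _) h (by linarith) (by linarith) _ (le_max_right _ _)
  · exact core _ _ (le_max_right _ _) h (by linarith) (by linarith) _ (le_max_right _ _)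

lemma Curve.step_jointCont (hβ : 0 < β) (hM : 0 ≤ M) (hc : 0 < c₀) (hg : Data β M g)
    (hf : Curve β M c₀ g f) : JointCont (step β c₀ g f) := by
  intro n hn
  have hφ := phi_pos hβ hn
  refine continuous_of_timeCont (fun t => continuous_of_modulus (fun a => by
    rw [step_clamp t n a, step_clamp t n (max a 0)]; simp) fun ε hε => ?_)
    (hf.step_timeCont hβ hM hc hg n hn)
  have ht : (0 : ℝ) ≤ max t 0 := le_max_right _ _
  obtain ⟨δ₀, h0, h1⟩ := exists_modulus (T := max t 0) (f := step β c₀ g f)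
    (ε := ε / phi β n) hβ hM hc hg
    (fun ε δ => hf.step_equi hβ hM hc hg (max t 0) ε δ ht) (by positivity)
  refine ⟨δ₀, h0, fun δ h2 h3 a ha => ?_⟩
  have := h1 δ h2 h3 (max t 0) ⟨ht, le_rfl⟩ n hn a ha
  rw [div_mul_cancel₀ _ hφ.ne'] at this
  rw [step_clamp t n a, step_clamp t n (a + δ), max_eq_left ha,
    max_eq_left (add_nonneg ha h2)]
  exact this

/-- The bound propagates because `ψ(ρ e^{ps})` remains a supersolution as long as `ρ e^{ps} ≤ 1`. -/
lemma Curve.step_moment (hβ : 0 < β) (hM : 0 ≤ M) (hc : 0 < c₀) (hg : Data β M g)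
    (hf : Curve β M c₀ g f) (T p ρ D : ℝ) (hT : 0 ≤ T) (hp : 0 ≤ p) (hρ : ratio β ≤ ρ)
    (hρT : ρ * Real.exp (p * T) ≤ 1) (hD : 0 ≤ D)
    (h : ∀ n, 2 ≤ n → expMoment p (g n) ≤ ENNReal.ofReal (D * psi ρ n))
    (t : ℝ) (ht : t ∈ Icc 0 T) (n : ℕ) (hn : 2 ≤ n) : expMoment p (step β c₀ g f t n) ≤
      ENNReal.ofReal (Real.exp (2 * (β + 1) * weightBound β M c₀ T * t) *
        (Real.exp (p * n * t) * (D * psi ρ n))) := by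
  set C := 2 * (β + 1) * weightBound β M c₀ T with hC
  have hW := weightBound_nonneg hβ hM hc T
  have hρ0 : 0 < ρ := (ratio_pos hβ).trans_le hρ
  have hψ := fun m => psi_nonneg hρ0.le m
  have hl := lam_nonneg hβ n
  refine (hf.step_solves hβ hM hc hg T).expMoment_le (hf.continuous_clipWeight hβ hM hc hg)
    (hf.jointCont_stepSource hβ hM hc hg) (hf.step_jointCont hβ hM hc hg) hn ht hp
    (mul_nonneg hD (hψ n)) (fun s _ => ?_) (h n hn) fun s hs => ?_
  · have := hf.clipWeight_nonneg hc s; positivity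
  · have hs' : s ∈ Icc 0 T := ⟨hs.1, hs.2.trans ht.2⟩
    have hΓ0 := hf.clipWeight_nonneg hc s
    have hΓ1 := hf.clipWeight_le hc hs'.2
    have h1 := expMoment_gain_le (p := p) (u := f s)
      (b := fun m => (Real.exp (C * s) * D) * psi (ρ * Real.exp (p * s)) m) hβ hn
      (fun m hm => (hf.continuous_area hβ hM hc hg hm s).measurable)
      (fun m _ => mul_nonneg (by positivity) (psi_nonneg (by positivity) m)) fun m hm => by
        refine (hf.moment T p ρ D hT hp hρ hρT hD h s hs' m hm).trans (le_of_eq ?_)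
        rw [← exp_mul_psi]; congr 1; ring
    have e : stepSource β c₀ f s n =
        fun a => clipWeight β c₀ f s * gain β (fun m => f s m a) n := rfl
    rw [e, expMoment_const_mul, abs_of_nonneg hΓ0]
    refine (mul_le_mul_right h1 _).trans ?_
    rw [← ENNReal.ofReal_mul hΓ0, gain_const_mul]
    refine ENNReal.ofReal_le_ofReal ?_
    have h2 : ρ * Real.exp (p * s) ≤ 1 := by
      refine le_trans ?_ hρT
      gcongr
      exact hs'.2
    have h3 : ratio β ≤ ρ * Real.exp (p * s) := by
      have : 1 ≤ Real.exp (p * s) := Real.one_le_exp (mul_nonneg hp hs.1)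
      nlinarith
    have h4 := gain_psi_le hβ h3 h2 hn
    rw [← exp_mul_psi] at h4
    have h5 : clipWeight β c₀ f s * (lam β n + 2 * (β + 1)) ≤
        lam β n * clipWeight β c₀ f s + C := by
      rw [hC]; nlinarith
    have h6 : 0 ≤ Real.exp (C * s) * D * (Real.exp (p * n * s) * psi ρ n) := by
      have := hψ n; positivity
    calc _ ≤ clipWeight β c₀ f s * (Real.exp (C * s) * D *
          ((lam β n + 2 * (β + 1)) * (Real.exp (p * n * s) * psi ρ n))) := by
          gcongr
      _ = clipWeight β c₀ f s * (lam β n + 2 * (β + 1)) *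
          (Real.exp (C * s) * D * (Real.exp (p * n * s) * psi ρ n)) := by ring
      _ ≤ (lam β n * clipWeight β c₀ f s + C) *
          (Real.exp (C * s) * D * (Real.exp (p * n * s) * psi ρ n)) := by gcongr
      _ = _ := by ring

/-- The iteration maps the class of curves into itself. -/
theorem Curve.step (hβ : 0 < β) (hM : 0 ≤ M) (hc : 0 < c₀) (hg : Data β M g)
    (hf : Curve β M c₀ g f) : Curve β M c₀ g (step β c₀ g f) where
  clamp := step_clamp
  nonneg := hf.step_nonneg hβ hM hc hg
  le := hf.step_le hβ hM hc hg
  equi := hf.step_equi hβ hM hc hg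
  timeCont := hf.step_timeCont hβ hM hc hg
  moment := hf.step_moment hβ hM hc hg

end

/-! ### The contraction estimate -/

/-- A common bound for the supremum norm and the `L¹` norm of a function on `[0, ∞)`. The numerator
of the coupling weight is controlled by the former, its denominator by the latter. -/
def Bounded (u : ℝ → ℝ) (b : ℝ) : Prop :=
  (∀ a, 0 ≤ a → |u a| ≤ b) ∧ expMoment 0 u ≤ ENNReal.ofReal b

section
variable {β M c₀ T : ℝ} {g : State} {f : ℝ → State} {Γ : ℝ → ℝ} {Q : ℝ → State}

lemma Bounded.nonneg {u : ℝ → ℝ} {b : ℝ} (h : Bounded u b) : 0 ≤ b :=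
  (abs_nonneg _).trans (h.1 0 le_rfl)

lemma Bounded.mono {u : ℝ → ℝ} {b b' : ℝ} (h : Bounded u b) (hb : b ≤ b') : Bounded u b' :=
  ⟨fun a ha => (h.1 a ha).trans hb, h.2.trans (ENNReal.ofReal_le_ofReal hb)⟩

lemma Bounded.congr {u v : ℝ → ℝ} {b : ℝ} (h : Bounded u b) (huv : ∀ a, 0 ≤ a → u a = v a) :
    Bounded v b :=
  ⟨fun a ha => by rw [← huv a ha]; exact h.1 a ha, by rw [← expMoment_congr huv]; exact h.2⟩

lemma Bounded.add {u v : ℝ → ℝ} {b c : ℝ} (h : Bounded u b) (h' : Bounded v c)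
    (hu : Measurable u) : Bounded (fun a => u a + v a) (b + c) := by
  refine ⟨fun a ha => (abs_add_le _ _).trans (add_le_add (h.1 a ha) (h'.1 a ha)),
    (expMoment_add_le hu).trans ?_⟩
  rw [ENNReal.ofReal_add h.nonneg h'.nonneg]
  exact add_le_add h.2 h'.2

lemma Bounded.const_mul {u : ℝ → ℝ} {b : ℝ} (h : Bounded u b) (c : ℝ) :
    Bounded (fun a => c * u a) (|c| * b) := by
  refine ⟨fun a ha => ?_, ?_⟩
  · rw [abs_mul]; exact mul_le_mul_of_nonneg_left (h.1 a ha) (abs_nonneg _)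
  · rw [expMoment_const_mul, ENNReal.ofReal_mul (abs_nonneg _)]
    exact mul_le_mul_right h.2 _

lemma Bounded.neg {u : ℝ → ℝ} {b : ℝ} (h : Bounded u b) : Bounded (fun a => - u a) b := by
  simpa using h.const_mul (-1)

lemma Bounded.sub {u v : ℝ → ℝ} {b c : ℝ} (h : Bounded u b) (h' : Bounded v c)
    (hu : Measurable u) : Bounded (fun a => u a - v a) (b + c) := by
  simpa only [sub_eq_add_neg] using h.add h'.neg hu

lemma Bounded.gain (hβ : 0 < β) {u : State} {b : ℕ → ℝ} {n : ℕ} (hn : 2 ≤ n)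
    (hu : ∀ m, 2 ≤ m → Measurable (u m)) (h : ∀ m, 2 ≤ m → Bounded (u m) (b m)) :
    Bounded (fun a => GrainGrowth.gain β (fun m => u m a) n) (GrainGrowth.gain β b n) :=
  ⟨fun a ha => abs_gain_le hβ hn fun m hm => (h m hm).1 a ha,
    expMoment_gain_le hβ hn hu (fun m hm => (h m hm).nonneg) fun m hm => (h m hm).2⟩

/-- The `L¹` part of a bound passes to pointwise limits by Fatou's lemma. -/
lemma expMoment_le_of_tendsto {p : ℝ} {u : ℕ → ℝ → ℝ} {v : ℝ → ℝ} {C : ℝ≥0∞}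
    (hu : ∀ j, Measurable (u j)) (hv : ∀ a, Tendsto (fun j => u j a) atTop (𝓝 (v a)))
    (h : ∀ j, expMoment p (u j) ≤ C) : expMoment p v ≤ C := by
  have e : expMoment p v = ∫⁻ a in Ioi (0 : ℝ), liminf (fun j =>
      ENNReal.ofReal (Real.exp (p * a)) * ENNReal.ofReal |u j a|) atTop := by
    unfold expMoment
    refine lintegral_congr fun a => (Tendsto.liminf_eq ?_).symm
    exact ENNReal.Tendsto.const_mul
      ((ENNReal.continuous_ofReal.tendsto _).comp (hv a).abs) (Or.inr ENNReal.ofReal_ne_top)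
  rw [e]
  refine (lintegral_liminf_le fun j => by have := hu j; fun_prop).trans ?_
  exact liminf_le_of_le (by isBoundedDefault) fun b hb => by
    obtain ⟨j, hj⟩ := hb.exists
    exact hj.trans (h j)

lemma Bounded.of_tendsto {u : ℕ → ℝ → ℝ} {v : ℝ → ℝ} {b : ℝ}
    (hu : ∀ j, Measurable (u j)) (hv : ∀ a, Tendsto (fun j => u j a) atTop (𝓝 (v a)))
    (h : ∀ j, Bounded (u j) b) : Bounded v b :=
  ⟨fun a ha => le_of_tendsto (hv a).abs (Eventually.of_forall fun j => (h j).1 a ha),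
    expMoment_le_of_tendsto hu hv fun j => (h j).2⟩

/-- Comparison in both norms at once, for zero initial values. -/
lemma Solves.bounded (h : Solves β T Γ Q g f) (hΓ : Continuous Γ) (hQ : JointCont Q)
    (hf : JointCont f) (hg : ∀ n, 2 ≤ n → ∀ a, 0 ≤ a → g n a = 0)
    {n : ℕ} (hn : 2 ≤ n) {t B C : ℝ} (ht : t ∈ Icc 0 T) (hB : 0 ≤ B)
    (hκ : ∀ s ∈ Icc 0 t, 0 ≤ lam β n * Γ s + C)
    (hb : ∀ s ∈ Icc 0 t, Bounded (Q s n) ((lam β n * Γ s + C) * Real.exp (C * s) * B)) :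
    Bounded (f t n) (Real.exp (C * t) * B) := by
  have h0 : expMoment 0 (g n) = 0 := by
    rw [expMoment_congr (hg n hn)]; simp [expMoment]
  refine ⟨fun a ha => h.abs_le hΓ hn ht hB (fun a ha => by rw [hg n hn a ha, abs_zero]; exact hB)
    (fun s hs => (hb s hs).1) ha, ?_⟩
  simpa using h.expMoment_le (p := 0) hΓ hQ hf hn ht le_rfl hB hκ (by rw [h0]; exact zero_le)
    (fun s hs => by simpa using (hb s hs).2)

/-- The contraction estimate: if `w` is driven by the gain of `v` and a remainder, both growing at
most like `e^{Ks}`, then `w` is smaller than `v` by the factor `θ` in the weighted norms. The gain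
is dominated by the damping with the factor `θ`, except for the term `2 (β + 1) Γ`, which together
with the remainder is absorbed by the growth rate `K`. -/
lemma Solves.contract (hβ : 0 < β) {w v R : ℝ → State} {ρ θ K W C D : ℝ} (hρ : 0 < ρ)
    (hθ : 0 < θ)
    (hψ : ∀ n, 2 ≤ n → gain β (psi ρ) n ≤ (θ * lam β n + 2 * (β + 1)) * psi ρ n)
    (hK : 2 * (β + 1) * W + C ≤ K * θ) (hK0 : 0 ≤ K)
    (h : Solves β T Γ (fun s n a => Γ s * gain β (fun m => v s m a) n + R s n a) g w)
    (hg : ∀ n, 2 ≤ n → ∀ a, 0 ≤ a → g n a = 0) (hΓ : Continuous Γ)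
    (hΓ0 : ∀ s ∈ Icc 0 T, 0 ≤ Γ s) (hΓ1 : ∀ s ∈ Icc 0 T, Γ s ≤ W)
    (hv : JointCont v) (hR : JointCont R) (hw : JointCont w) (hD : 0 ≤ D)
    (hvb : ∀ s ∈ Icc 0 T, ∀ n, 2 ≤ n → Bounded (v s n) (D * Real.exp (K * s) * psi ρ n))
    (hRb : ∀ s ∈ Icc 0 T, ∀ n, 2 ≤ n → Bounded (R s n) (C * (D * Real.exp (K * s)) * psi ρ n)) :
    ∀ t ∈ Icc 0 T, ∀ n, 2 ≤ n → Bounded (w t n) (θ * D * Real.exp (K * t) * psi ρ n) := by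
  intro t ht n hn
  have hl := lam_nonneg hβ n
  have hψ0 := psi_nonneg hρ.le n
  have hvc : JointCont fun s n a => Γ s * gain β (fun m => v s m a) n := hv.gain.mul_time hΓ
  have hQ : JointCont fun s n a => Γ s * gain β (fun m => v s m a) n + R s n a :=
    fun n hn => (hvc n hn).add (hR n hn)
  have key := h.bounded hΓ hQ hw hg hn (B := θ * D * psi ρ n) (C := K) ht (by positivity)
    (fun s hs => by have := hΓ0 s ⟨hs.1, hs.2.trans ht.2⟩; positivity) fun s hs => by
      have hs' : s ∈ Icc 0 T := ⟨hs.1, hs.2.trans ht.2⟩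
      have h0 := hΓ0 s hs'
      have h1 := hΓ1 s hs'
      have hm : ∀ m, 2 ≤ m → Measurable (v s m) := fun m hm =>
        (hv.comp hm continuous_const continuous_id).measurable
      have h2 := ((Bounded.gain (β := β) hβ hn hm (hvb s hs')).const_mul (Γ s)).add
        (hRb s hs' n hn) (hvc.comp hn continuous_const continuous_id).measurable
      refine h2.mono ?_
      rw [gain_const_mul, abs_of_nonneg h0]
      have hE : 0 ≤ D * Real.exp (K * s) := by positivity
      have h3 := mul_le_mul_of_nonneg_left (hψ n hn) (mul_nonneg h0 hE)
      have h4 : 2 * (β + 1) * Γ s + C ≤ K * θ := by nlinarith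
      have h5 := mul_le_mul_of_nonneg_left h4 (mul_nonneg hE hψ0)
      nlinarith
  exact key.mono (le_of_eq (by ring))

lemma edgeMoment_le_of_bounded {u : State} {X ρ : ℝ} (hρ : 0 ≤ ρ) (hρ1 : ρ < 1) (hX : 0 ≤ X)
    (h : ∀ n, 2 ≤ n → Bounded (u n) (X * psi ρ n)) :
    edgeMoment 0 u ≤ ENNReal.ofReal (X / (1 - ρ)) := by
  have h2 : ∀ k : ℕ, 0 ≤ X * ρ ^ k := fun k => by positivity
  rw [div_eq_mul_inv, ← tsum_geometric_of_lt_one hρ hρ1, ← tsum_mul_left,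
    ENNReal.ofReal_tsum_of_nonneg h2 ((summable_geometric_of_lt_one hρ hρ1).mul_left _)]
  refine ENNReal.tsum_le_tsum fun k => (mul_le_mul_right (h (k + 2) (by omega)).2 _).trans ?_
  rw [← ENNReal.ofReal_mul (Nat.cast_nonneg _)]
  refine ENNReal.ofReal_le_ofReal ?_
  rw [mul_left_comm, mul_psi ρ (by omega)]
  gcongr X * ?_
  exact pow_le_pow_of_le_one hρ hρ1.le (by omega)

lemma abs_boundaryFlux_sub_le {u v : State} {X ρ : ℝ} (hρ : 0 ≤ ρ) (hρ1 : ρ ≤ 1) (hX : 0 ≤ X)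
    (h : ∀ n, 2 ≤ n → Bounded (u n - v n) (X * psi ρ n)) :
    |boundaryFlux u - boundaryFlux v| ≤ 30 * X := by
  have h1 : ∀ n, 2 ≤ n → |u n 0 - v n 0| ≤ X := fun n hn => by
    refine ((h n hn).1 0 le_rfl).trans ?_
    have hn' : (1 : ℝ) ≤ n := by exact_mod_cast (by omega : 1 ≤ n)
    have : psi ρ n ≤ 1 := div_le_one_of_le₀ ((pow_le_one₀ hρ hρ1).trans hn') (by positivity)
    nlinarith
  have e : boundaryFlux u - boundaryFlux v = 16 * (u 2 0 - v 2 0) + 9 * (u 3 0 - v 3 0) +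
      4 * (u 4 0 - v 4 0) + (u 5 0 - v 5 0) := by unfold boundaryFlux; ring
  have h2 := abs_le.1 (h1 2 (by omega))
  have h3 := abs_le.1 (h1 3 (by omega))
  have h4 := abs_le.1 (h1 4 (by omega))
  have h5 := abs_le.1 (h1 5 (by omega))
  rw [e, abs_le]
  constructor <;> linarith

lemma abs_div_sub_div_le {x x' y y' c F : ℝ} (hc : 0 < c) (hy : c ≤ |y|) (hy' : c ≤ |y'|)
    (hx : |x'| ≤ F) : |x / y - x' / y'| ≤ |x - x'| / c + F * |y - y'| / c ^ 2 := by
  have h0 : y ≠ 0 := abs_pos.1 (hc.trans_le hy)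
  have h0' : y' ≠ 0 := abs_pos.1 (hc.trans_le hy')
  have hF : 0 ≤ F := (abs_nonneg _).trans hx
  have e : x / y - x' / y' = (x - x') / y + x' * (y' - y) / (y * y') := by
    field_simp; ring
  rw [e]
  refine (abs_add_le _ _).trans (add_le_add ?_ ?_)
  · rw [abs_div]; gcongr
  · rw [abs_div, abs_mul, abs_mul, abs_sub_comm y' y, pow_two]
    gcongr

/-- Local Lipschitz continuity of the coupling weight as a quotient. The denominators `y` and `y'`
may be those of the states or their cut-off versions. -/
lemma exists_weight_lipschitz (hβ : 0 < β) {c F ρ : ℝ} (hc : 0 < c) (hF : 0 ≤ F) (hρ : 0 < ρ)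
    (hρ1 : ρ < 1) : ∃ L : ℝ, 0 ≤ L ∧ ∀ (u v : State) (y y' X : ℝ), 0 ≤ X →
      (∀ n, 2 ≤ n → AEStronglyMeasurable (u n) (volume.restrict (Ioi 0))) →
      (∀ n, 2 ≤ n → AEStronglyMeasurable (v n) (volume.restrict (Ioi 0))) →
      edgeMoment 0 u < ⊤ → edgeMoment 0 v < ⊤ →
      c ≤ |y| → c ≤ |y'| → |y - y'| ≤ |weightDen β u - weightDen β v| → |boundaryFlux v| ≤ F →
      (∀ n, 2 ≤ n → Bounded (u n - v n) (X * psi ρ n)) →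
      |boundaryFlux u / y - boundaryFlux v / y'| ≤ L * X := by
  refine ⟨30 / c + F * ((β + 2) / (1 - ρ)) / c ^ 2, by
    have : 0 < 1 - ρ := by linarith
    positivity, fun u v y y' X hX hu hv hue hve hy hy' hyy hvF h => ?_⟩
  refine (abs_div_sub_div_le hc hy hy' hvF).trans ?_
  have h1 := abs_boundaryFlux_sub_le hρ.le hρ1.le hX h
  have h2 := abs_weightDen_sub_le hβ hu hv hue hve
  have h3 : (edgeMoment 0 (u - v)).toReal ≤ X / (1 - ρ) := by
    refine ENNReal.toReal_le_of_le_ofReal (div_nonneg hX (by linarith)) ?_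
    exact edgeMoment_le_of_bounded hρ.le hρ1 hX h
  have h4 : |y - y'| ≤ (β + 2) * (X / (1 - ρ)) :=
    hyy.trans (h2.trans (by gcongr))
  calc _ ≤ 30 * X / c + F * ((β + 2) * (X / (1 - ρ))) / c ^ 2 := by gcongr
    _ = _ := by ring

end

/-! ### Existence for the clipped equation -/

section
variable {β M c₀ T : ℝ} {g : State} {f : ℝ → State} {Γ : ℝ → ℝ} {Q : ℝ → State}

lemma psi_mono {ρ ρ' : ℝ} (h0 : 0 ≤ ρ) (h : ρ ≤ ρ') (n : ℕ) : psi ρ n ≤ psi ρ' n := by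
  unfold psi; gcongr

/-- Geometric decay in both norms, with constants common to all curves. -/
lemma Curve.exists_bound (hβ : 0 < β) (hM : 0 ≤ M) (hc : 0 < c₀) (hg : Data β M g)
    (hT : 0 ≤ T) : ∃ A ρ : ℝ, 0 ≤ A ∧ ratio β ≤ ρ ∧ ρ < 1 ∧
      ∀ f, Curve β M c₀ g f → ∀ t, t ≤ T → ∀ n, 2 ≤ n → Bounded (f t n) (A * psi ρ n) := by
  obtain ⟨q, A, ρ, hq, -, hA, hρ, hρ1, h⟩ := Curve.exists_moment hβ hM hc hg hT
  have hr := ratio_pos hβ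
  refine ⟨max A (M / β), ρ, hA.trans (le_max_left _ _), hρ, hρ1, fun f hf t ht n hn => ⟨?_, ?_⟩⟩
  · intro a _
    rw [abs_of_nonneg (hf.nonneg t n hn a)]
    refine (hf.le t n hn a).trans ?_
    have h1 := psi_mono hr.le hρ n
    have h2 := psi_nonneg hr.le n
    calc M * phi β n = M / β * psi (ratio β) n := by rw [phi_eq]; ring
      _ ≤ max A (M / β) * psi ρ n := by
        gcongr; exact le_max_right _ _
  · refine (expMoment_mono_exponent hq.le _).trans ((h f hf t ht n hn).trans ?_)
    have := psi_nonneg (hr.le.trans hρ) n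
    exact ENNReal.ofReal_le_ofReal (by gcongr; exact le_max_left _ _)

/-- The coupling operator maps a geometrically bounded state to one with a larger ratio. The states
in the gain and in the loss may differ, as they do in a step of the iteration. -/
lemma exists_bounded_coupling (hβ : 0 < β) {A ρ₁ ρ : ℝ} (hA : 0 ≤ A) (h1 : ratio β ≤ ρ₁)
    (h2 : ρ₁ < ρ) (hρ : ρ < 1) : ∃ C : ℝ, 0 ≤ C ∧ ∀ u v : State,
      (∀ n, 2 ≤ n → Measurable (u n)) → (∀ n, 2 ≤ n → Bounded (u n) (A * psi ρ₁ n)) →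
      (∀ n, 2 ≤ n → Bounded (v n) (A * psi ρ₁ n)) → ∀ n, 2 ≤ n →
      Bounded (fun a => gain β (fun m => u m a) n - lam β n * v n a) (C * psi ρ n) := by
  have hr := ratio_pos hβ
  have hρ₁ : 0 < ρ₁ := hr.trans_le h1
  obtain ⟨C, hC, h⟩ := exists_psi_le hρ₁.le h2 1
  refine ⟨(6 * β + 4) * A * C, by positivity, fun u v hu hub hvb n hn => ?_⟩
  have hn' : (1 : ℝ) ≤ n := by exact_mod_cast (by omega : 1 ≤ n)
  have h3 : Measurable fun a => gain β (fun m => u m a) n := by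
    unfold gain
    have := hu (n + 1) (by omega)
    by_cases h2 : n = 2
    · simp only [if_pos h2]; fun_prop
    · simp only [if_neg h2]
      have := hu (n - 1) (by omega)
      fun_prop
  refine ((Bounded.gain hβ hn hu hub).sub ((hvb n hn).const_mul _) h3).mono ?_
  rw [gain_const_mul, abs_of_nonneg (lam_nonneg hβ n)]
  have h4 := gain_psi_le hβ h1 (h2.le.trans hρ.le) hn
  have h5 := lam_le hβ n
  have h6 := psi_nonneg hρ₁.le n
  have h7 := h n
  rw [pow_one] at h7
  calc A * gain β (psi ρ₁) n + lam β n * (A * psi ρ₁ n) ≤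
      A * ((lam β n + 2 * (β + 1)) * psi ρ₁ n) + lam β n * (A * psi ρ₁ n) := by gcongr
    _ = (2 * lam β n + 2 * (β + 1)) * (A * psi ρ₁ n) := by ring
    _ ≤ ((6 * β + 4) * n) * (A * psi ρ₁ n) := by
      gcongr
      nlinarith
    _ = (6 * β + 4) * A * (n * psi ρ₁ n) := by ring
    _ ≤ (6 * β + 4) * A * (C * psi ρ n) := by gcongr
    _ = _ := by ring

lemma JointCont.sub {f f' : ℝ → State} (hf : JointCont f) (hf' : JointCont f') :
    JointCont fun s n a => f s n a - f' s n a := fun n hn => (hf n hn).sub (hf' n hn)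

lemma JointCont.lam_mul (hf : JointCont f) : JointCont fun s n a => lam β n * f s n a :=
  fun n hn => (hf n hn).const_mul _

/-- The iteration step is a contraction on curves in the norms weighted by `e^{Kt} ψ(ρ)_n`. The
ratio `ρ` is taken larger than the one that bounds the curves themselves: the difference of the two
weights multiplies the unbounded coupling operator, which costs a factor `n`. -/
theorem exists_contraction (hβ : 0 < β) (hM : 0 ≤ M) (hc : 0 < c₀) (hg : Data β M g)
    (hT : 0 ≤ T) : ∃ ρ θ K X : ℝ, 0 < ρ ∧ ρ < 1 ∧ 0 < θ ∧ θ < 1 ∧ 0 ≤ K ∧ 0 ≤ X ∧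
      (∀ f, Curve β M c₀ g f → ∀ t ∈ Icc 0 T, ∀ n, 2 ≤ n → Bounded (f t n) (X * psi ρ n)) ∧
      ∀ f f', Curve β M c₀ g f → Curve β M c₀ g f' → ∀ D, 0 ≤ D →
      (∀ s ∈ Icc 0 T, ∀ n, 2 ≤ n →
        Bounded (fun a => f s n a - f' s n a) (D * Real.exp (K * s) * psi ρ n)) →
      ∀ t ∈ Icc 0 T, ∀ n, 2 ≤ n → Bounded (fun a => step β c₀ g f t n a - step β c₀ g f' t n a)
        (θ * D * Real.exp (K * t) * psi ρ n) := by
  obtain ⟨A, ρ₁, hA, hρ₁, hρ₁1, hb⟩ := Curve.exists_bound hβ hM hc hg hT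
  obtain ⟨ρ, hρ2, hρ1⟩ := exists_between hρ₁1
  have hρ₁0 : 0 < ρ₁ := (ratio_pos hβ).trans_le hρ₁
  have hρ0 : 0 < ρ := hρ₁0.trans hρ2
  obtain ⟨θ, hθ, hθ1, hψ⟩ := exists_gain_psi_le hβ (hρ₁.trans_lt hρ2) hρ1
  obtain ⟨C, hC, hcoup⟩ := exists_bounded_coupling hβ hA hρ₁ hρ2 hρ1
  have hφ : ∀ n, 2 ≤ n → 0 ≤ phi β n := fun n hn => (phi_pos hβ hn).le
  have hF : 0 ≤ M * boundaryFlux (fun n _ => phi β n) := by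
    unfold boundaryFlux
    have := hφ 2 (by omega)
    have := hφ 3 (by omega)
    have := hφ 4 (by omega)
    have := hφ 5 (by omega)
    positivity
  obtain ⟨L, hL, hLip⟩ := exists_weight_lipschitz hβ
    (by positivity : 0 < c₀ * Real.exp (-2 * T)) hF hρ0 hρ1
  have hW := weightBound_nonneg hβ hM hc T
  set W := weightBound β M c₀ T
  -- the growth rate absorbs the defect of the supersolution and the difference of the weights
  set K := (2 * (β + 1) * W + L * C) / θ with hK
  have hKθ : K * θ = 2 * (β + 1) * W + L * C := by rw [hK]; field_simp
  refine ⟨ρ, θ, K, A, hρ0, hρ1, hθ, hθ1, by positivity, hA, fun f hf t ht n hn =>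
    (hb f hf t ht.2 n hn).mono ?_, fun f f' hf hf' D hD hd => ?_⟩
  · gcongr; exact psi_mono hρ₁0.le hρ2.le n
  have hΓ := hf.continuous_clipWeight hβ hM hc hg
  have hΓ' := hf'.continuous_clipWeight hβ hM hc hg
  have hj := hf.jointCont hβ hM hc hg
  have hj' := hf'.jointCont hβ hM hc hg
  have hsj := hf.step_jointCont hβ hM hc hg
  have hsj' := hf'.step_jointCont hβ hM hc hg
  have hQ := hf.jointCont_stepSource hβ hM hc hg
  have hQ' := hf'.jointCont_stepSource hβ hM hc hg
  -- both steps are compared in the equation damped with the first weight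
  have hS' := (hf'.step_solves hβ hM hc hg T).change_damping hΓ' hΓ hQ'
  have hQ'' : JointCont fun s n a => stepSource β c₀ f' s n a +
      lam β n * (clipWeight β c₀ f s - clipWeight β c₀ f' s) * step β c₀ g f' s n a := by
    intro n hn
    have := hQ' n hn
    have := hsj' n hn
    fun_prop
  have hS := (hf.step_solves hβ hM hc hg T).sub hS' hΓ hQ hQ''
  set R : ℝ → State := fun s n a => (clipWeight β c₀ f s - clipWeight β c₀ f' s) *
    (gain β (fun m => f' s m a) n - lam β n * step β c₀ g f' s n a) with hR
  have hRc : JointCont R := (hj'.gain.sub hsj'.lam_mul).mul_time (hΓ.sub hΓ')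
  refine Solves.contract (v := fun s n a => f s n a - f' s n a) (R := R) (W := W) (C := L * C)
    hβ hρ0 hθ hψ hKθ.ge (by positivity) (hS.congr fun s _ n _ a _ => ?_) (fun n _ a _ => ?_)
    hΓ (fun s _ => hf.clipWeight_nonneg hc s) (fun s hs => hf.clipWeight_le hc hs.2)
    (hj.sub hj') hRc (hsj.sub hsj') hD hd fun s hs n hn => ?_
  · simp only [hR, stepSource, gain_sub]; ring
  · simp
  · have h1 := hcoup (f' s) (step β c₀ g f' s)
      (fun n hn => (hf'.continuous_area hβ hM hc hg hn s).measurable)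
      (fun n hn => hb f' hf' s hs.2 n hn)
      (fun n hn => hb _ (hf'.step hβ hM hc hg) s hs.2 n hn) n hn
    refine (h1.const_mul (clipWeight β c₀ f s - clipWeight β c₀ f' s)).mono ?_
    have hexp : c₀ * Real.exp (-2 * T) ≤ c₀ * Real.exp (-2 * s) :=
      mul_le_mul_of_nonneg_left (Real.exp_le_exp.2 (by linarith [hs.2])) hc.le
    have habs : ∀ y, c₀ * Real.exp (-2 * T) ≤ |max y (c₀ * Real.exp (-2 * s))| := fun y =>
      hexp.trans ((le_max_right _ _).trans (le_abs_self _))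
    have h2 := hLip (f s) (f' s) _ _ (D * Real.exp (K * s)) (by positivity)
      (hf.measurable hβ hM hc hg s) (hf'.measurable hβ hM hc hg s)
      (hf.edgeMoment_zero_lt_top hβ hM hc hg s) (hf'.edgeMoment_zero_lt_top hβ hM hc hg s)
      (habs (weightDen β (f s))) (habs (weightDen β (f' s))) (abs_max_sub_max_le_abs _ _ _)
      (by rw [abs_of_nonneg (hf'.boundaryFlux_nonneg s)]; exact hf'.boundaryFlux_le s)
      (hd s hs)
    have h3 := psi_nonneg hρ0.le n
    calc _ ≤ L * (D * Real.exp (K * s)) * (C * psi ρ n) := by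
          refine mul_le_mul_of_nonneg_right h2 (by positivity)
      _ = _ := by ring

lemma Curve.zero (hβ : 0 < β) (hM : 0 ≤ M) (hc : 0 < c₀) : Curve β M c₀ g (fun _ _ _ => 0) where
  clamp _ _ _ := rfl
  nonneg _ _ _ _ := le_rfl
  le _ n hn _ := mul_nonneg hM (phi_pos hβ hn).le
  equi T ε δ _ hε hδ _ _ _ n hn _ _ := by
    have := weightBound_nonneg hβ hM hc T
    have := (phi_pos hβ hn).le
    rw [sub_zero, abs_zero]; positivity
  timeCont _ _ _ ε hε := Eventually.of_forall fun _ _ => by simpa using hε.le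
  moment _ _ _ _ _ _ _ _ _ _ _ _ _ _ := by simp [expMoment]

/-- The successive approximations. -/
noncomputable def approx (β c₀ : ℝ) (g : State) : ℕ → ℝ → State
  | 0 => fun _ _ _ => 0
  | j + 1 => step β c₀ g (approx β c₀ g j)

lemma curve_approx (hβ : 0 < β) (hM : 0 ≤ M) (hc : 0 < c₀) (hg : Data β M g) (j : ℕ) :
    Curve β M c₀ g (approx β c₀ g j) := by
  induction j with
  | zero => exact Curve.zero hβ hM hc
  | succ j ih => exact ih.step hβ hM hc hg

/-- Pointwise limits of curves that converge uniformly up to any time are curves. -/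
lemma Curve.of_tendsto (hβ : 0 < β) (hM : 0 ≤ M) (hc : 0 < c₀) (hg : Data β M g)
    {F : ℕ → ℝ → State} (hF : ∀ j, Curve β M c₀ g (F j))
    (hclamp : ∀ t n a, f t n a = f (max t 0) n (max a 0))
    (hlim : ∀ n, 2 ≤ n → ∀ t a, Tendsto (fun j => F j t n a) atTop (𝓝 (f t n a)))
    (hunif : ∀ n, 2 ≤ n → ∀ T, 0 ≤ T → ∀ ε : ℝ, 0 < ε →
      ∃ j, ∀ t, t ≤ T → ∀ a, |F j t n a - f t n a| ≤ ε) : Curve β M c₀ g f where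
  clamp := hclamp
  nonneg t n hn a := ge_of_tendsto' (hlim n hn t a) fun j => (hF j).nonneg t n hn a
  le t n hn a := le_of_tendsto' (hlim n hn t a) fun j => (hF j).le t n hn a
  equi T ε δ hT hε hδ h t ht n hn a ha :=
    le_of_tendsto' ((hlim n hn t (a + δ)).sub (hlim n hn t a)).abs fun j =>
      (hF j).equi T ε δ hT hε hδ h t ht n hn a ha
  timeCont n hn t ε hε := by
    obtain ⟨j, hj⟩ := hunif n hn (max t 0 + 1) (by positivity) (ε / 3) (by positivity)
    have h1 : ∀ᶠ s in 𝓝 t, s ≤ max t 0 + 1 :=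
      Iic_mem_nhds (by have := le_max_left t 0; linarith)
    filter_upwards [(hF j).timeCont n hn t (ε / 3) (by positivity), h1] with s hs hsT a
    have h2 := abs_le.1 (hj s hsT a)
    have h3 := abs_le.1 (hj t (by have := le_max_left t 0; linarith) a)
    have h4 := abs_le.1 (hs a)
    rw [abs_le]; constructor <;> linarith
  moment T p ρ D hT hp hρ hρT hD h t ht n hn :=
    expMoment_le_of_tendsto (fun j => ((hF j).continuous_area hβ hM hc hg hn t).measurable)
      (hlim n hn t) fun j => (hF j).moment T p ρ D hT hp hρ hρT hD h t ht n hn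

/-- The clipped equation has a solution in the class of curves: the fixed point of the step. -/
theorem exists_fixed_point (hβ : 0 < β) (hM : 0 ≤ M) (hc : 0 < c₀) (hg : Data β M g) :
    ∃ f, Curve β M c₀ g f ∧ ∀ t n, 2 ≤ n → ∀ a, step β c₀ g f t n a = f t n a := by
  set F := approx β c₀ g with hFdef
  have hF : ∀ j, Curve β M c₀ g (F j) := curve_approx hβ hM hc hg
  have hFs : ∀ j, F (j + 1) = step β c₀ g (F j) := fun j => rfl
  have hmeas : ∀ j t n, 2 ≤ n → Measurable (F j t n) := fun j t n hn =>
    ((hF j).continuous_area hβ hM hc hg hn t).measurable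
  -- geometric estimates for the approximations on a time interval
  have geo : ∀ T, 0 ≤ T → ∃ ρ θ K X : ℝ, 0 < ρ ∧ ρ < 1 ∧ 0 < θ ∧ θ < 1 ∧ 0 ≤ K ∧ 0 ≤ X ∧
      (∀ i j, ∀ t ∈ Icc 0 T, ∀ n, 2 ≤ n → Bounded (fun a => F (j + i) t n a - F j t n a)
        (θ ^ j * X / (1 - θ) * Real.exp (K * t) * psi ρ n)) ∧
      ∀ f f', Curve β M c₀ g f → Curve β M c₀ g f' → ∀ D, 0 ≤ D →
        (∀ s ∈ Icc 0 T, ∀ n, 2 ≤ n →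
          Bounded (fun a => f s n a - f' s n a) (D * Real.exp (K * s) * psi ρ n)) →
        ∀ t ∈ Icc 0 T, ∀ n, 2 ≤ n →
        Bounded (fun a => step β c₀ g f t n a - step β c₀ g f' t n a)
          (θ * D * Real.exp (K * t) * psi ρ n) := by
    intro T hT
    obtain ⟨ρ, θ, K, X, hρ, hρ1, hθ, hθ1, hK, hX, hb, hcon⟩ :=
      exists_contraction hβ hM hc hg hT
    refine ⟨ρ, θ, K, X, hρ, hρ1, hθ, hθ1, hK, hX, ?_, hcon⟩
    have one : ∀ j, ∀ t ∈ Icc 0 T, ∀ n, 2 ≤ n → Bounded (fun a => F (j + 1) t n a - F j t n a)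
        (θ ^ j * X * Real.exp (K * t) * psi ρ n) := by
      intro j
      induction j with
      | zero =>
        intro t ht n hn
        have e : (fun a => F (0 + 1) t n a - F 0 t n a) = F 1 t n := by
          funext a; simp [hFdef, approx]
        rw [e]
        refine (hb (F 1) (hF 1) t ht n hn).mono ?_
        have h1 : 1 ≤ Real.exp (K * t) := Real.one_le_exp (mul_nonneg hK ht.1)
        have h2 := mul_nonneg hX (psi_nonneg hρ.le n)
        nlinarith
      | succ j ih =>
        intro t ht n hn
        have := hcon _ _ (hF (j + 1)) (hF j) (θ ^ j * X) (by positivity) ih t ht n hn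
        refine this.mono (le_of_eq ?_)
        ring
    have many : ∀ j i, ∀ t ∈ Icc 0 T, ∀ n, 2 ≤ n →
        Bounded (fun a => F (j + i) t n a - F j t n a)
          (θ ^ j * X * ((1 - θ ^ i) / (1 - θ)) * Real.exp (K * t) * psi ρ n) := by
      intro j i
      induction i with
      | zero =>
        intro t ht n hn
        simp [Bounded, expMoment]
      | succ i ih =>
        intro t ht n hn
        have h1 := (one (j + i) t ht n hn).add (ih t ht n hn)
          ((hmeas _ t n hn).sub (hmeas _ t n hn))
        refine (h1.congr fun a _ => ?_).mono (le_of_eq ?_)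
        · rw [add_assoc]; ring
        · have : 1 - θ ≠ 0 := by linarith
          field_simp
          ring
    intro i j t ht n hn
    refine (many j i t ht n hn).mono ?_
    have h1 : (1 - θ ^ i) / (1 - θ) ≤ 1 / (1 - θ) := by
      have := pow_pos hθ i
      have : 0 < 1 - θ := by linarith
      gcongr; linarith
    have h2 := psi_nonneg hρ.le n
    calc _ ≤ θ ^ j * X * (1 / (1 - θ)) * Real.exp (K * t) * psi ρ n := by gcongr
      _ = _ := by ring
  -- the approximations converge pointwise
  have hcauchy : ∀ n, 2 ≤ n → ∀ t a, ∃ y, Tendsto (fun j => F j t n a) atTop (𝓝 y) := by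
    intro n hn t a
    obtain ⟨ρ, θ, K, X, hρ, hρ1, hθ, hθ1, hK, hX, hb, -⟩ := geo (max t 0) (le_max_right _ _)
    refine cauchySeq_tendsto_of_complete (cauchySeq_of_le_tendsto_0'
      (fun j => θ ^ j * X / (1 - θ) * Real.exp (K * max t 0) * psi ρ n) (fun j k hjk => ?_) ?_)
    · obtain ⟨i, rfl⟩ := Nat.exists_eq_add_of_le hjk
      rw [dist_comm, Real.dist_eq, (hF j).clamp t, (hF (j + i)).clamp t]
      exact (hb i j (max t 0) ⟨le_max_right _ _, le_rfl⟩ n hn).1 _ (le_max_right _ _)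
    · have := (tendsto_pow_atTop_nhds_zero_of_lt_one hθ.le hθ1).mul_const
        (X / (1 - θ) * Real.exp (K * max t 0) * psi ρ n)
      rw [zero_mul] at this
      exact this.congr fun j => by ring
  set f : ℝ → State := fun t n a => limUnder atTop (fun j => F j t n a) with hf
  have hlim : ∀ n, 2 ≤ n → ∀ t a, Tendsto (fun j => F j t n a) atTop (𝓝 (f t n a)) :=
    fun n hn t a => tendsto_nhds_limUnder (hcauchy n hn t a)
  have hclamp : ∀ t n a, f t n a = f (max t 0) n (max a 0) := fun t n a => by
    simp only [hf]
    exact congrArg _ (funext fun j => (hF j).clamp t n a)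
  -- and the geometric estimates pass to the limit
  have hconv : ∀ T, 0 ≤ T → ∃ ρ θ K X : ℝ, 0 < ρ ∧ ρ < 1 ∧ 0 < θ ∧ θ < 1 ∧ 0 ≤ K ∧ 0 ≤ X ∧
      (∀ j, ∀ t ∈ Icc 0 T, ∀ n, 2 ≤ n → Bounded (fun a => f t n a - F j t n a)
        (θ ^ j * X / (1 - θ) * Real.exp (K * t) * psi ρ n)) ∧
      ∀ f f', Curve β M c₀ g f → Curve β M c₀ g f' → ∀ D, 0 ≤ D →
        (∀ s ∈ Icc 0 T, ∀ n, 2 ≤ n →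
          Bounded (fun a => f s n a - f' s n a) (D * Real.exp (K * s) * psi ρ n)) →
        ∀ t ∈ Icc 0 T, ∀ n, 2 ≤ n →
        Bounded (fun a => step β c₀ g f t n a - step β c₀ g f' t n a)
          (θ * D * Real.exp (K * t) * psi ρ n) := by
    intro T hT
    obtain ⟨ρ, θ, K, X, hρ, hρ1, hθ, hθ1, hK, hX, hb, hcon⟩ := geo T hT
    refine ⟨ρ, θ, K, X, hρ, hρ1, hθ, hθ1, hK, hX, fun j t ht n hn => ?_, hcon⟩
    refine Bounded.of_tendsto (u := fun i a => F (j + i) t n a - F j t n a)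
      (fun i => (hmeas _ t n hn).sub (hmeas _ t n hn)) (fun a => ?_) fun i => hb i j t ht n hn
    have := (tendsto_add_atTop_iff_nat j).2 (hlim n hn t a)
    simp only [add_comm _ j] at this
    exact this.sub_const _
  have hpow : ∀ {θ : ℝ} (B : ℝ), 0 < θ → θ < 1 → Tendsto (fun j => θ ^ j * B) atTop (𝓝 0) :=
    fun B h0 h1 => by simpa using (tendsto_pow_atTop_nhds_zero_of_lt_one h0.le h1).mul_const B
  have hcurve : Curve β M c₀ g f := by
    refine Curve.of_tendsto hβ hM hc hg hF hclamp hlim fun n hn T hT ε hε => ?_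
    obtain ⟨ρ, θ, K, X, hρ, hρ1, hθ, hθ1, hK, hX, hb, -⟩ := hconv T hT
    obtain ⟨j, hj⟩ := ((hpow (X / (1 - θ) * Real.exp (K * T) * psi ρ n) hθ hθ1).eventually_le_const
      hε).exists
    refine ⟨j, fun t ht a => ?_⟩
    have ht' : max t 0 ∈ Icc 0 T := ⟨le_max_right _ _, max_le ht hT⟩
    rw [(hF j).clamp, hclamp t, abs_sub_comm]
    refine ((hb j _ ht' n hn).1 _ (le_max_right _ _)).trans (le_trans ?_ hj)
    have h1 := psi_nonneg hρ.le n
    have h2 : 0 < 1 - θ := by linarith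
    calc _ ≤ θ ^ j * X / (1 - θ) * Real.exp (K * T) * psi ρ n := by
          gcongr; exact ht'.2
      _ = _ := by ring
  refine ⟨f, hcurve, fun t n hn a => ?_⟩
  rw [step_clamp, hclamp]
  obtain ⟨ρ, θ, K, X, hρ, hρ1, hθ, hθ1, hK, hX, hb, hcon⟩ := hconv (max t 0) (le_max_right _ _)
  have ht' : max t 0 ∈ Icc 0 (max t 0) := ⟨le_max_right _ _, le_rfl⟩
  have h2 : 0 < 1 - θ := by linarith
  set B := X / (1 - θ) * Real.exp (K * max t 0) * psi ρ n with hB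
  have h3 : ∀ j : ℕ, |step β c₀ g f (max t 0) n (max a 0) - f (max t 0) n (max a 0)| ≤
      θ ^ j * (2 * θ * B) := by
    intro j
    have h4 := (hcon f (F j) hcurve (hF j) (θ ^ j * X / (1 - θ)) (by positivity) (hb j)
      _ ht' n hn).1 (max a 0) (le_max_right _ _)
    have h5 := (hb (j + 1) _ ht' n hn).1 (max a 0) (le_max_right _ _)
    rw [hFs, abs_sub_comm] at h5
    refine (abs_sub_le _ (step β c₀ g (F j) (max t 0) n (max a 0)) _).trans
      ((add_le_add h4 h5).trans (le_of_eq ?_))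
    rw [hB]; ring
  -- the limit and its image are both close to the approximation number `j + 1`
  have h6 := ge_of_tendsto' (hpow (2 * θ * B) hθ hθ1) h3
  exact sub_eq_zero.1 (abs_nonpos_iff.1 h6)

end

/-! ### Admissible and regular initial states -/

section
variable {β : ℝ} {g : State}

lemma betaNorm_le_iff (hβ : 0 < β) {f : State} {C : ℝ} (hC : 0 ≤ C) :
    betaNorm β f ≤ ENNReal.ofReal C ↔ ∀ n, 2 ≤ n → ∀ a, 0 ≤ a → |f n a| ≤ C * phi β n := by
  unfold betaNorm
  simp only [iSup_le_iff]
  refine forall_congr' fun n => forall_congr' fun hn => forall_congr' fun a =>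
    forall_congr' fun _ => ?_
  rw [ENNReal.ofReal_le_ofReal_iff hC, div_le_iff₀ (phi_pos hβ hn)]

lemma abs_le_of_betaNorm (hβ : 0 < β) {f : State} (h : betaNorm β f < ⊤) {n : ℕ} (hn : 2 ≤ n)
    {a : ℝ} (ha : 0 ≤ a) : |f n a| ≤ (betaNorm β f).toReal * phi β n :=
  (betaNorm_le_iff hβ ENNReal.toReal_nonneg).1 (ENNReal.ofReal_toReal h.ne).ge n hn a ha

lemma MemY.aestronglyMeasurable {f : State} (hf : MemY β f) {n : ℕ} (hn : 2 ≤ n) :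
    AEStronglyMeasurable (f n) (volume.restrict (Ioi 0)) :=
  ((hf.continuousOn n hn).mono Ioi_subset_Ici_self).aestronglyMeasurable measurableSet_Ioi

lemma lintegral_le_lNorm {f : State} {n : ℕ} (hn : 2 ≤ n) :
    ∫⁻ a in Ioi (0 : ℝ), ENNReal.ofReal (((n : ℝ) + a) * |f n a|) ≤ lNorm f := by
  obtain ⟨k, rfl⟩ : ∃ k, n = k + 2 := ⟨n - 2, by omega⟩
  exact ENNReal.le_tsum k

/-- The summand with `k = ⌈a⌉ - 1` alone dominates `e^{qa}`. -/
lemma exp_le_tsum_indicator {q a : ℝ} (hq : 0 ≤ q) (ha : 0 < a) :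
    ENNReal.ofReal (Real.exp (q * a)) ≤
      ∑' k : ℕ, if (k : ℝ) < a then ENNReal.ofReal (Real.exp (q * (k + 1))) else 0 := by
  have h1 : (⌈a⌉₊ - 1 : ℕ) < ⌈a⌉₊ := Nat.sub_lt (Nat.ceil_pos.2 ha) one_pos
  have h2 : ((⌈a⌉₊ - 1 : ℕ) : ℝ) < a := Nat.lt_ceil.1 h1
  refine le_trans ?_ (ENNReal.le_tsum (⌈a⌉₊ - 1))
  rw [if_pos h2]
  refine ENNReal.ofReal_le_ofReal (Real.exp_le_exp.2 (mul_le_mul_of_nonneg_left ?_ hq))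
  have h3 : ((⌈a⌉₊ - 1 : ℕ) : ℝ) + 1 = ⌈a⌉₊ := by
    exact_mod_cast Nat.sub_add_cancel (Nat.ceil_pos.2 ha)
  rw [h3]; exact Nat.le_ceil a

/-- The layers `a > k`, `k = 0, 1, …`, turn exponentially small tails into exponential moments. -/
lemma expMoment_le_of_tails {u : ℝ → ℝ} {q d B : ℝ} (hq : 0 ≤ q) (hqd : q < d) (hB : 0 ≤ B)
    (hu : AEStronglyMeasurable u (volume.restrict (Ioi 0)))
    (h : ∀ k : ℕ, ∫⁻ a in Ioi (k : ℝ), ENNReal.ofReal |u a| ≤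
      ENNReal.ofReal (B * Real.exp (-d * k))) :
    expMoment q u ≤ ENNReal.ofReal (B * Real.exp q / (1 - Real.exp (q - d))) := by
  have hr1 : Real.exp (q - d) < 1 := Real.exp_lt_one_iff.2 (by linarith)
  have step : ∀ k : ℕ, ∫⁻ a in Ioi (0 : ℝ),
      (if (k : ℝ) < a then ENNReal.ofReal (Real.exp (q * (k + 1))) else 0) *
        ENNReal.ofReal |u a| ≤ ENNReal.ofReal (B * Real.exp q * Real.exp (q - d) ^ k) := by
    intro k
    have e : ∀ a : ℝ, (if (k : ℝ) < a then ENNReal.ofReal (Real.exp (q * (k + 1))) else 0) *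
        ENNReal.ofReal |u a| = (Ioi (k : ℝ)).indicator
          (fun a => ENNReal.ofReal (Real.exp (q * (k + 1))) * ENNReal.ofReal |u a|) a := by
      intro a
      by_cases h : (k : ℝ) < a
      · rw [if_pos h, indicator_of_mem (mem_Ioi.2 h)]
      · rw [if_neg h, indicator_of_notMem (by simpa using h), zero_mul]
    simp_rw [e]
    rw [setLIntegral_indicator measurableSet_Ioi]
    have hsub : Ioi (k : ℝ) ∩ Ioi 0 ⊆ Ioi (k : ℝ) := inter_subset_left
    refine (lintegral_mono_set hsub).trans ?_
    rw [lintegral_const_mul' _ _ ENNReal.ofReal_ne_top]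
    refine (mul_le_mul_right (h k) _).trans (le_of_eq ?_)
    rw [← ENNReal.ofReal_mul (Real.exp_nonneg _), ← Real.exp_nat_mul]
    congr 1
    rw [mul_left_comm, mul_assoc, ← Real.exp_add, ← Real.exp_add]
    congr 2; ring
  have hum := hu.aemeasurable
  calc expMoment q u ≤ ∫⁻ a in Ioi (0 : ℝ), ∑' k : ℕ,
        (if (k : ℝ) < a then ENNReal.ofReal (Real.exp (q * (k + 1))) else 0) *
          ENNReal.ofReal |u a| := by
        refine setLIntegral_mono' measurableSet_Ioi fun a ha => ?_
        rw [ENNReal.tsum_mul_right]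
        exact mul_le_mul_left (exp_le_tsum_indicator hq ha) _
    _ = ∑' k : ℕ, ∫⁻ a in Ioi (0 : ℝ),
        (if (k : ℝ) < a then ENNReal.ofReal (Real.exp (q * (k + 1))) else 0) *
          ENNReal.ofReal |u a| := by
        refine lintegral_tsum fun k => ?_
        refine AEMeasurable.mul (Measurable.ite measurableSet_Ioi measurable_const
          measurable_const).aemeasurable (by fun_prop)
    _ ≤ ∑' k : ℕ, ENNReal.ofReal (B * Real.exp q * Real.exp (q - d) ^ k) :=
        ENNReal.tsum_le_tsum step
    _ = _ := by
        rw [← ENNReal.ofReal_tsum_of_nonneg (fun k => by positivity)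
          ((summable_geometric_of_lt_one (Real.exp_nonneg _) hr1).mul_left _), tsum_mul_left,
          tsum_geometric_of_lt_one (Real.exp_nonneg _) hr1]
        rfl

/-- Rapid decrease controls the tails of `a g_n`; for `α ≥ 1` these dominate the tails of `g_n`,
which therefore have exponential moments. -/
lemma data_of_admissible (hβ : 0 < β) (hadm : IsAdmissible β g) (hreg : IsRegular β g) :
    Data β (betaNorm β g).toReal g where
  nonneg := hadm.nonneg
  le n hn a ha := (le_abs_self _).trans (abs_le_of_betaNorm hβ hadm.memY.betaNorm_lt_top hn ha)
  boundary := hadm.boundary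
  equi ε hε := by
    obtain ⟨δ₀, h0, h⟩ := hreg.equicontinuous ε hε
    exact ⟨δ₀, h0, fun δ h1 h2 => (betaNorm_le_iff hβ hε.le).1 (h δ h1 h2)⟩
  expTail := by
    obtain ⟨d, D, hd, h⟩ := hreg.rapidlyDecreasing
    have hL := hadm.memY.lNorm_lt_top
    set Λ := (lNorm g).toReal with hΛ
    have hΛ' : lNorm g = ENNReal.ofReal Λ := (ENNReal.ofReal_toReal hL.ne).symm
    have hΛ0 : 0 ≤ Λ := ENNReal.toReal_nonneg
    have hmeas := fun n (hn : 2 ≤ n) => hadm.memY.aestronglyMeasurable (n := n) hn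
    -- tails of the area of one class
    have hint : ∀ n, 2 ≤ n → ∀ α : ℝ, 0 ≤ α → ∫⁻ a in Ioi α, ENNReal.ofReal (a * g n a) ≤
        ∫⁻ a in Ioi (0 : ℝ), ENNReal.ofReal (((n : ℝ) + a) * |g n a|) := by
      intro n hn α hα
      refine (lintegral_mono_set (Ioi_subset_Ioi hα)).trans
        (setLIntegral_mono' measurableSet_Ioi fun a ha => ENNReal.ofReal_le_ofReal ?_)
      have : 0 ≤ a := le_of_lt ha
      refine mul_le_mul (by have : (0 : ℝ) ≤ n := by positivity
                            linarith) (le_abs_self _) (hadm.nonneg n hn a this) (by positivity)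
    have htail : ∀ n, 2 ≤ n → ∀ α : ℝ, 0 ≤ α → ∫⁻ a in Ioi α, ENNReal.ofReal (a * g n a) ≤
        ENNReal.ofReal (D * Real.exp (-d * α)) := by
      intro n hn α hα
      have hnn : ∀ n, 2 ≤ n → 0 ≤ᵐ[volume.restrict (Ioi α)] fun a => a * g n a := fun n hn => by
        filter_upwards [ae_restrict_mem measurableSet_Ioi] with a ha
        have : 0 ≤ a := hα.trans (le_of_lt ha)
        exact mul_nonneg this (hadm.nonneg n hn a this)
      have hm : ∀ n, 2 ≤ n → AEStronglyMeasurable (fun a => a * g n a)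
          (volume.restrict (Ioi α)) := fun n hn =>
        (continuous_id.aestronglyMeasurable).mul
          ((hmeas n hn).mono_measure (Measure.restrict_mono (Ioi_subset_Ioi hα) le_rfl))
      have e : ∀ n, 2 ≤ n → ∫ a in Ioi α, a * g n a =
          (∫⁻ a in Ioi α, ENNReal.ofReal (a * g n a)).toReal := fun n hn =>
        integral_eq_lintegral_of_nonneg_ae (hnn n hn) (hm n hn)
      have hfin : ∀ n, 2 ≤ n → ∫⁻ a in Ioi α, ENNReal.ofReal (a * g n a) ≠ ⊤ := fun n hn =>
        (((hint n hn α hα).trans (lintegral_le_lNorm hn)).trans_lt hL).ne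
      have hsum : Summable fun k : ℕ => ∫ a in Ioi α, a * g (k + 2) a := by
        have : ∑' k : ℕ, ∫⁻ a in Ioi α, ENNReal.ofReal (a * g (k + 2) a) ≠ ⊤ :=
          ((ENNReal.tsum_le_tsum fun k => hint (k + 2) (by omega) α hα).trans_lt hL).ne
        refine (ENNReal.summable_toReal this).congr fun k => (e (k + 2) (by omega)).symm
      obtain ⟨k, rfl⟩ : ∃ k, n = k + 2 := ⟨n - 2, by omega⟩
      rw [← ENNReal.ofReal_toReal (hfin _ hn)]
      refine ENNReal.ofReal_le_ofReal ?_
      rw [← e _ hn]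
      refine le_trans ?_ (h α hα)
      unfold quasiCompl
      have h1 := hsum.le_tsum k fun j _ => integral_nonneg_of_ae (hnn (j + 2) (by omega))
      have h2 : 0 ≤ ∑' k : ℕ, if ⌊α⌋₊ + 1 ≤ k + 2 then
          ((k + 2 : ℕ) : ℝ) * ∫ a in Ioi (0 : ℝ), g (k + 2) a else 0 := by
        refine tsum_nonneg fun k => ?_
        split_ifs
        · exact mul_nonneg (Nat.cast_nonneg _) (setIntegral_nonneg measurableSet_Ioi
            fun a ha => hadm.nonneg _ (by omega) a (le_of_lt ha))
        · exact le_rfl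
      linarith
    have hr1 : Real.exp (d / 2 - d) < 1 := Real.exp_lt_one_iff.2 (by linarith)
    have : 0 < 1 - Real.exp (d / 2 - d) := by linarith
    refine ⟨d / 2, max D Λ * Real.exp (d / 2) / (1 - Real.exp (d / 2 - d)), by positivity,
      by positivity, fun n hn => expMoment_le_of_tails (by positivity) (by linarith) (by positivity)
        (hmeas n hn) fun k => ?_⟩
    rcases Nat.eq_zero_or_pos k with rfl | hk
    · simp only [Nat.cast_zero, mul_zero, Real.exp_zero, mul_one]
      calc ∫⁻ a in Ioi (0 : ℝ), ENNReal.ofReal |g n a| ≤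
          ∫⁻ a in Ioi (0 : ℝ), ENNReal.ofReal (((n : ℝ) + a) * |g n a|) := by
            refine setLIntegral_mono' measurableSet_Ioi fun a ha => ENNReal.ofReal_le_ofReal ?_
            have h1 : (1 : ℝ) ≤ n := by exact_mod_cast (by omega : 1 ≤ n)
            have h2 : 0 < a := ha
            exact le_mul_of_one_le_left (abs_nonneg _) (by linarith)
        _ ≤ lNorm g := lintegral_le_lNorm hn
        _ = ENNReal.ofReal Λ := hΛ'
        _ ≤ _ := ENNReal.ofReal_le_ofReal (le_max_right _ _)
    · have hk1 : (1 : ℝ) ≤ k := by exact_mod_cast hk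
      calc ∫⁻ a in Ioi (k : ℝ), ENNReal.ofReal |g n a| ≤
          ∫⁻ a in Ioi (k : ℝ), ENNReal.ofReal (a * g n a) := by
            refine setLIntegral_mono' measurableSet_Ioi fun a ha => ENNReal.ofReal_le_ofReal ?_
            have h2 : (k : ℝ) < a := ha
            have h3 := hadm.nonneg n hn a (by linarith)
            rw [abs_of_nonneg h3]
            exact le_mul_of_one_le_left h3 (by linarith)
        _ ≤ ENNReal.ofReal (D * Real.exp (-d * k)) := htail n hn k (by positivity)
        _ ≤ _ := ENNReal.ofReal_le_ofReal (by gcongr; exact le_max_left _ _)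

end

/-! ### Moments along the transport equation -/

section
variable {β T : ℝ} {g : State} {f : ℝ → State} {Q : ℝ → State}

/-- Fubini's theorem in coordinates moving with the characteristics: `d s` is the distance
travelled by a grain between time `s` and the reference time. -/
lemma integral_shift_swap {t : ℝ} (ht : 0 ≤ t) {d : ℝ → ℝ} (hd : Continuous d)
    (hd0 : ∀ s ∈ Icc 0 t, 0 ≤ d s) {R : ℝ → ℝ → ℝ} (hR : Continuous fun p : ℝ × ℝ => R p.1 p.2)
    {B : ℝ≥0∞} (hB : B ≠ ⊤) (hRB : ∀ s ∈ Icc 0 t, expMoment 0 (R s) ≤ B) :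
    IntegrableOn (fun a => ∫ s in (0 : ℝ)..t, if d s < a then R s (a - d s) else 0) (Ioi 0) ∧
    ∫ a in Ioi (0 : ℝ), ∫ s in (0 : ℝ)..t, (if d s < a then R s (a - d s) else 0) =
      ∫ s in (0 : ℝ)..t, ∫ a in Ioi (0 : ℝ), R s a := by
  set Z : ℝ → ℝ → ℝ := fun a s => if d s < a then R s (a - d s) else 0 with hZ
  have hZm : Measurable (Function.uncurry Z) := by
    refine Measurable.ite (measurableSet_lt (by fun_prop) (by fun_prop)) ?_ measurable_const
    exact (hR.comp (by fun_prop : Continuous fun p : ℝ × ℝ => (p.2, p.1 - d p.2))).measurable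
  have hZi : ∀ s ∈ Icc 0 t, ∀ F : ℝ → ℝ, (fun a => (Ioi (0 : ℝ)).indicator
      (fun a => if d s < a then F (a - d s) else 0) a) =
      fun a => (Ioi (0 : ℝ)).indicator F (a - d s) := by
    intro s hs F
    funext a
    have h0 := hd0 s hs
    by_cases h : d s < a
    · rw [indicator_of_mem (mem_Ioi.2 (by linarith)), indicator_of_mem (mem_Ioi.2 (by linarith)),
        if_pos h]
    · rw [indicator_of_notMem (s := Ioi (0 : ℝ)) (a := a - d s)
        (by rw [mem_Ioi]; linarith)]
      by_cases h1 : a ∈ Ioi (0 : ℝ)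
      · rw [indicator_of_mem h1, if_neg h]
      · rw [indicator_of_notMem h1]
  have hinner : ∀ s ∈ Icc 0 t, ∫ a in Ioi (0 : ℝ), Z a s = ∫ a in Ioi (0 : ℝ), R s a := by
    intro s hs
    rw [← integral_indicator measurableSet_Ioi, ← integral_indicator measurableSet_Ioi]
    rw [hZi s hs (R s)]
    exact integral_sub_right_eq_self (fun a => (Ioi (0 : ℝ)).indicator (R s) a) (d s)
  have hint : Integrable (Function.uncurry Z)
      ((volume.restrict (Ioi (0 : ℝ))).prod (volume.restrict (Ioc 0 t))) := by
    refine ⟨hZm.aestronglyMeasurable, ?_⟩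
    rw [hasFiniteIntegral_iff_enorm, lintegral_prod_symm _ hZm.enorm.aemeasurable]
    have : ∫⁻ s in Ioc 0 t, ∫⁻ a in Ioi (0 : ℝ), ‖Function.uncurry Z (a, s)‖ₑ ≤
        ∫⁻ s in Ioc 0 t, B := by
      refine setLIntegral_mono' measurableSet_Ioc fun s hs => ?_
      have hs' : s ∈ Icc 0 t := ⟨hs.1.le, hs.2⟩
      have h := expMoment_shift_le (p := 0) (d := d s) (U := fun a => ENNReal.ofReal |R s a|)
        (by have : Continuous (R s) := hR.comp (by fun_prop : Continuous fun a => (s, a))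
            have := this.measurable
            fun_prop)
      simp only [zero_mul, Real.exp_zero, ENNReal.ofReal_one, one_mul] at h
      refine le_trans (lintegral_mono fun a => ?_) (h.trans (le_trans (le_of_eq ?_) (hRB s hs')))
      · simp only [Function.uncurry, hZ]
        by_cases h1 : d s < a
        · rw [if_pos h1, if_pos h1.le, ← ofReal_norm, Real.norm_eq_abs]
        · rw [if_neg h1]; simp
      · simp [expMoment]
    refine this.trans_lt ?_
    rw [lintegral_const]
    exact ENNReal.mul_lt_top hB.lt_top (by simp)
  have e : ∀ a, ∫ s in (0 : ℝ)..t, (if d s < a then R s (a - d s) else 0) =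
      ∫ s in Ioc 0 t, Z a s := fun a => intervalIntegral.integral_of_le ht
  simp_rw [e]
  refine ⟨hint.integral_prod_left, ?_⟩
  rw [integral_integral_swap hint, intervalIntegral.integral_of_le ht]
  exact setIntegral_congr_fun measurableSet_Ioc fun s hs => hinner s ⟨hs.1.le, hs.2⟩

/-- The product rule along characteristics. -/
lemma Solves.weighted (h : Solves β T (fun _ => 0) Q g f) (hQ : JointCont Q)
    {χ χ' : ℝ → ℝ} (hχ : ∀ a, HasDerivAt χ (χ' a) a) (hχ' : Continuous χ') {n : ℕ} (hn : 2 ≤ n)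
    {τ t a : ℝ} (h0 : 0 ≤ τ) (h1 : τ ≤ t) (h2 : t ≤ T) (h3 : 0 ≤ a)
    (h4 : 0 ≤ a - ((n : ℝ) - 6) * (t - τ)) :
    χ a * f t n a = χ (a - ((n : ℝ) - 6) * (t - τ)) * f τ n (a - ((n : ℝ) - 6) * (t - τ)) +
      ∫ s in τ..t, (((n : ℝ) - 6) * χ' (a - ((n : ℝ) - 6) * (t - s)) *
          f s n (a - ((n : ℝ) - 6) * (t - s)) +
        χ (a - ((n : ℝ) - 6) * (t - s)) * Q s n (a - ((n : ℝ) - 6) * (t - s))) := by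
  set c : ℝ := (n : ℝ) - 6 with hc
  set pos : ℝ → ℝ := fun s => a - c * (t - s) with hpos
  have hχc : Continuous χ := continuous_iff_continuousAt.2 fun a => (hχ a).continuousAt
  have hq : Continuous fun s => Q s n (pos s) := hQ.comp hn continuous_id (by fun_prop)
  obtain ⟨Y, hY⟩ : ∃ Y : ℝ → ℝ, ∀ s, Y s = f τ n (pos τ) + ∫ x in τ..s, Q x n (pos x) :=
    ⟨_, fun _ => rfl⟩
  have hfY : ∀ s ∈ Icc τ t, f s n (pos s) = Y s := by
    intro s hs
    have h5 : 0 ≤ pos s := foot_nonneg h3 h4 hs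
    have h6 := h.duhamel n hn τ s (pos s) h0 hs.1 (hs.2.trans h2) h5
      (by simp only [hpos]; convert h4 using 1; ring)
    simp only [damp, intervalIntegral.integral_zero, mul_zero, sub_zero, Real.exp_zero,
      one_mul] at h6
    rw [h6, hY]
    congr 1
    · congr 1; simp only [hpos]; ring
    · congr 1; funext x; congr 1; simp only [hpos]; ring
  have hYd : ∀ s, HasDerivAt Y (Q s n (pos s)) s := fun s => by
    rw [funext hY]
    exact (intervalIntegral.integral_hasDerivAt_right (hq.intervalIntegrable _ _)
      hq.stronglyMeasurable.stronglyMeasurableAtFilter hq.continuousAt).const_add _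
  have hYc : Continuous Y := continuous_iff_continuousAt.2 fun s => (hYd s).continuousAt
  have hpd : ∀ s, HasDerivAt pos c s := fun s => by
    have := (((hasDerivAt_id s).const_sub t).const_mul c).const_sub a
    simpa [hpos] using this
  have hd : ∀ s, HasDerivAt (fun s => χ (pos s) * Y s)
      (c * χ' (pos s) * Y s + χ (pos s) * Q s n (pos s)) s := fun s => by
    refine (((hχ (pos s)).comp s (hpd s)).mul (hYd s)).congr_deriv ?_
    simp only [Function.comp]; ring
  have hposc : Continuous pos := by fun_prop
  have hdc : Continuous fun s => c * χ' (pos s) * Y s + χ (pos s) * Q s n (pos s) :=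
    ((continuous_const.mul (hχ'.comp hposc)).mul hYc).add ((hχc.comp hposc).mul hq)
  have key := intervalIntegral.integral_eq_sub_of_hasDerivAt (a := τ) (b := t)
    (fun s _ => hd s) (hdc.intervalIntegrable _ _)
  have e1 : ∫ s in τ..t, (c * χ' (pos s) * f s n (pos s) + χ (pos s) * Q s n (pos s)) =
      ∫ s in τ..t, (c * χ' (pos s) * Y s + χ (pos s) * Q s n (pos s)) := by
    refine intervalIntegral.integral_congr fun s hs => ?_
    rw [uIcc_of_le h1] at hs
    simp only [hfY s hs]
  have e2 : pos t = a := by simp [hpos]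
  have e3 := hfY t ⟨h1, le_rfl⟩
  rw [e2] at e3
  change _ = χ (pos τ) * f τ n (pos τ) + ∫ s in τ..t,
    (c * χ' (pos s) * f s n (pos s) + χ (pos s) * Q s n (pos s))
  rw [e1, key, e2, e3, hfY τ ⟨le_rfl, h1⟩]; ring

/-- The evolution of a moment `∫ χ f_n da`. The boundary term is the flux through `a = 0`: an
outflow for `n < 6`, and zero for `n ≥ 6`. -/
theorem Solves.moment_identity (h : Solves β T (fun _ => 0) Q g f) (hQ : JointCont Q)
    (hf : JointCont f) {χ χ' : ℝ → ℝ} (hχ : ∀ a, HasDerivAt χ (χ' a) a) (hχ' : Continuous χ')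
    {n : ℕ} (hn : 2 ≤ n) {t : ℝ} (ht : t ∈ Icc 0 T) {B : ℝ≥0∞} (hB : B ≠ ⊤)
    (hi : ∀ s ∈ Icc 0 T, IntegrableOn (fun a => χ a * f s n a) (Ioi 0))
    (hRB : ∀ s ∈ Icc 0 t, expMoment 0 (fun a => ((n : ℝ) - 6) * χ' a * f s n a +
      χ a * Q s n a) ≤ B) :
    ∫ a in Ioi (0 : ℝ), χ a * f t n a = (∫ a in Ioi (0 : ℝ), χ a * f 0 n a) +
      ∫ s in (0 : ℝ)..t, ((∫ a in Ioi (0 : ℝ), (((n : ℝ) - 6) * χ' a * f s n a +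
        χ a * Q s n a)) + ((n : ℝ) - 6) * (χ 0 * f s n 0)) := by
  have hχc : Continuous χ := continuous_iff_continuousAt.2 fun a => (hχ a).continuousAt
  set c : ℝ := (n : ℝ) - 6 with hc
  set R : ℝ → ℝ → ℝ := fun s a => c * χ' a * f s n a + χ a * Q s n a with hR
  have hRc : Continuous fun p : ℝ × ℝ => R p.1 p.2 := by
    have := hf n hn
    have := hQ n hn
    fun_prop
  have h0T : (0 : ℝ) ∈ Icc 0 T := ⟨le_rfl, ht.1.trans ht.2⟩
  have hf0 : Continuous fun s => f s n 0 := hf.comp hn continuous_id continuous_const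
  have shift : ∀ d : ℝ, 0 ≤ d → ∀ F : ℝ → ℝ, IntegrableOn F (Ioi 0) →
      IntegrableOn (fun a => if d < a then F (a - d) else 0) (Ioi 0) ∧
      ∫ a in Ioi (0 : ℝ), (if d < a then F (a - d) else 0) = ∫ a in Ioi (0 : ℝ), F a := by
    intro d hd F hF
    have e : (Ioi (0 : ℝ)).indicator (fun a => if d < a then F (a - d) else 0) =
        fun a => (Ioi (0 : ℝ)).indicator F (a - d) := by
      funext a
      by_cases h : d < a
      · rw [indicator_of_mem (mem_Ioi.2 (by linarith)),
          indicator_of_mem (mem_Ioi.2 (by linarith)), if_pos h]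
      · rw [indicator_of_notMem (s := Ioi (0 : ℝ)) (a := a - d) (by rw [mem_Ioi]; linarith)]
        by_cases h1 : a ∈ Ioi (0 : ℝ)
        · rw [indicator_of_mem h1, if_neg h]
        · rw [indicator_of_notMem h1]
    constructor
    · rw [← integrable_indicator_iff measurableSet_Ioi, e]
      exact ((integrable_indicator_iff measurableSet_Ioi).2 hF).comp_sub_right d
    · rw [← integral_indicator measurableSet_Ioi, ← integral_indicator measurableSet_Ioi, e]
      exact integral_sub_right_eq_self (fun a => (Ioi (0 : ℝ)).indicator F a) d
  have hRint : Continuous fun s => c * (χ 0 * f s n 0) := by fun_prop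
  by_cases h6 : 6 < n
  · -- outgoing characteristics are followed backwards from time `t`
    have hc0 : 0 < c := by
      have : (6 : ℝ) < n := by exact_mod_cast h6
      rw [hc]; linarith
    obtain ⟨I1, I2⟩ := integral_shift_swap ht.1 (d := fun s => c * (t - s)) (by fun_prop)
      (fun s hs => mul_nonneg hc0.le (sub_nonneg.2 hs.2)) hRc hB hRB
    obtain ⟨J1, J2⟩ := shift (c * t) (mul_nonneg hc0.le ht.1) (fun a => χ a * f 0 n a) (hi 0 h0T)
    have hpt : ∀ a ∈ Ioi (0 : ℝ), χ a * f t n a =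
        (if c * t < a then χ (a - c * t) * f 0 n (a - c * t) else 0) +
        ∫ s in (0 : ℝ)..t, if c * (t - s) < a then R s (a - c * (t - s)) else 0 := by
      intro a ha
      have ha' : (0 : ℝ) < a := ha
      by_cases hlt : c * t < a
      · rw [if_pos hlt]
        have := h.weighted hQ hχ hχ' hn le_rfl ht.1 ht.2 ha'.le (by rw [sub_zero]; linarith)
        rw [sub_zero] at this
        rw [this]
        congr 1
        refine intervalIntegral.integral_congr fun s hs => ?_
        rw [uIcc_of_le ht.1] at hs
        rw [if_pos (by nlinarith [hs.1])]
      · push Not at hlt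
        rw [if_neg hlt.not_gt, zero_add]
        set σ := t - a / c with hσ
        have e : c * (a / c) = a := by field_simp
        have hσ0 : 0 ≤ σ := by
          have : a / c ≤ t := by rw [div_le_iff₀ hc0]; linarith
          linarith
        have hσt : σ ≤ t := by
          have : 0 ≤ a / c := by positivity
          linarith
        have hz : a - c * (t - σ) = 0 := by rw [hσ, sub_sub_cancel, e, sub_self]
        have := h.weighted hQ hχ hχ' hn hσ0 hσt ht.2 ha'.le hz.ge
        rw [hz, h.boundary n h6 σ ⟨hσ0, hσt.trans ht.2⟩, mul_zero, zero_add] at this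
        rw [this]
        have hci : Continuous fun s => R s (a - c * (t - s)) :=
          hRc.comp (by fun_prop : Continuous fun s => (s, a - c * (t - s)))
        have hlt : ∀ s, c * (t - s) < a ↔ σ < s := fun s => by
          rw [hσ, sub_lt_comm, lt_div_iff₀ hc0, mul_comm]
        simp_rw [hlt]
        have e0 : ∀ s : ℝ, (if σ < s then R s (a - c * (t - s)) else 0) =
            (Ioi σ).indicator (fun s => R s (a - c * (t - s))) s := fun s => by
          simp [indicator]
        simp_rw [e0]
        rw [intervalIntegral.integral_of_le ht.1, setIntegral_indicator measurableSet_Ioi,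
          intervalIntegral.integral_of_le hσt]
        congr 2
        ext s
        simp only [mem_inter_iff, mem_Ioc, mem_Ioi]
        constructor
        · rintro ⟨h1, h2⟩; exact ⟨⟨by linarith, h2⟩, h1⟩
        · rintro ⟨⟨-, h2⟩, h3⟩; exact ⟨h3, h2⟩
    rw [setIntegral_congr_fun measurableSet_Ioi hpt, integral_add J1 I1, J2, I2]
    congr 1
    refine intervalIntegral.integral_congr fun s hs => ?_
    rw [uIcc_of_le ht.1] at hs
    simp only [hR]
    rw [h.boundary n h6 s ⟨hs.1, hs.2.trans ht.2⟩]; simp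
  · -- incoming characteristics are followed forwards until they leave at `a = 0`
    set v : ℝ := -c with hv
    have hv0 : 0 ≤ v := by
      have : (n : ℝ) ≤ 6 := by exact_mod_cast not_lt.1 h6
      rw [hv, hc]; linarith
    obtain ⟨I1, I2⟩ := integral_shift_swap ht.1 (d := fun s => v * s) (by fun_prop)
      (fun s hs => mul_nonneg hv0 hs.1) hRc hB hRB
    obtain ⟨J1, J2⟩ := shift (v * t) (mul_nonneg hv0 ht.1) (fun a => χ a * f t n a) (hi t ht)
    -- the part of the characteristics that have left the quadrant
    set G : ℝ → ℝ := fun x => (Ioc 0 (v * t)).indicator (fun x => χ 0 * f (x / v) n 0) x with hG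
    have hGc : Continuous fun x => χ 0 * f (x / v) n 0 :=
      continuous_const.mul (hf0.comp (by fun_prop))
    have hG1 : IntegrableOn G (Ioi 0) := by
      refine Integrable.integrableOn ?_
      rw [hG, integrable_indicator_iff measurableSet_Ioc]
      exact hGc.integrableOn_Ioc
    have hG2 : ∫ x in Ioi (0 : ℝ), G x = v * ∫ s in (0 : ℝ)..t, χ 0 * f s n 0 := by
      rw [hG, setIntegral_indicator measurableSet_Ioc]
      have : Ioi (0 : ℝ) ∩ Ioc 0 (v * t) = Ioc 0 (v * t) :=
        inter_eq_right.2 fun x hx => hx.1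
      rw [this, ← intervalIntegral.integral_of_le (mul_nonneg hv0 ht.1)]
      rcases hv0.eq_or_lt with h0 | h0
      · rw [← h0]; simp
      · have := intervalIntegral.integral_comp_div (a := 0) (b := v * t)
          (fun s => χ 0 * f s n 0) h0.ne'
        rw [this, zero_div, mul_div_cancel_left₀ _ h0.ne', smul_eq_mul]
    have hpt : ∀ x ∈ Ioi (0 : ℝ),
        (if v * t < x then χ (x - v * t) * f t n (x - v * t) else 0) + G x =
        χ x * f 0 n x + ∫ s in (0 : ℝ)..t, if v * s < x then R s (x - v * s) else 0 := by
      intro x hx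
      have hx' : (0 : ℝ) < x := hx
      by_cases hlt : v * t < x
      · have hnm : x ∉ Ioc 0 (v * t) := fun hm => absurd hm.2 (not_le.2 hlt)
        rw [if_pos hlt, hG]
        simp only
        rw [indicator_of_notMem hnm, add_zero]
        have := h.weighted hQ hχ hχ' hn (a := x - v * t) le_rfl ht.1 ht.2 (by linarith)
          (by rw [sub_zero, ← hc, hv]; linarith)
        rw [this]
        congr 1
        · have : x - v * t - ((n : ℝ) - 6) * (t - 0) = x := by rw [← hc, hv]; ring
          rw [this]
        · refine intervalIntegral.integral_congr fun s hs => ?_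
          rw [uIcc_of_le ht.1] at hs
          have e : x - v * t - ((n : ℝ) - 6) * (t - s) = x - v * s := by rw [← hc, hv]; ring
          simp only [e]
          rw [if_pos (by nlinarith [hs.2])]
      · push Not at hlt
        have hvp : 0 < v := by
          by_contra hn
          have : v = 0 := le_antisymm (not_lt.1 hn) hv0
          rw [this] at hlt; linarith
        have hm : x ∈ Ioc 0 (v * t) := ⟨hx', hlt⟩
        rw [if_neg hlt.not_gt, zero_add, hG]
        simp only
        rw [indicator_of_mem hm]
        set σ := x / v with hσ
        have e : v * σ = x := by rw [hσ]; field_simp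
        have hσ0 : 0 ≤ σ := by positivity
        have hσt : σ ≤ t := by rw [hσ, div_le_iff₀ hvp]; linarith
        have ez : (0 : ℝ) - ((n : ℝ) - 6) * (σ - 0) = x := by rw [← hc, ← e, hv]; ring
        have := h.weighted hQ hχ hχ' hn (a := 0) le_rfl hσ0 (hσt.trans ht.2) le_rfl
          (by rw [ez]; exact hx'.le)
        rw [this, ez]
        congr 1
        have hlt : ∀ s, v * s < x ↔ s < σ := fun s => by
          rw [hσ, lt_div_iff₀ hvp, mul_comm]
        simp_rw [hlt]
        have e0 : ∀ s : ℝ, (if s < σ then R s (x - v * s) else 0) =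
            (Iio σ).indicator (fun s => R s (x - v * s)) s := fun s => by simp [indicator]
        simp_rw [e0]
        rw [intervalIntegral.integral_of_le ht.1, setIntegral_indicator measurableSet_Iio]
        have hset : Ioc 0 t ∩ Iio σ = Ioo 0 σ := by
          ext s
          simp only [mem_inter_iff, mem_Ioc, mem_Iio, mem_Ioo]
          constructor
          · rintro ⟨⟨h1, h2⟩, h3⟩; exact ⟨h1, h3⟩
          · rintro ⟨h1, h3⟩; exact ⟨⟨h1, by linarith⟩, h3⟩
        rw [hset, ← integral_Ioc_eq_integral_Ioo, ← intervalIntegral.integral_of_le hσ0]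
        refine intervalIntegral.integral_congr fun s _ => ?_
        have e1 : (0 : ℝ) - ((n : ℝ) - 6) * (σ - s) = x - v * s := by rw [← hc, ← e, hv]; ring
        simp only [e1, hR, hc]
    have key := setIntegral_congr_fun (μ := volume) measurableSet_Ioi hpt
    rw [integral_add J1 hG1, integral_add (hi 0 h0T) I1, J2, I2, hG2] at key
    have hsplit : ∫ s in (0 : ℝ)..t, ((∫ a in Ioi (0 : ℝ), R s a) + c * (χ 0 * f s n 0)) =
        (∫ s in (0 : ℝ)..t, ∫ a in Ioi (0 : ℝ), R s a) +
          c * ∫ s in (0 : ℝ)..t, χ 0 * f s n 0 := by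
      have hii : IntervalIntegrable (fun s => ∫ a in Ioi (0 : ℝ), R s a) volume 0 t := by
        have hm : StronglyMeasurable fun s => ∫ a in Ioi (0 : ℝ), R s a :=
          hRc.stronglyMeasurable.integral_prod_right'
        refine (intervalIntegrable_const (c := B.toReal)).mono_fun
          hm.aestronglyMeasurable ?_
        filter_upwards [ae_restrict_mem measurableSet_uIoc] with s hs
        rw [uIoc_of_le ht.1] at hs
        have h1 := hRB s ⟨hs.1.le, hs.2⟩
        have h2 := abs_integral_le_expMoment (h1.trans_lt hB.lt_top)
        rw [Real.norm_eq_abs, Real.norm_eq_abs, abs_of_nonneg ENNReal.toReal_nonneg]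
        exact h2.trans (ENNReal.toReal_mono hB h1)
      rw [intervalIntegral.integral_add hii (hRint.intervalIntegrable _ _),
        intervalIntegral.integral_const_mul]
    change _ = _ + ∫ s in (0 : ℝ)..t, ((∫ a in Ioi (0 : ℝ), R s a) + c * (χ 0 * f s n 0))
    rw [hsplit]
    have : c = -v := by rw [hv]; ring
    rw [this]
    linarith

end

/-! ### Moments of a solution -/

/-- The moment `∫_0^∞ χ(a) u(a) da`. -/
noncomputable def mom (χ u : ℝ → ℝ) : ℝ := ∫ a in Ioi (0 : ℝ), χ a * u a

/-- Continuous functions that every increasing exponential dominates on `[0, ∞)`. -/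
structure Tame (χ : ℝ → ℝ) : Prop where
  continuous : Continuous χ
  le_exp : ∀ q : ℝ, 0 < q → q ≤ 1 → ∃ C : ℝ, 0 ≤ C ∧ ∀ a, 0 ≤ a → |χ a| ≤ C * Real.exp (q * a)

lemma tame_const (c : ℝ) : Tame fun _ => c where
  continuous := continuous_const
  le_exp q hq _ := ⟨|c|, abs_nonneg c, fun a ha =>
    le_mul_of_one_le_right (abs_nonneg c) (Real.one_le_exp (by positivity))⟩

lemma tame_id : Tame fun a => a where
  continuous := continuous_id
  le_exp q hq hq1 := ⟨q⁻¹, by positivity, fun a ha => by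
    rw [abs_of_nonneg ha]; linarith [one_add_le_exp (a := a) hq hq1]⟩

lemma Tame.mul {χ η : ℝ → ℝ} (h : Tame χ) (h' : Tame η) : Tame fun a => χ a * η a where
  continuous := h.continuous.mul h'.continuous
  le_exp q hq hq1 := by
    obtain ⟨C, hC, h1⟩ := h.le_exp (q / 2) (by positivity) (by linarith)
    obtain ⟨C', hC', h2⟩ := h'.le_exp (q / 2) (by positivity) (by linarith)
    refine ⟨C * C', by positivity, fun a ha => ?_⟩
    rw [abs_mul]
    calc _ ≤ (C * Real.exp (q / 2 * a)) * (C' * Real.exp (q / 2 * a)) :=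
          mul_le_mul (h1 a ha) (h2 a ha) (abs_nonneg _) (by positivity)
      _ = C * C' * (Real.exp (q / 2 * a) * Real.exp (q / 2 * a)) := by ring
      _ = _ := by rw [← Real.exp_add]; congr 2; ring

lemma expMoment_zero_mul_le {χ u : ℝ → ℝ} {q C E : ℝ} (hC : 0 ≤ C)
    (hχ : ∀ a, 0 ≤ a → |χ a| ≤ C * Real.exp (q * a)) (h : expMoment q u ≤ ENNReal.ofReal E) :
    expMoment 0 (fun a => χ a * u a) ≤ ENNReal.ofReal (C * E) := by
  rw [ENNReal.ofReal_mul hC]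
  refine le_trans ?_ (mul_le_mul_right h _)
  unfold expMoment
  rw [← lintegral_const_mul' _ _ ENNReal.ofReal_ne_top]
  refine setLIntegral_mono' measurableSet_Ioi fun a ha => ?_
  rw [zero_mul, Real.exp_zero, ENNReal.ofReal_one, one_mul, abs_mul,
    ENNReal.ofReal_mul (abs_nonneg _), ← mul_assoc, ← ENNReal.ofReal_mul hC]
  exact mul_le_mul_left (ENNReal.ofReal_le_ofReal (hχ a (le_of_lt ha))) _

lemma abs_mom_le {χ u : ℝ → ℝ} {q C E : ℝ} (hC : 0 ≤ C) (hE : 0 ≤ E)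
    (hχ : ∀ a, 0 ≤ a → |χ a| ≤ C * Real.exp (q * a)) (h : expMoment q u ≤ ENNReal.ofReal E) :
    |mom χ u| ≤ C * E := by
  have h1 := expMoment_zero_mul_le hC hχ h
  refine (abs_integral_le_expMoment (h1.trans_lt ENNReal.ofReal_lt_top)).trans ?_
  exact ENNReal.toReal_le_of_le_ofReal (by positivity) h1

lemma integrableOn_mul {χ u : ℝ → ℝ} {q C E : ℝ} (hχc : Continuous χ) (hu : Continuous u)
    (hC : 0 ≤ C) (hχ : ∀ a, 0 ≤ a → |χ a| ≤ C * Real.exp (q * a))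
    (h : expMoment q u ≤ ENNReal.ofReal E) : IntegrableOn (fun a => χ a * u a) (Ioi 0) :=
  integrable_of_expMoment le_rfl (hχc.mul hu).aestronglyMeasurable
    ((expMoment_zero_mul_le hC hχ h).trans_lt ENNReal.ofReal_lt_top)

lemma mom_gain {β : ℝ} {χ : ℝ → ℝ} {u : State} {n : ℕ} (hn : 2 ≤ n)
    (h : ∀ m, 2 ≤ m → IntegrableOn (fun a => χ a * u m a) (Ioi 0)) :
    IntegrableOn (fun a => χ a * gain β (fun m => u m a) n) (Ioi 0) ∧
    mom χ (fun a => gain β (fun m => u m a) n) = gain β (fun m => mom χ (u m)) n := by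
  unfold mom gain
  split_ifs with h2
  · have e : (fun a => χ a * ((β + 1) * ((n : ℝ) + 1) * u (n + 1) a)) =
        fun a => (β + 1) * ((n : ℝ) + 1) * (χ a * u (n + 1) a) := by
      funext a; ring
    simp only [add_zero, e]
    exact ⟨(h (n + 1) (by omega)).const_mul _, integral_const_mul _ _⟩
  · have e : (fun a => χ a * ((β + 1) * ((n : ℝ) + 1) * u (n + 1) a +
        β * ((n : ℝ) - 1) * u (n - 1) a)) = fun a => (β + 1) * ((n : ℝ) + 1) * (χ a * u (n + 1) a) +
        β * ((n : ℝ) - 1) * (χ a * u (n - 1) a) := by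
      funext a; ring
    have i1 := (h (n + 1) (by omega)).const_mul ((β + 1) * ((n : ℝ) + 1))
    have i2 := (h (n - 1) (by omega)).const_mul (β * ((n : ℝ) - 1))
    simp only [e]
    refine ⟨i1.add i2, ?_⟩
    rw [integral_add i1 i2, integral_const_mul, integral_const_mul]

/-- Global solutions of the equation with the clipped weight, as fixed points of the iteration
step, together with the standing assumptions of the construction. -/
structure ClippedSolution (β M c₀ : ℝ) (g : State) (f : ℝ → State) : Prop where
  hβ : 0 < β
  hM : 0 ≤ M
  hc : 0 < c₀
  data : Data β M g
  curve : Curve β M c₀ g f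
  fixed : ∀ t n, 2 ≤ n → ∀ a, step β c₀ g f t n a = f t n a

section
variable {β M c₀ : ℝ} {g : State} {f : ℝ → State} {χ χ' : ℝ → ℝ} {ω : ℕ → ℝ} {c : ℝ}

lemma ClippedSolution.jointCont (h : ClippedSolution β M c₀ g f) : JointCont f :=
  h.curve.jointCont h.hβ h.hM h.hc h.data

lemma ClippedSolution.continuous_clipWeight (h : ClippedSolution β M c₀ g f) :
    Continuous (clipWeight β c₀ f) :=
  h.curve.continuous_clipWeight h.hβ h.hM h.hc h.data

lemma ClippedSolution.solves_damped (h : ClippedSolution β M c₀ g f) (T : ℝ) :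
    Solves β T (clipWeight β c₀ f) (stepSource β c₀ f) g f where
  init n hn a ha := by
    rw [← h.fixed 0 n hn]
    exact (h.curve.step_solves h.hβ h.hM h.hc h.data T).init n hn a ha
  boundary n hn t ht := by
    rw [← h.fixed t n (by omega)]
    exact (h.curve.step_solves h.hβ h.hM h.hc h.data T).boundary n hn t ht
  duhamel n hn τ t a h0 h1 h2 h3 h4 := by
    have := (h.curve.step_solves h.hβ h.hM h.hc h.data T).duhamel n hn τ t a h0 h1 h2 h3 h4
    rwa [h.fixed t n hn, h.fixed τ n hn] at this

lemma ClippedSolution.solves (h : ClippedSolution β M c₀ g f) (T : ℝ) :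
    Solves β T (fun _ => 0) (fun s n a => clipWeight β c₀ f s *
      (gain β (fun m => f s m a) n - lam β n * f s n a)) g f := by
  refine ((h.solves_damped T).change_damping h.continuous_clipWeight continuous_const
    (h.curve.jointCont_stepSource h.hβ h.hM h.hc h.data)).congr fun s _ n _ a _ => ?_
  unfold stepSource; ring

lemma ClippedSolution.exists_moment (h : ClippedSolution β M c₀ g f) (T : ℝ) :
    ∃ q A ρ : ℝ, 0 < q ∧ q ≤ 1 ∧ 0 ≤ A ∧ ratio β ≤ ρ ∧ 0 < ρ ∧ ρ < 1 ∧
      ∀ t, t ≤ T → ∀ n, 2 ≤ n → expMoment q (f t n) ≤ ENNReal.ofReal (A * psi ρ n) := by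
  obtain ⟨q, A, ρ, hq, hq1, hA, hρ, hρ1, hm⟩ :=
    Curve.exists_moment h.hβ h.hM h.hc h.data (le_max_right T 0)
  exact ⟨q, A, ρ, hq, hq1, hA, hρ, (ratio_pos h.hβ).trans_le hρ, hρ1, fun t ht =>
    hm f h.curve t (ht.trans (le_max_left _ _))⟩

lemma ClippedSolution.integrableOn (h : ClippedSolution β M c₀ g f) (hχ : Tame χ) (t : ℝ) {n : ℕ}
    (hn : 2 ≤ n) : IntegrableOn (fun a => χ a * f t n a) (Ioi 0) := by
  obtain ⟨q, A, ρ, hq, hq1, hA, -, -, -, hm⟩ := h.exists_moment t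
  obtain ⟨C, hC, hχC⟩ := hχ.le_exp q hq hq1
  exact integrableOn_mul hχ.continuous (h.curve.continuous_area h.hβ h.hM h.hc h.data hn t) hC hχC
    (hm t le_rfl n hn)

lemma ClippedSolution.exists_mom_le (h : ClippedSolution β M c₀ g f) (hχ : Tame χ) (T : ℝ) :
    ∃ A ρ : ℝ, 0 ≤ A ∧ ratio β ≤ ρ ∧ 0 < ρ ∧ ρ < 1 ∧
      ∀ t, t ≤ T → ∀ n, 2 ≤ n → |mom χ (f t n)| ≤ A * psi ρ n := by
  obtain ⟨q, A, ρ, hq, hq1, hA, hρ, hρ0, hρ1, hm⟩ := h.exists_moment T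
  obtain ⟨C, hC, hχC⟩ := hχ.le_exp q hq hq1
  refine ⟨C * A, ρ, by positivity, hρ, hρ0, hρ1, fun t ht n hn => ?_⟩
  rw [mul_assoc]
  exact abs_mom_le hC (mul_nonneg hA (psi_nonneg hρ0.le n)) hχC (hm t ht n hn)

/-- Moments are summable against every power of `n`. -/
lemma ClippedSolution.summable_mom (h : ClippedSolution β M c₀ g f) (hχ : Tame χ) (t : ℝ) (j : ℕ)
    (hω : ∀ n, 2 ≤ n → |ω n| ≤ c * (n : ℝ) ^ j) :
    Summable fun k : ℕ => ω (k + 2) * mom χ (f t (k + 2)) := by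
  obtain ⟨A, ρ, hA, -, hρ0, hρ1, hm⟩ := h.exists_mom_le hχ t
  obtain ⟨ρ', h1, h2⟩ := exists_between hρ1
  obtain ⟨C, hC, hp⟩ := exists_psi_le hρ0.le h1 (j + 1)
  have hs := ((summable_nat_add_iff 2).2
    (summable_geometric_of_lt_one (hρ0.trans h1).le h2)).mul_left (|c| * A * C)
  refine hs.of_norm_bounded fun k => ?_
  have hn : 2 ≤ k + 2 := by omega
  have hn1 : (1 : ℝ) ≤ ((k + 2 : ℕ) : ℝ) := by exact_mod_cast (by omega : 1 ≤ k + 2)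
  set n := k + 2
  have h3 : |ω n| ≤ |c| * (n : ℝ) ^ j :=
    (hω n hn).trans (mul_le_mul_of_nonneg_right (le_abs_self c) (by positivity))
  have h4 : psi ρ' n ≤ ρ' ^ n := by
    rw [← mul_psi ρ' (n := n) (by omega)]
    exact le_mul_of_one_le_left (psi_nonneg (hρ0.trans h1).le n) hn1
  have h5 := hp n
  have h6 := psi_nonneg hρ0.le n
  have h7 : (n : ℝ) ^ j * psi ρ n ≤ (n : ℝ) ^ (j + 1) * psi ρ n :=
    mul_le_mul_of_nonneg_right (pow_le_pow_right₀ hn1 (by omega)) h6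
  rw [Real.norm_eq_abs, abs_mul]
  calc _ ≤ (|c| * (n : ℝ) ^ j) * (A * psi ρ n) :=
        mul_le_mul h3 (hm t le_rfl n hn) (abs_nonneg _) (by positivity)
    _ = |c| * A * ((n : ℝ) ^ j * psi ρ n) := by ring
    _ ≤ |c| * A * (C * ρ' ^ n) := by
        refine mul_le_mul_of_nonneg_left (h7.trans (h5.trans ?_)) (by positivity)
        exact mul_le_mul_of_nonneg_left h4 hC.le
    _ = _ := by ring

lemma ClippedSolution.continuous_mom (h : ClippedSolution β M c₀ g f) (hχ : Tame χ) {n : ℕ}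
    (hn : 2 ≤ n) : Continuous fun t => mom χ (f t n) := by
  rw [continuous_iff_continuousAt]
  intro t
  obtain ⟨q, hq, hq1, ht⟩ := h.curve.tendsto_edgeMoment h.hβ h.hM h.hc h.data t
  obtain ⟨C, hC, hχC⟩ := hχ.le_exp q hq hq1
  rw [ContinuousAt, tendsto_iff_dist_tendsto_zero]
  have h1 : Tendsto (fun s => C * (edgeMoment q (f s - f t)).toReal) (𝓝 t) (𝓝 0) := by
    have := ((ENNReal.tendsto_toReal ENNReal.zero_ne_top).comp ht).const_mul C
    simpa using this
  refine squeeze_zero' (Eventually.of_forall fun _ => dist_nonneg) ?_ h1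
  filter_upwards [ht.eventually (gt_mem_nhds ENNReal.zero_lt_top)] with s hs
  have e : mom χ (f s n) - mom χ (f t n) = mom χ ((f s - f t) n) := by
    unfold mom
    rw [← integral_sub (h.integrableOn hχ s hn) (h.integrableOn hχ t hn)]
    congr 1; funext a; simp only [Pi.sub_apply]; ring
  rw [Real.dist_eq, e]
  refine abs_mom_le hC ENNReal.toReal_nonneg hχC ?_
  rw [ENNReal.ofReal_toReal hs.ne]
  obtain ⟨k, rfl⟩ : ∃ k, n = k + 2 := ⟨n - 2, by omega⟩
  refine le_trans ?_ (ENNReal.le_tsum k)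
  refine le_mul_of_one_le_left' ?_
  rw [ENNReal.one_le_ofReal]; exact_mod_cast (by omega : 1 ≤ k + 2)

lemma ClippedSolution.continuous_tsum_mom (h : ClippedSolution β M c₀ g f) (hχ : Tame χ)
    (hω : ∀ n, 2 ≤ n → |ω n| ≤ c * n) :
    Continuous fun t => ∑' k : ℕ, ω (k + 2) * mom χ (f t (k + 2)) := by
  rw [continuous_iff_continuousAt]
  intro t
  obtain ⟨A, ρ, hA, -, hρ0, hρ1, hm⟩ := h.exists_mom_le hχ (t + 1)
  have hs := ((summable_nat_add_iff 2).2 (summable_geometric_of_lt_one hρ0.le hρ1)).mul_left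
    (|c| * A)
  have : ContinuousOn (fun t => ∑' k : ℕ, ω (k + 2) * mom χ (f t (k + 2))) (Iic (t + 1)) := by
    refine continuousOn_tsum (fun k => ?_) hs fun k s hs => ?_
    · exact (continuous_const.mul (h.continuous_mom hχ (by omega))).continuousOn
    · have hn : 2 ≤ k + 2 := by omega
      have h3 : |ω (k + 2)| ≤ |c| * ((k + 2 : ℕ) : ℝ) :=
        (hω _ hn).trans (mul_le_mul_of_nonneg_right (le_abs_self c) (by positivity))
      rw [Real.norm_eq_abs, abs_mul]
      calc _ ≤ (|c| * ((k + 2 : ℕ) : ℝ)) * (A * psi ρ (k + 2)) :=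
            mul_le_mul h3 (hm s hs _ hn) (abs_nonneg _) (by positivity)
        _ = |c| * A * (((k + 2 : ℕ) : ℝ) * psi ρ (k + 2)) := by ring
        _ = _ := by rw [mul_psi ρ (by omega)]
  exact this.continuousAt (Iic_mem_nhds (by linarith))

end

/-! ### Balance laws -/

/-- The rate of change of the moment `∫ χ f_n da`, where `χ'` is the derivative of `χ`. -/
noncomputable def momRate (β c₀ : ℝ) (f : ℝ → State) (χ χ' : ℝ → ℝ) (n : ℕ) (s : ℝ) : ℝ :=
  ((n : ℝ) - 6) * mom χ' (f s n) + ((n : ℝ) - 6) * (χ 0 * f s n 0) +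
    clipWeight β c₀ f s * (gain β (fun m => mom χ (f s m)) n - lam β n * mom χ (f s n))

section
variable {β M c₀ : ℝ} {g : State} {f : ℝ → State} {χ χ' : ℝ → ℝ} {ω : ℕ → ℝ} {c : ℝ}

lemma ClippedSolution.mom_eq (h : ClippedSolution β M c₀ g f) (hχ : Tame χ) (hχ' : Tame χ')
    (hd : ∀ a, HasDerivAt χ (χ' a) a) {n : ℕ} (hn : 2 ≤ n) {t : ℝ} (ht : 0 ≤ t) :
    mom χ (f t n) = mom χ (f 0 n) + ∫ s in (0 : ℝ)..t, momRate β c₀ f χ χ' n s := by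
  have hj := h.jointCont
  have hΓ := h.continuous_clipWeight
  have hQ : JointCont fun s n a => clipWeight β c₀ f s *
      (gain β (fun m => f s m a) n - lam β n * f s n a) := (hj.gain.sub hj.lam_mul).mul_time hΓ
  have hgain : ∀ s n, 2 ≤ n → Continuous fun a => gain β (fun m => f s m a) n := fun s n hn =>
    hj.gain.comp hn continuous_const continuous_id
  have hfc : ∀ s n, 2 ≤ n → Continuous (f s n) := fun s n hn =>
    hj.comp hn continuous_const continuous_id
  obtain ⟨q, A, ρ, hq, hq1, hA, -, hρ0, -, hm⟩ := h.exists_moment t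
  obtain ⟨C, hC, hχC⟩ := hχ.le_exp q hq hq1
  obtain ⟨C', hC', hχC'⟩ := hχ'.le_exp q hq hq1
  have hψ := psi_nonneg hρ0.le
  set G := gain β (fun m => A * psi ρ m) n
  have hbound : ∀ s ∈ Icc 0 t, expMoment 0 (fun a => ((n : ℝ) - 6) * χ' a * f s n a +
      χ a * (clipWeight β c₀ f s * (gain β (fun m => f s m a) n - lam β n * f s n a))) ≤
      ENNReal.ofReal |(n : ℝ) - 6| * ENNReal.ofReal (C' * (A * psi ρ n)) +
        (ENNReal.ofReal (weightBound β M c₀ t) * ENNReal.ofReal (C * G) +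
        ENNReal.ofReal (weightBound β M c₀ t) * (ENNReal.ofReal (lam β n) *
          ENNReal.ofReal (C * (A * psi ρ n)))) := by
    intro s hs
    have e : (fun a => ((n : ℝ) - 6) * χ' a * f s n a + χ a * (clipWeight β c₀ f s *
        (gain β (fun m => f s m a) n - lam β n * f s n a))) =
        fun a => ((n : ℝ) - 6) * (χ' a * f s n a) + (clipWeight β c₀ f s *
          (χ a * gain β (fun m => f s m a) n) +
          clipWeight β c₀ f s * (-lam β n * (χ a * f s n a))) := by
      funext a; ring
    have m1 : Measurable fun a => ((n : ℝ) - 6) * (χ' a * f s n a) :=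
      (continuous_const.mul (hχ'.continuous.mul (hfc s n hn))).measurable
    have m2 : Measurable fun a => clipWeight β c₀ f s * (χ a * gain β (fun m => f s m a) n) :=
      (continuous_const.mul (hχ.continuous.mul (hgain s n hn))).measurable
    have hW : |clipWeight β c₀ f s| ≤ weightBound β M c₀ t := by
      rw [abs_of_nonneg (h.curve.clipWeight_nonneg h.hc s)]
      exact h.curve.clipWeight_le h.hc hs.2
    rw [e]
    refine (expMoment_add_le m1).trans (add_le_add ?_ ((expMoment_add_le m2).trans
      (add_le_add ?_ ?_)))
    · rw [expMoment_const_mul]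
      exact mul_le_mul_right (expMoment_zero_mul_le hC' hχC' (hm s hs.2 n hn)) _
    · rw [expMoment_const_mul]
      exact mul_le_mul' (ENNReal.ofReal_le_ofReal hW) (expMoment_zero_mul_le hC hχC
        (expMoment_gain_le h.hβ hn (fun m hm => (hfc s m hm).measurable)
          (fun m _ => mul_nonneg hA (hψ m)) (fun m hm' => hm s hs.2 m hm')))
    · rw [expMoment_const_mul, expMoment_const_mul, abs_neg, abs_of_nonneg (lam_nonneg h.hβ n)]
      exact mul_le_mul' (ENNReal.ofReal_le_ofReal hW)
        (mul_le_mul_right (expMoment_zero_mul_le hC hχC (hm s hs.2 n hn)) _)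
  have key := (h.solves t).moment_identity hQ hj hd hχ'.continuous hn ⟨ht, le_rfl⟩ (by finiteness)
    (fun s _ => h.integrableOn hχ s hn) hbound
  change mom χ (f t n) = _ at key
  rw [key]
  change mom χ (f 0 n) + _ = _
  congr 1
  refine intervalIntegral.integral_congr fun s _ => ?_
  obtain ⟨i1, e1⟩ := mom_gain (β := β) (u := f s) hn fun m hm => h.integrableOn hχ s hm
  have i2 := h.integrableOn hχ s hn
  have i3 := h.integrableOn hχ' s hn
  have e : (fun a => ((n : ℝ) - 6) * χ' a * f s n a + χ a * (clipWeight β c₀ f s *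
        (gain β (fun m => f s m a) n - lam β n * f s n a))) =
        fun a => ((n : ℝ) - 6) * (χ' a * f s n a) + clipWeight β c₀ f s *
          (χ a * gain β (fun m => f s m a) n - lam β n * (χ a * f s n a)) := by
      funext a; ring
  have i4 : IntegrableOn (fun a => clipWeight β c₀ f s * (χ a * gain β (fun m => f s m a) n -
      lam β n * (χ a * f s n a))) (Ioi 0) := (i1.sub (i2.const_mul _)).const_mul _
  simp only [momRate]
  rw [e, integral_add (i3.const_mul _) i4,
    integral_const_mul, integral_const_mul, integral_sub i1 (i2.const_mul _), integral_const_mul,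
    ← e1]
  simp only [mom]; ring

lemma ClippedSolution.continuous_momRate (h : ClippedSolution β M c₀ g f) (hχ : Tame χ)
    (hχ' : Tame χ') {n : ℕ} (hn : 2 ≤ n) : Continuous (momRate β c₀ f χ χ' n) := by
  have hΓ := h.continuous_clipWeight
  have h1 : Continuous fun s => f s n 0 := h.jointCont.comp hn continuous_id continuous_const
  have h2 := h.continuous_mom hχ hn
  have h3 := h.continuous_mom hχ' hn
  have h4 : Continuous fun s => gain β (fun m => mom χ (f s m)) n := by
    unfold gain
    have := h.continuous_mom hχ (n := n + 1) (by omega)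
    split_ifs with h2
    · fun_prop
    · have := h.continuous_mom hχ (n := n - 1) (by omega)
      fun_prop
  unfold momRate
  fun_prop

/-- A summable bound on the rates, uniform in time, for exchanging the sum over `n` with the time
integral. -/
lemma ClippedSolution.exists_momRate_le (h : ClippedSolution β M c₀ g f) (hχ : Tame χ)
    (hχ' : Tame χ') (T : ℝ) : ∃ K ρ : ℝ, 0 ≤ K ∧ 0 < ρ ∧ ρ < 1 ∧
      ∀ s, s ≤ T → ∀ n, 2 ≤ n → |momRate β c₀ f χ χ' n s| ≤ K * ρ ^ n := by
  obtain ⟨A, ρ₁, hA, hr, hρ0, hρ1, hm⟩ := h.exists_mom_le hχ T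
  obtain ⟨A', ρ₂, hA', -, hρ0', hρ1', hm'⟩ := h.exists_mom_le hχ' T
  have hW := weightBound_nonneg h.hβ h.hM h.hc T
  have hβ := h.hβ
  have hM := h.hM
  set W := weightBound β M c₀ T
  set ρ := max ρ₁ ρ₂ with hρ
  have hlt : ρ < 1 := max_lt hρ1 hρ1'
  refine ⟨2 * A' + 2 * (|χ 0| * (M / β)) + W * (A * (2 * (2 * β + 1) + 2 * (β + 1))), ρ,
    by positivity, hρ0.trans_le (le_max_left _ _), hlt, fun s hs n hn => ?_⟩
  have hn' : (2 : ℝ) ≤ n := by exact_mod_cast hn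
  have h6 : |(n : ℝ) - 6| ≤ 2 * n := by rw [abs_le]; constructor <;> linarith
  have hψ1 := psi_nonneg hρ0.le n
  have hp1 : psi ρ₁ n ≤ psi ρ n := psi_mono hρ0.le (le_max_left _ _) n
  have hp2 : psi ρ₂ n ≤ psi ρ n := psi_mono hρ0'.le (le_max_right _ _) n
  have hψ := hψ1.trans hp1
  have t1 : |((n : ℝ) - 6) * mom χ' (f s n)| ≤ 2 * n * (A' * psi ρ n) := by
    rw [abs_mul]
    refine mul_le_mul h6 ((hm' s hs n hn).trans ?_) (abs_nonneg _) (by positivity)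
    gcongr
  have t2 : |((n : ℝ) - 6) * (χ 0 * f s n 0)| ≤ 2 * n * (|χ 0| * (M / β * psi ρ n)) := by
    rw [abs_mul, abs_mul, abs_of_nonneg (h.curve.nonneg s n hn 0)]
    refine mul_le_mul h6 (mul_le_mul_of_nonneg_left ((h.curve.le s n hn 0).trans ?_)
      (abs_nonneg _)) (mul_nonneg (abs_nonneg _) (h.curve.nonneg s n hn 0)) (by positivity)
    calc M * phi β n = M / β * psi (ratio β) n := by rw [phi_eq]; ring
      _ ≤ _ := mul_le_mul_of_nonneg_left
        (psi_mono (ratio_pos hβ).le (hr.trans (le_max_left ρ₁ ρ₂)) n) (by positivity)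
  have t3 : |gain β (fun m => mom χ (f s m)) n - lam β n * mom χ (f s n)| ≤
      A * ((2 * (2 * β + 1) + 2 * (β + 1)) * (n * psi ρ n)) := by
    have hl := lam_le hβ n
    have hl0 := lam_nonneg hβ n
    have g1 := abs_gain_le hβ hn fun m hm2 => hm s hs m hm2
    rw [gain_const_mul] at g1
    have g2 := gain_psi_le hβ hr hρ1.le hn
    have g3 : |lam β n * mom χ (f s n)| ≤ lam β n * (A * psi ρ₁ n) := by
      rw [abs_mul, abs_of_nonneg hl0]
      exact mul_le_mul_of_nonneg_left (hm s hs n hn) hl0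
    refine (abs_sub _ _).trans ((add_le_add g1 g3).trans ?_)
    calc _ ≤ A * ((lam β n + 2 * (β + 1)) * psi ρ₁ n) + lam β n * (A * psi ρ₁ n) := by gcongr
      _ = A * ((2 * lam β n + 2 * (β + 1) * 1) * psi ρ₁ n) := by ring
      _ ≤ A * ((2 * ((2 * β + 1) * n) + 2 * (β + 1) * n) * psi ρ n) := by
        gcongr; linarith
      _ = _ := by ring
  have t4 : |clipWeight β c₀ f s| ≤ W := by
    rw [abs_of_nonneg (h.curve.clipWeight_nonneg h.hc s)]
    exact h.curve.clipWeight_le h.hc hs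
  unfold momRate
  refine (abs_add_le _ _).trans ((add_le_add ((abs_add_le _ _).trans (add_le_add t1 t2))
    ((abs_mul _ _).le.trans (mul_le_mul t4 t3 (abs_nonneg _) hW))).trans (le_of_eq ?_))
  rw [← mul_psi ρ (by omega : 1 ≤ n)]; ring

/-- The balance law for weighted sums of moments. -/
theorem ClippedSolution.tsum_mom_eq (h : ClippedSolution β M c₀ g f) (hχ : Tame χ) (hχ' : Tame χ')
    (hd : ∀ a, HasDerivAt χ (χ' a) a) (hω : ∀ n, 2 ≤ n → |ω n| ≤ c * n) {t : ℝ} (ht : 0 ≤ t) :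
    ∑' k : ℕ, ω (k + 2) * mom χ (f t (k + 2)) = (∑' k : ℕ, ω (k + 2) * mom χ (f 0 (k + 2))) +
      ∫ s in (0 : ℝ)..t, ∑' k : ℕ, ω (k + 2) * momRate β c₀ f χ χ' (k + 2) s := by
  obtain ⟨K, ρ, hK, hρ0, hρ1, hb⟩ := h.exists_momRate_le hχ hχ' t
  have hs : Summable fun k : ℕ => |c| * K * (((k + 2 : ℕ) : ℝ) * ρ ^ (k + 2)) := by
    have hρ : ‖ρ‖ < 1 := by rwa [Real.norm_eq_abs, abs_of_pos hρ0]
    have := summable_pow_mul_geometric_of_norm_lt_one 1 hρ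
    simp only [pow_one] at this
    exact ((summable_nat_add_iff (f := fun n : ℕ => (n : ℝ) * ρ ^ n) 2).2 this).mul_left _
  have hb' : ∀ s, s ≤ t → ∀ k : ℕ, ‖ω (k + 2) * momRate β c₀ f χ χ' (k + 2) s‖ ≤
      |c| * K * (((k + 2 : ℕ) : ℝ) * ρ ^ (k + 2)) := by
    intro s hst k
    have h3 : |ω (k + 2)| ≤ |c| * ((k + 2 : ℕ) : ℝ) :=
      (hω _ (by omega)).trans (mul_le_mul_of_nonneg_right (le_abs_self c) (by positivity))
    rw [Real.norm_eq_abs, abs_mul]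
    refine (mul_le_mul h3 (hb s hst _ (by omega)) (abs_nonneg _) (by positivity)).trans
      (le_of_eq ?_)
    ring
  have key := intervalIntegral.hasSum_integral_of_dominated_convergence (μ := volume) (a := 0)
    (b := t) (F := fun k s => ω (k + 2) * momRate β c₀ f χ χ' (k + 2) s)
    (fun k _ => |c| * K * (((k + 2 : ℕ) : ℝ) * ρ ^ (k + 2)))
    (fun k => (continuous_const.mul
      (h.continuous_momRate hχ hχ' (by omega))).aestronglyMeasurable)
    (fun k => ae_of_all _ fun s hs => hb' s (by rw [uIoc_of_le ht] at hs; exact hs.2) k)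
    (ae_of_all _ fun _ _ => hs) intervalIntegrable_const
    (ae_of_all _ fun s hs' => (hs.of_norm_bounded
      (hb' s (by rw [uIoc_of_le ht] at hs'; exact hs'.2))).hasSum)
  have hω' : ∀ n, 2 ≤ n → |ω n| ≤ c * (n : ℝ) ^ 1 := by simpa using hω
  rw [← key.tsum_eq, ← (h.summable_mom hχ 0 1 hω').tsum_add key.summable]
  refine tsum_congr fun k => ?_
  rw [intervalIntegral.integral_const_mul, h.mom_eq hχ hχ' hd (by omega) ht]; ring

end

/-! ### Conservation laws and the lower bound on the denominator -/

/-- The rate `∑ (6 - n) f_n(0)` at which grains disappear at `a = 0`. -/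
def edgeFlux (u : State) : ℝ := 4 * u 2 0 + 3 * u 3 0 + 2 * u 4 0 + u 5 0

/-- The second moment `∑_{n ≥ 2} ∫_0^∞ a² u_n(a) da`. -/
noncomputable def secondMoment (u : State) : ℝ := ∑' k : ℕ, mom (fun a => a * a) (u (k + 2))

/-- The sum `∑_{n ≥ 2} n³ M φ_n`. -/
noncomputable def cubicSum (β M : ℝ) : ℝ :=
  ∑' k : ℕ, ((k + 2 : ℕ) : ℝ) ^ 3 * (M * phi β (k + 2))

lemma hasSum_boundary {u : State} (hu : ∀ n, 6 < n → u n 0 = 0) (ω : ℕ → ℝ) :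
    HasSum (fun k : ℕ => ω (k + 2) * u (k + 2) 0)
      (ω 2 * u 2 0 + ω 3 * u 3 0 + ω 4 * u 4 0 + ω 5 * u 5 0 + ω 6 * u 6 0) := by
  have : HasSum (fun k : ℕ => ω (k + 2) * u (k + 2) 0)
      (∑ k ∈ Finset.range 5, ω (k + 2) * u (k + 2) 0) :=
    hasSum_sum_of_ne_finset_zero fun k hk => by
      rw [hu (k + 2) (by simp at hk; omega), mul_zero]
  simpa [Finset.sum_range_succ] using this

lemma weightNum_eq {u : State} (hu : ∀ n, 6 < n → u n 0 = 0) : weightNum u = boundaryFlux u := by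
  rw [weightNum, (hasSum_boundary hu fun n => ((n : ℝ) - 6) ^ 2).tsum_eq, boundaryFlux]
  norm_num

/-- Gronwall's inequality in integral form. -/
lemma le_mul_exp_of_le_integral {u : ℝ → ℝ} (hu : Continuous u) {b K : ℝ} (hK : 0 ≤ K)
    (h : ∀ t, 0 ≤ t → u t ≤ b + ∫ s in (0 : ℝ)..t, K * u s) {t : ℝ} (ht : 0 ≤ t) :
    u t ≤ b * Real.exp (K * t) := by
  have hc : Continuous fun s => K * u s := by fun_prop
  set U : ℝ → ℝ := fun t => b + ∫ s in (0 : ℝ)..t, K * u s with hU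
  have hd : ∀ s, HasDerivAt U (K * u s) s := fun s =>
    (intervalIntegral.integral_hasDerivAt_right (hc.intervalIntegrable _ _)
      hc.stronglyMeasurable.stronglyMeasurableAtFilter hc.continuousAt).const_add _
  have hV : ∀ s, HasDerivAt (fun s => U s * Real.exp (-(K * s)))
      (K * (u s - U s) * Real.exp (-(K * s))) s := fun s => by
    have h1 : HasDerivAt (fun s => Real.exp (-(K * s))) (Real.exp (-(K * s)) * (-K)) s := by
      simpa using (((hasDerivAt_id s).const_mul K).neg).exp
    refine ((hd s).mul h1).congr_deriv ?_
    ring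
  have hanti : AntitoneOn (fun s => U s * Real.exp (-(K * s))) (Ici 0) := by
    refine antitoneOn_of_deriv_nonpos (convex_Ici 0)
      (fun s _ => (hV s).continuousAt.continuousWithinAt)
      (fun s _ => (hV s).differentiableAt.differentiableWithinAt) fun s hs => ?_
    rw [(hV s).deriv]
    rw [interior_Ici] at hs
    have := h s (le_of_lt hs)
    exact mul_nonpos_of_nonpos_of_nonneg
      (mul_nonpos_of_nonneg_of_nonpos hK (by simp only [hU]; linarith)) (Real.exp_nonneg _)
  have h1 := hanti (mem_Ici.2 le_rfl) (mem_Ici.2 ht) ht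
  have h2 : U 0 = b := by simp [hU]
  simp only [h2, mul_zero, neg_zero, Real.exp_zero, mul_one] at h1
  rw [Real.exp_neg, ← div_eq_mul_inv, div_le_iff₀ (Real.exp_pos _)] at h1
  exact (h t ht).trans h1

/-- The first moment is controlled by the second one on `[n, ∞)`, where `n a ≤ a²`, and by the
supremum on `[0, n]`. -/
lemma mul_mom_two_mul_le {u : ℝ → ℝ} {b : ℝ} (n : ℕ) (hb : ∀ a, 0 ≤ a → u a ≤ b)
    (h0 : ∀ a, 0 ≤ a → 0 ≤ u a)
    (h1 : IntegrableOn (fun a => 2 * a * u a) (Ioi 0))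
    (h2 : IntegrableOn (fun a => a * a * u a) (Ioi 0)) :
    (n : ℝ) * mom (fun a => 2 * a) u ≤ 2 * ((n : ℝ) ^ 3 * b + mom (fun a => a * a) u) := by
  have hb0 : 0 ≤ b := (h0 0 le_rfl).trans (hb 0 le_rfl)
  have i1 : IntegrableOn ((Ioc (0 : ℝ) n).indicator fun _ => (n : ℝ) ^ 2 * b) (Ioi 0) := by
    refine Integrable.integrableOn ?_
    rw [integrable_indicator_iff measurableSet_Ioc]
    exact integrableOn_const (by simp)
  have e1 : ∫ a in Ioi (0 : ℝ), (Ioc (0 : ℝ) n).indicator (fun _ => (n : ℝ) ^ 2 * b) a =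
      (n : ℝ) ^ 3 * b := by
    rw [setIntegral_indicator measurableSet_Ioc, inter_eq_right.2 Ioc_subset_Ioi_self,
      setIntegral_const]
    simp; ring
  unfold mom
  rw [← e1, ← integral_const_mul, ← integral_add i1 h2, ← integral_const_mul]
  refine setIntegral_mono_on (h1.const_mul _) ((i1.add h2).const_mul _) measurableSet_Ioi
    fun a ha => ?_
  have ha0 : 0 < a := ha
  have := h0 a ha0.le
  by_cases han : a ≤ n
  · have hm : a ∈ Ioc (0 : ℝ) n := ⟨ha0, han⟩
    rw [indicator_of_mem hm]
    have h3 := hb a ha0.le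
    have h4 : (n : ℝ) * (a * u a) ≤ n * (n * b) := by gcongr
    have h5 : 0 ≤ a * a * u a := by positivity
    nlinarith
  · push Not at han
    rw [indicator_of_notMem fun hm => absurd hm.2 (not_le.2 han)]
    have h4 : (n : ℝ) * (a * u a) ≤ a * (a * u a) := by gcongr
    nlinarith

lemma mom_zero (u : ℝ → ℝ) : mom (fun _ => 0) u = 0 := by simp [mom]

lemma mom_one (u : ℝ → ℝ) : mom (fun _ => 1) u = ∫ a in Ioi (0 : ℝ), u a := by simp [mom]

lemma mom_congr {χ u v : ℝ → ℝ} (h : ∀ a, 0 ≤ a → u a = v a) : mom χ u = mom χ v :=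
  setIntegral_congr_fun measurableSet_Ioi fun a ha => by simp only [h a (le_of_lt ha)]

lemma mom_nonneg {χ u : ℝ → ℝ} (hχ : ∀ a, 0 ≤ a → 0 ≤ χ a) (h : ∀ a, 0 ≤ a → 0 ≤ u a) :
    0 ≤ mom χ u :=
  setIntegral_nonneg measurableSet_Ioi fun a ha =>
    mul_nonneg (hχ a (le_of_lt ha)) (h a (le_of_lt ha))

lemma numGrains_eq (u : State) : numGrains u = ∑' k : ℕ, mom (fun _ => 1) (u (k + 2)) := by
  simp only [mom_one, numGrains]

lemma polyDefect_eq (u : State) :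
    polyDefect u = ∑' k : ℕ, (((k + 2 : ℕ) : ℝ) - 6) * mom (fun _ => 1) (u (k + 2)) := by
  simp only [mom_one, polyDefect]

lemma weightDen_eq (β : ℝ) (u : State) :
    weightDen β u = (∑' k : ℕ, ((k + 2 : ℕ) : ℝ) * mom (fun _ => 1) (u (k + 2))) -
      2 * (β + 1) * mom (fun _ => 1) (u 2) := by
  simp only [mom_one, weightDen]

lemma abs_sub_six_le (n : ℕ) (hn : 2 ≤ n) : |(n : ℝ) - 6| ≤ 2 * n := by
  have : (2 : ℝ) ≤ n := by exact_mod_cast hn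
  rw [abs_le]; constructor <;> linarith

section
variable {β M c₀ : ℝ} {g : State} {f : ℝ → State} {χ χ' : ℝ → ℝ} {ω : ℕ → ℝ} {c : ℝ}

lemma summable_cubic (hβ : 0 < β) (M : ℝ) :
    Summable fun k : ℕ => ((k + 2 : ℕ) : ℝ) ^ 3 * (M * phi β (k + 2)) := by
  have hρ : ‖ratio β‖ < 1 := by
    rw [Real.norm_eq_abs, abs_of_pos (ratio_pos hβ)]; exact ratio_lt_one hβ
  have h1 := summable_pow_mul_geometric_of_norm_lt_one 2 hρ
  have h2 := ((summable_nat_add_iff (f := fun n : ℕ => (n : ℝ) ^ 2 * ratio β ^ n) 2).2 h1).mul_left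
    (M / β)
  refine h2.congr fun k => ?_
  rw [phi_eq, ← mul_psi (ratio β) (by omega : 1 ≤ k + 2)]
  ring

lemma ClippedSolution.boundary (h : ClippedSolution β M c₀ g f) {n : ℕ} (hn : 6 < n) {t : ℝ}
    (ht : 0 ≤ t) : f t n 0 = 0 :=
  (h.solves t).boundary n hn t ⟨ht, le_rfl⟩

lemma ClippedSolution.summable_mom_zero (h : ClippedSolution β M c₀ g f) (hχ : Tame χ) (t : ℝ) :
    Summable fun k : ℕ => mom χ (f t (k + 2)) := by
  simpa using h.summable_mom (ω := fun _ => 1) (c := 1) hχ t 0 (by simp)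

lemma ClippedSolution.summable_mom_one (h : ClippedSolution β M c₀ g f) (hχ : Tame χ) (t : ℝ) :
    Summable fun k : ℕ => ((k + 2 : ℕ) : ℝ) * mom χ (f t (k + 2)) :=
  h.summable_mom (ω := fun n => (n : ℝ)) (c := 1) hχ t 1 (by simp)

lemma ClippedSolution.summable_mom_sub_six (h : ClippedSolution β M c₀ g f) (hχ : Tame χ) (t : ℝ) :
    Summable fun k : ℕ => (((k + 2 : ℕ) : ℝ) - 6) * mom χ (f t (k + 2)) :=
  h.summable_mom (ω := fun n => (n : ℝ) - 6) (c := 2) hχ t 1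
    (by simpa using fun n hn => abs_sub_six_le n hn)

/-- The coupling drops out of unweighted sums, as it conserves the number of grains. -/
lemma ClippedSolution.tsum_momRate (h : ClippedSolution β M c₀ g f) (hχ : Tame χ) (hχ' : Tame χ')
    {s : ℝ} (hs : 0 ≤ s) : ∑' k : ℕ, momRate β c₀ f χ χ' (k + 2) s =
      (∑' k : ℕ, (((k + 2 : ℕ) : ℝ) - 6) * mom χ' (f s (k + 2))) - χ 0 * edgeFlux (f s) := by
  have h1 := (h.summable_mom_sub_six hχ' s).hasSum
  have h2 := (hasSum_boundary (fun n hn => h.boundary hn hs) fun n => (n : ℝ) - 6).mul_left (χ 0)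
  have h3 := (hasSum_gain_sub (β := β) (u := fun n => mom χ (f s n))
    (h.summable_mom_one hχ s)).mul_left (clipWeight β c₀ f s)
  have := ((h1.add h2).add h3).tsum_eq
  rw [mul_zero, add_zero] at this
  rw [edgeFlux]
  refine Eq.trans (tsum_congr fun k => ?_) (this.trans ?_)
  · rw [momRate]; ring
  · push_cast; ring

/-- The balance law for `∑ ∫ χ f_n da`, which does not involve the weight. -/
lemma ClippedSolution.tsum_mom_sub (h : ClippedSolution β M c₀ g f) (hχ : Tame χ) (hχ' : Tame χ')
    (hd : ∀ a, HasDerivAt χ (χ' a) a) {t : ℝ} (ht : 0 ≤ t) :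
    ∑' k : ℕ, mom χ (f t (k + 2)) = (∑' k : ℕ, mom χ (f 0 (k + 2))) +
      ∫ s in (0 : ℝ)..t, ((∑' k : ℕ, (((k + 2 : ℕ) : ℝ) - 6) * mom χ' (f s (k + 2))) -
        χ 0 * edgeFlux (f s)) := by
  have key := h.tsum_mom_eq (ω := fun _ => 1) (c := 1) hχ hχ' hd
    (fun n hn => by rw [abs_one, one_mul]; exact_mod_cast (by omega : 1 ≤ n)) ht
  simp only [one_mul] at key
  rw [key]
  congr 1
  refine intervalIntegral.integral_congr fun s hs => ?_
  rw [uIcc_of_le ht] at hs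
  exact h.tsum_momRate hχ hχ' hs.1

lemma ClippedSolution.continuous_edgeFlux (h : ClippedSolution β M c₀ g f) :
    Continuous fun s => edgeFlux (f s) := by
  have hc : ∀ n, 2 ≤ n → Continuous fun s => f s n 0 := fun n hn =>
    h.jointCont.comp hn continuous_id continuous_const
  have := hc 2 (by omega)
  have := hc 3 (by omega)
  have := hc 4 (by omega)
  have := hc 5 (by omega)
  unfold edgeFlux
  fun_prop

lemma ClippedSolution.edgeFlux_nonneg (h : ClippedSolution β M c₀ g f) (s : ℝ) :
    0 ≤ edgeFlux (f s) := by
  unfold edgeFlux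
  have := h.curve.nonneg s 2 (by omega) 0
  have := h.curve.nonneg s 3 (by omega) 0
  have := h.curve.nonneg s 4 (by omega) 0
  have := h.curve.nonneg s 5 (by omega) 0
  positivity

/-- Grains are lost only through `a = 0`. -/
lemma ClippedSolution.numGrains_antitoneOn (h : ClippedSolution β M c₀ g f) :
    AntitoneOn (fun t => numGrains (f t)) (Ici 0) := by
  have key : ∀ t, 0 ≤ t → numGrains (f t) =
      numGrains (f 0) - ∫ s in (0 : ℝ)..t, edgeFlux (f s) := fun t ht => by
    have := h.tsum_mom_sub (tame_const 1) (tame_const 0) (fun a => hasDerivAt_const a 1) ht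
    simp only [mom_zero, mul_zero, tsum_zero, one_mul, zero_sub,
      intervalIntegral.integral_neg, ← numGrains_eq] at this
    rw [this]; ring
  intro s hs t ht hst
  simp only
  rw [key s hs, key t ht]
  have := intervalIntegral.integral_mono_interval (μ := volume) (c := 0) (a := 0) (b := s) (d := t)
    le_rfl hs hst (ae_of_all _ fun s => h.edgeFlux_nonneg s)
    (h.continuous_edgeFlux.intervalIntegrable _ _)
  linarith

lemma ClippedSolution.area_eq (h : ClippedSolution β M c₀ g f) {t : ℝ} (ht : 0 ≤ t) :
    area (f t) = area (f 0) + ∫ s in (0 : ℝ)..t, polyDefect (f s) := by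
  have := h.tsum_mom_sub tame_id (tame_const 1) (fun a => hasDerivAt_id a) ht
  simp only [zero_mul, sub_zero, ← polyDefect_eq] at this
  exact this

/-- The polyhedral defect changes by the boundary flux and by the coupling, whose first moment is
minus the denominator of the weight; for the unclipped weight the two cancel. -/
lemma ClippedSolution.polyDefect_eq (h : ClippedSolution β M c₀ g f) {t : ℝ} (ht : 0 ≤ t) :
    polyDefect (f t) = polyDefect (f 0) + ∫ s in (0 : ℝ)..t,
      (boundaryFlux (f s) - clipWeight β c₀ f s * weightDen β (f s)) := by
  have hT := tame_const 1
  have key := h.tsum_mom_eq (ω := fun n => (n : ℝ) - 6) (c := 2) hT (tame_const 0)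
    (fun a => hasDerivAt_const a 1) abs_sub_six_le ht
  rw [GrainGrowth.polyDefect_eq, GrainGrowth.polyDefect_eq, key]
  congr 1
  refine intervalIntegral.integral_congr fun s hs => ?_
  rw [uIcc_of_le ht] at hs
  have h2 := hasSum_boundary (fun n hn => h.boundary hn hs.1) fun n => ((n : ℝ) - 6) ^ 2
  have h3 := (hasSum_gain_sub (β := β) (u := fun n => mom (fun _ => 1) (f s n))
    (h.summable_mom_one hT s)).mul_left 6
  have h4 := hasSum_mul_gain_sub (β := β) (u := fun n => mom (fun _ => 1) (f s n))
    (h.summable_mom (ω := fun n => (n : ℝ) ^ 2) (c := 1) hT s 2 (by simp))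
  have := (h2.add ((h4.sub h3).mul_left (clipWeight β c₀ f s))).tsum_eq
  rw [boundaryFlux, weightDen_eq]
  refine Eq.trans (tsum_congr fun k => ?_) (this.trans ?_)
  · rw [momRate, mom_zero]; ring
  · push_cast; ring

/-- The polyhedral defect cannot become negative, as clipping only decreases the weight. -/
lemma ClippedSolution.polyDefect_nonneg (h : ClippedSolution β M c₀ g f)
    (h0 : 0 ≤ polyDefect (f 0)) {t : ℝ} (ht : 0 ≤ t) : 0 ≤ polyDefect (f t) := by
  rw [h.polyDefect_eq ht]
  refine add_nonneg h0 (intervalIntegral.integral_nonneg ht fun s _ => ?_)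
  have h1 : clipWeight β c₀ f s * weightDen β (f s) ≤
      clipWeight β c₀ f s * max (weightDen β (f s)) (c₀ * Real.exp (-2 * s)) :=
    mul_le_mul_of_nonneg_left (le_max_left _ _) (h.curve.clipWeight_nonneg h.hc s)
  have h2 : 0 < max (weightDen β (f s)) (c₀ * Real.exp (-2 * s)) :=
    lt_max_of_lt_right (mul_pos h.hc (Real.exp_pos _))
  rw [clipWeight, div_mul_cancel₀ _ h2.ne', ← clipWeight] at h1
  linarith

lemma tame_sq : Tame fun a => a * a := tame_id.mul tame_id

lemma tame_two_mul : Tame fun a => 2 * a := (tame_const 2).mul tame_id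

lemma ClippedSolution.continuous_secondMoment (h : ClippedSolution β M c₀ g f) :
    Continuous fun s => secondMoment (f s) := by
  have := h.continuous_tsum_mom (ω := fun _ => 1) (c := 1) tame_sq
    (fun n hn => by rw [abs_one, one_mul]; exact_mod_cast (by omega : 1 ≤ n))
  simpa only [one_mul, secondMoment] using this

/-- The second moment grows at most exponentially, with a rate that does not depend on the
weight. Its derivative `2 ∑ (n - 6) ∫ a f_n da` carries a factor `n`, which is traded for a factor
`a` on `[n, ∞)` and for the bound `M φ` on `[0, n]`. -/
lemma ClippedSolution.secondMoment_le (h : ClippedSolution β M c₀ g f) {t : ℝ} (ht : 0 ≤ t) :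
    secondMoment (f t) + cubicSum β M + 1 ≤
      (secondMoment (f 0) + cubicSum β M + 1) * Real.exp (2 * t) := by
  have hcont := h.continuous_secondMoment
  refine le_mul_exp_of_le_integral (u := fun t => secondMoment (f t) + cubicSum β M + 1)
    (by fun_prop) zero_le_two (fun t ht => ?_) ht
  have key := h.tsum_mom_sub tame_sq tame_two_mul
    (fun a => ((hasDerivAt_id a).mul (hasDerivAt_id a)).congr_deriv (by simp; ring)) ht
  simp only [mul_zero, zero_mul, sub_zero] at key
  have hle : ∀ s, ∑' k : ℕ, (((k + 2 : ℕ) : ℝ) - 6) * mom (fun a => 2 * a) (f s (k + 2)) ≤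
      2 * (secondMoment (f s) + cubicSum β M + 1) := fun s => by
    have h1 := (h.summable_mom_zero tame_sq s)
    have h2 := ((summable_cubic h.hβ M).add h1).mul_left 2
    refine ((h.summable_mom_sub_six tame_two_mul s).tsum_le_tsum (fun k => ?_) h2).trans ?_
    · have hn : 2 ≤ k + 2 := by omega
      have h3 := mul_mom_two_mul_le (k + 2) (fun a _ => h.curve.le s _ hn a)
        (fun a _ => h.curve.nonneg s _ hn a) (h.integrableOn tame_two_mul s hn)
        (h.integrableOn tame_sq s hn)
      have h4 : 0 ≤ mom (fun a => 2 * a) (f s (k + 2)) :=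
        mom_nonneg (fun a ha => by positivity) fun a _ => h.curve.nonneg s _ hn a
      linarith
    · rw [tsum_mul_left, (summable_cubic h.hβ M).tsum_add h1, ← secondMoment, ← cubicSum]
      linarith
  have hi := intervalIntegral.integral_mono_on (μ := volume) ht
    ((h.continuous_tsum_mom (ω := fun n => (n : ℝ) - 6) (c := 2) tame_two_mul
      abs_sub_six_le).intervalIntegrable 0 t)
    ((by fun_prop : Continuous fun s =>
      2 * (secondMoment (f s) + cubicSum β M + 1)).intervalIntegrable 0 t) fun s _ => hle s
  simp only [secondMoment] at key hi ⊢
  linarith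

/-- The Cauchy-Schwarz inequality in the form `∑ ∫ (x a - 1)² f_n da ≥ 0`: area cannot be carried
by few grains unless the second moment is large. -/
lemma ClippedSolution.numGrains_ge (h : ClippedSolution β M c₀ g f) (t x : ℝ) :
    2 * x * area (f t) - x ^ 2 * secondMoment (f t) ≤ numGrains (f t) := by
  have s1 := (h.summable_mom_zero tame_id t).mul_left (2 * x)
  have s2 := (h.summable_mom_zero tame_sq t).mul_left (x ^ 2)
  have s3 := h.summable_mom_zero (tame_const 1) t
  rw [numGrains_eq, secondMoment, area, ← tsum_mul_left, ← tsum_mul_left]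
  change (∑' k : ℕ, 2 * x * mom (fun a => a) (f t (k + 2))) - _ ≤ _
  rw [← s1.tsum_sub s2]
  refine (s1.sub s2).tsum_le_tsum (fun k => ?_) s3
  have hn : 2 ≤ k + 2 := by omega
  have i1 := (h.integrableOn tame_id t hn).const_mul (2 * x)
  have i2 := (h.integrableOn tame_sq t hn).const_mul (x ^ 2)
  have i3 := h.integrableOn (tame_const 1) t hn
  unfold mom
  rw [← integral_const_mul, ← integral_const_mul, ← integral_sub i1 i2]
  refine setIntegral_mono_on (i1.sub i2) i3 measurableSet_Ioi fun a _ => ?_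
  have := mul_nonneg (sq_nonneg (x * a - 1)) (h.curve.nonneg t _ hn a)
  linarith

/-- The denominator is `P + 6 N - 2 (β + 1) ∫ f_2 da`, and the integral is at most `N`. -/
lemma ClippedSolution.weightDen_ge_numGrains (h : ClippedSolution β M c₀ g f) (t : ℝ) :
    polyDefect (f t) + (4 - 2 * β) * numGrains (f t) ≤ weightDen β (f t) := by
  have hT := tame_const 1
  have s1 := h.summable_mom_zero hT t
  have s2 := h.summable_mom_one hT t
  have h1 : mom (fun _ => 1) (f t 2) ≤ numGrains (f t) := by
    rw [numGrains_eq]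
    exact s1.le_tsum 0 fun k _ => mom_nonneg (fun _ _ => zero_le_one)
      fun a _ => h.curve.nonneg t _ (by omega) a
  have h2 : polyDefect (f t) + 6 * numGrains (f t) =
      ∑' k : ℕ, ((k + 2 : ℕ) : ℝ) * mom (fun _ => 1) (f t (k + 2)) := by
    rw [GrainGrowth.polyDefect_eq, numGrains_eq, ← tsum_mul_left,
      ← (h.summable_mom_sub_six hT t).tsum_add (s1.mul_left 6)]
    exact tsum_congr fun k => by ring
  rw [weightDen_eq, ← h2]
  nlinarith [h.hβ]

/-- The height of the cut-off, small enough for the clipping to be inactive: the lower bound on the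
denominator at time `0` that follows from the Cauchy-Schwarz inequality. -/
noncomputable def cutoff (β M : ℝ) (g : State) : ℝ :=
  2 * (2 - β) * area g ^ 2 / (secondMoment g + cubicSum β M + 1)

lemma cubicSum_nonneg (hβ : 0 < β) (hM : 0 ≤ M) : 0 ≤ cubicSum β M :=
  tsum_nonneg fun k => by
    have := (phi_pos hβ (by omega : 2 ≤ k + 2)).le
    positivity

lemma secondMoment_nonneg {u : State} (h : ∀ n, 2 ≤ n → ∀ a, 0 ≤ a → 0 ≤ u n a) :
    0 ≤ secondMoment u :=
  tsum_nonneg fun k => mom_nonneg (fun a _ => mul_self_nonneg a) (h (k + 2) (by omega))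

lemma cutoff_pos (hβ : 0 < β) (hβ2 : β < 2) (hM : 0 ≤ M)
    (h : ∀ n, 2 ≤ n → ∀ a, 0 ≤ a → 0 ≤ g n a) (hA : 0 < area g) : 0 < cutoff β M g := by
  have := secondMoment_nonneg h
  have := cubicSum_nonneg hβ hM
  have : 0 < 2 - β := by linarith
  unfold cutoff
  positivity

lemma ClippedSolution.zero_eq (h : ClippedSolution β M c₀ g f) {n : ℕ} (hn : 2 ≤ n) {a : ℝ}
    (ha : 0 ≤ a) : f 0 n a = g n a := (h.solves 0).init n hn a ha

lemma ClippedSolution.area_zero (h : ClippedSolution β M c₀ g f) : area (f 0) = area g :=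
  tsum_congr fun _ => mom_congr (χ := fun a => a) fun _ ha => h.zero_eq (by omega) ha

lemma ClippedSolution.polyDefect_zero (h : ClippedSolution β M c₀ g f) :
    polyDefect (f 0) = polyDefect g := by
  rw [GrainGrowth.polyDefect_eq, GrainGrowth.polyDefect_eq]
  exact tsum_congr fun _ => by rw [mom_congr fun _ ha => h.zero_eq (by omega) ha]

lemma ClippedSolution.secondMoment_zero (h : ClippedSolution β M c₀ g f) :
    secondMoment (f 0) = secondMoment g :=
  tsum_congr fun _ => mom_congr fun _ ha => h.zero_eq (by omega) ha

/-- The clipping is inactive. None of the bounds used depends on the height of the cut-off, so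
that its choice is not circular. -/
theorem ClippedSolution.cutoff_le_weightDen (h : ClippedSolution β M (cutoff β M g) g f)
    (hβ2 : β < 2) (hP : polyDefect g = 0) (hA : 0 < area g) {t : ℝ} (ht : 0 ≤ t) :
    cutoff β M g * Real.exp (-2 * t) ≤ weightDen β (f t) := by
  have hP0 : polyDefect (f 0) = 0 := by rw [h.polyDefect_zero, hP]
  have hPt : ∀ s, 0 ≤ s → 0 ≤ polyDefect (f s) := fun s hs => h.polyDefect_nonneg hP0.ge hs
  have hAt : area g ≤ area (f t) := by
    rw [h.area_eq ht, h.area_zero]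
    have := intervalIntegral.integral_nonneg (μ := volume) ht fun s hs => hPt s hs.1
    linarith
  set B := (secondMoment g + cubicSum β M + 1) * Real.exp (2 * t) with hB
  have hC := cubicSum_nonneg h.hβ h.hM
  have hS0 := secondMoment_nonneg h.data.nonneg
  have hBpos : 0 < B := by positivity
  have hS : secondMoment (f t) ≤ B := by
    have := h.secondMoment_le ht
    rw [h.secondMoment_zero] at this
    linarith
  have hN : area g ^ 2 / B ≤ numGrains (f t) := by
    -- `x = A / B` maximizes `2 x A - x² B`
    refine le_trans ?_ (h.numGrains_ge t (area g / B))
    have h1 : 2 * (area g / B) * area g ≤ 2 * (area g / B) * area (f t) := by gcongr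
    have h2 : (area g / B) ^ 2 * secondMoment (f t) ≤ (area g / B) ^ 2 * B := by gcongr
    have h3 : (area g / B) ^ 2 * B = area g ^ 2 / B := by field_simp
    have h4 : 2 * (area g / B) * area g = 2 * (area g ^ 2 / B) := by ring
    linarith
  have h5 : cutoff β M g * Real.exp (-2 * t) = (4 - 2 * β) * (area g ^ 2 / B) := by
    rw [cutoff, hB, show (-2 : ℝ) * t = -(2 * t) by ring, Real.exp_neg]
    field_simp
    ring
  have h6 := h.weightDen_ge_numGrains t
  have h7 : (4 - 2 * β) * (area g ^ 2 / B) ≤ (4 - 2 * β) * numGrains (f t) :=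
    mul_le_mul_of_nonneg_left hN (by linarith)
  linarith [hPt t ht]

lemma ClippedSolution.weightDen_pos (h : ClippedSolution β M (cutoff β M g) g f)
    (hβ2 : β < 2) (hP : polyDefect g = 0) (hA : 0 < area g) {t : ℝ} (ht : 0 ≤ t) :
    0 < weightDen β (f t) :=
  (mul_pos h.hc (Real.exp_pos _)).trans_le (h.cutoff_le_weightDen hβ2 hP hA ht)

lemma ClippedSolution.clipWeight_eq (h : ClippedSolution β M (cutoff β M g) g f)
    (hβ2 : β < 2) (hP : polyDefect g = 0) (hA : 0 < area g) {t : ℝ} (ht : 0 ≤ t) :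
    clipWeight β (cutoff β M g) f t = weight β (f t) := by
  rw [clipWeight, max_eq_left (h.cutoff_le_weightDen hβ2 hP hA ht), weight,
    weightNum_eq fun n hn => h.boundary hn ht]

lemma ClippedSolution.polyDefect_eq_zero (h : ClippedSolution β M (cutoff β M g) g f)
    (hβ2 : β < 2) (hP : polyDefect g = 0) (hA : 0 < area g) {t : ℝ} (ht : 0 ≤ t) :
    polyDefect (f t) = 0 := by
  rw [h.polyDefect_eq ht, h.polyDefect_zero, hP, zero_add]
  refine (intervalIntegral.integral_congr fun s hs => ?_).trans intervalIntegral.integral_zero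
  rw [uIcc_of_le ht] at hs
  rw [h.clipWeight_eq hβ2 hP hA hs.1, weight,
    div_mul_cancel₀ _ (h.weightDen_pos hβ2 hP hA hs.1).ne',
    weightNum_eq fun n hn => h.boundary hn hs.1, sub_self]

lemma ClippedSolution.area_eq_area (h : ClippedSolution β M (cutoff β M g) g f)
    (hβ2 : β < 2) (hP : polyDefect g = 0) (hA : 0 < area g) {t : ℝ} (ht : 0 ≤ t) :
    area (f t) = area g := by
  rw [h.area_eq ht, h.area_zero]
  refine add_eq_left.2 ?_
  refine (intervalIntegral.integral_congr fun s hs => ?_).trans intervalIntegral.integral_zero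
  rw [uIcc_of_le ht] at hs
  exact h.polyDefect_eq_zero hβ2 hP hA hs.1

end

/-! ### Mild solutions along characteristics -/

/-- The extension of a curve on `[0, T]` that is frozen outside of `[0, T]` and for negative
areas. -/
def extend (T : ℝ) (h : ℝ → State) : ℝ → State := fun t n a => h (max 0 (min t T)) n (max a 0)

lemma lNorm_le_add {u v : State}
    (hv : ∀ n, 2 ≤ n → AEStronglyMeasurable (v n) (volume.restrict (Ioi 0))) :
    lNorm u ≤ lNorm (u - v) + lNorm v := by
  unfold lNorm
  rw [← ENNReal.tsum_add]
  refine ENNReal.tsum_le_tsum fun k => ?_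
  have := (hv (k + 2) (by omega)).aemeasurable
  rw [← lintegral_add_right' _ (by fun_prop)]
  refine setLIntegral_mono' measurableSet_Ioi fun a ha => ?_
  have ha0 : (0 : ℝ) < a := ha
  rw [← ENNReal.ofReal_add (by positivity) (by positivity), ← mul_add]
  refine ENNReal.ofReal_le_ofReal (mul_le_mul_of_nonneg_left ?_ (by positivity))
  simpa using abs_add_le (u (k + 2) a - v (k + 2) a) (v (k + 2) a)

/-- Splitting the integral at `R` bounds the `L¹` norm of a component by its supremum and its
first moment. -/
lemma expMoment_zero_le_of_split {u : State} {n : ℕ} (hn : 2 ≤ n) {b R : ℝ} (hR : 0 < R)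
    (hb : ∀ a, 0 ≤ a → |u n a| ≤ b) :
    expMoment 0 (u n) ≤ ENNReal.ofReal (R * b) + ENNReal.ofReal R⁻¹ * lNorm u := by
  have hb0 : 0 ≤ b := (abs_nonneg _).trans (hb 0 le_rfl)
  have h1 : expMoment 0 (u n) ≤ ∫⁻ a in Ioi (0 : ℝ),
      ((Ioc (0 : ℝ) R).indicator (fun _ => ENNReal.ofReal b) a +
        ENNReal.ofReal R⁻¹ * ENNReal.ofReal (((n : ℝ) + a) * |u n a|)) := by
    unfold expMoment
    refine setLIntegral_mono' measurableSet_Ioi fun a ha => ?_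
    have ha0 : (0 : ℝ) < a := ha
    rw [zero_mul, Real.exp_zero, ENNReal.ofReal_one, one_mul]
    by_cases haR : a ≤ R
    · have hm : a ∈ Ioc (0 : ℝ) R := ⟨ha0, haR⟩
      rw [indicator_of_mem hm]
      exact le_add_right (ENNReal.ofReal_le_ofReal (hb a ha0.le))
    · push Not at haR
      refine le_add_left ?_
      rw [← ENNReal.ofReal_mul (by positivity)]
      refine ENNReal.ofReal_le_ofReal ?_
      rw [← mul_assoc]
      refine le_mul_of_one_le_left (abs_nonneg _) ?_
      rw [inv_mul_eq_div, one_le_div hR]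
      have : (0 : ℝ) ≤ n := Nat.cast_nonneg n
      linarith
  refine h1.trans ?_
  rw [lintegral_add_left (measurable_const.indicator measurableSet_Ioc),
    lintegral_const_mul' _ _ ENNReal.ofReal_ne_top]
  refine add_le_add ?_ (mul_le_mul_right (lintegral_le_lNorm hn) _)
  refine (setLIntegral_le_lintegral _ _).trans ?_
  rw [lintegral_indicator measurableSet_Ioc, setLIntegral_const, Real.volume_Ioc, sub_zero,
    mul_comm R b, ENNReal.ofReal_mul hb0]

section
variable {β T : ℝ} {g : State} {h : ℝ → State}

lemma clampTime_mem (hT : 0 ≤ T) (t : ℝ) : max 0 (min t T) ∈ Icc 0 T :=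
  ⟨le_max_left _ _, max_le hT (min_le_right _ _)⟩

lemma clampTime_of_mem {t : ℝ} (ht : t ∈ Icc 0 T) : max 0 (min t T) = t := by
  rw [min_eq_left ht.2, max_eq_right ht.1]

lemma extend_apply {t : ℝ} (ht : t ∈ Icc 0 T) (n : ℕ) {a : ℝ} (ha : 0 ≤ a) :
    extend T h t n a = h t n a := by
  rw [extend, clampTime_of_mem ht, max_eq_left ha]

lemma tendsto_clampTime (hT : 0 ≤ T) (t : ℝ) :
    Tendsto (fun s => max 0 (min s T)) (𝓝 t) (𝓝[Icc 0 T] (max 0 (min t T))) :=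
  tendsto_nhdsWithin_iff.2 ⟨(by fun_prop : Continuous fun s => max 0 (min s T)).tendsto t,
    Eventually.of_forall fun s => clampTime_mem hT s⟩

lemma MemSolutionSpace.jointCont (hm : MemSolutionSpace β T h) (hT : 0 ≤ T) :
    JointCont (extend T h) := fun n hn => by
  refine continuous_of_timeCont (F := fun t a => extend T h t n a) (fun t => ?_) fun t ε hε => ?_
  · exact ((hm.memY _ (clampTime_mem hT t)).continuousOn n hn).comp_continuous
      (by fun_prop) fun a => mem_Ici.2 (le_max_right _ _)
  · have h1 := Metric.tendstoUniformlyOn_iff.1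
      (hm.continuous_comp n hn _ (clampTime_mem hT t)) ε hε
    filter_upwards [(tendsto_clampTime hT t).eventually h1] with s hs a
    have := hs (max a 0) (mem_Ici.2 (le_max_right _ _))
    rw [dist_comm, Real.dist_eq] at this
    exact this.le

/-- Compactness of `[0, T]` turns continuity with respect to `‖·‖_L` into a uniform bound. -/
lemma MemSolutionSpace.exists_lNorm_le (hm : MemSolutionSpace β T h) :
    ∃ L : ℝ, 0 ≤ L ∧ ∀ t ∈ Icc 0 T, lNorm (h t) ≤ ENNReal.ofReal L := by
  refine IsCompact.induction_on (p := fun s => ∃ L : ℝ, 0 ≤ L ∧ ∀ t ∈ s,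
    lNorm (h t) ≤ ENNReal.ofReal L) isCompact_Icc ⟨0, le_rfl, by simp⟩ ?_ ?_ ?_
  · rintro s s' hss ⟨L, hL, h1⟩
    exact ⟨L, hL, fun t ht => h1 t (hss ht)⟩
  · rintro s s' ⟨L, hL, h1⟩ ⟨L', hL', h2⟩
    refine ⟨max L L', hL.trans (le_max_left _ _), fun t ht => ?_⟩
    rcases ht with ht | ht
    · exact (h1 t ht).trans (ENNReal.ofReal_le_ofReal (le_max_left _ _))
    · exact (h2 t ht).trans (ENNReal.ofReal_le_ofReal (le_max_right _ _))
  · intro t ht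
    refine ⟨{s | lNorm (h s - h t) < 1}, (hm.continuous_lNorm t ht).eventually
      (gt_mem_nhds zero_lt_one), 1 + (lNorm (h t)).toReal, by positivity, fun s hs => ?_⟩
    rw [ENNReal.ofReal_add zero_le_one ENNReal.toReal_nonneg, ENNReal.ofReal_one,
      ENNReal.ofReal_toReal (hm.memY t ht).lNorm_lt_top.ne]
    exact (lNorm_le_add fun n hn => (hm.memY t ht).aestronglyMeasurable hn).trans
      (add_le_add (le_of_lt hs) le_rfl)

/-- A curve in the solution space decays geometrically in both norms. No exponential tails in the
area are available here; the split at `R = (ratio β) ^ (-n / 2)` balances the decay of `φ_n` against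
the first moment. -/
lemma MemSolutionSpace.exists_bounded (hβ : 0 < β) (hm : MemSolutionSpace β T h) :
    ∃ A ρ : ℝ, 0 ≤ A ∧ ratio β ≤ ρ ∧ ρ < 1 ∧ ∀ t ∈ Icc 0 T, ∀ n, 2 ≤ n →
      Bounded (h t n) (A * psi ρ n) := by
  obtain ⟨L, hL, hLn⟩ := hm.exists_lNorm_le
  obtain ⟨C, hC⟩ := hm.bounded
  have hr0 := ratio_pos hβ
  have hr1 := ratio_lt_one hβ
  set x := √(ratio β) with hx
  have hx0 : 0 < x := Real.sqrt_pos.2 hr0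
  have hxx : x * x = ratio β := Real.mul_self_sqrt hr0.le
  have hx1 : x < 1 := by nlinarith
  have hrx : ratio β ≤ x := by nlinarith
  obtain ⟨ρ, h1, h2⟩ := exists_between hx1
  obtain ⟨K, hK, hp⟩ := exists_psi_le hx0.le h1 1
  have hC' : ∀ t ∈ Icc 0 T, ∀ n, 2 ≤ n → ∀ a, 0 ≤ a → |h t n a| ≤ C * phi β n :=
    fun t ht => (betaNorm_le_iff hβ C.2).1 (by
      have := hC t ht
      rwa [← ENNReal.ofReal_coe_nnreal] at this)
  refine ⟨(C / β + L) * K, ρ, by positivity, hrx.trans h1.le, h2, fun t ht n hn => ?_⟩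
  have hxn : 0 < x ^ n := pow_pos hx0 n
  have hxn1 : x ^ n ≤ 1 := pow_le_one₀ hx0.le hx1.le
  have hn1 : 1 ≤ n := by omega
  have h3 : x ^ n ≤ K * psi ρ n := by
    have := hp n
    rwa [pow_one, mul_psi x hn1] at this
  have h4 : phi β n ≤ x ^ n * x ^ n / β := by
    rw [← mul_pow, hxx]; exact phi_le hβ hn
  have hb : Bounded (h t n) ((C / β + L) * x ^ n) := by
    constructor
    · intro a ha
      refine (hC' t ht n hn a ha).trans ?_
      calc C * phi β n ≤ C * (x ^ n * x ^ n / β) := by gcongr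
        _ ≤ C * (x ^ n * 1 / β) := by gcongr
        _ ≤ C * (x ^ n * 1 / β) + L * x ^ n := le_add_of_nonneg_right (by positivity)
        _ = _ := by ring
    · have h5 := expMoment_zero_le_of_split hn (inv_pos.2 hxn) (hC' t ht n hn)
      refine h5.trans ?_
      rw [inv_inv]
      refine (add_le_add le_rfl (mul_le_mul_right (hLn t ht) _)).trans ?_
      have := (phi_pos hβ hn).le
      rw [← ENNReal.ofReal_mul hxn.le, ← ENNReal.ofReal_add (by positivity) (by positivity)]
      refine ENNReal.ofReal_le_ofReal ?_
      have h6 : (x ^ n)⁻¹ * (C * phi β n) ≤ (x ^ n)⁻¹ * (C * (x ^ n * x ^ n / β)) := by gcongr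
      have h7 : (x ^ n)⁻¹ * (C * (x ^ n * x ^ n / β)) = C / β * x ^ n := by field_simp
      linarith
  refine hb.mono ?_
  rw [mul_assoc]
  gcongr

lemma MemSolutionSpace.continuous_weightDen (hβ : 0 < β) (hm : MemSolutionSpace β T h)
    (hT : 0 ≤ T) : Continuous fun t => weightDen β (h (max 0 (min t T))) := by
  rw [continuous_iff_continuousAt]
  intro t
  rw [ContinuousAt, tendsto_iff_dist_tendsto_zero]
  have ht := clampTime_mem hT t
  have h0 := (hm.continuous_lNorm _ ht).comp (tendsto_clampTime hT t)
  have h1 : Tendsto (fun s => edgeMoment 0 (h (max 0 (min s T)) - h (max 0 (min t T)))) (𝓝 t)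
      (𝓝 0) :=
    tendsto_of_tendsto_of_tendsto_of_le_of_le tendsto_const_nhds h0 (fun _ => zero_le)
      fun s => edgeMoment_zero_le_lNorm _
  have h2 := ((ENNReal.tendsto_toReal ENNReal.zero_ne_top).comp h1).const_mul (β + 2)
  simp only [ENNReal.toReal_zero, mul_zero] at h2
  refine squeeze_zero (fun _ => dist_nonneg) (fun s => ?_) h2
  have hs := clampTime_mem hT s
  rw [Real.dist_eq]
  exact abs_weightDen_sub_le hβ (fun n hn => (hm.memY _ hs).aestronglyMeasurable hn)
    (fun n hn => (hm.memY _ ht).aestronglyMeasurable hn)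
    ((edgeMoment_zero_le_lNorm _).trans_lt (hm.memY _ hs).lNorm_lt_top)
    ((edgeMoment_zero_le_lNorm _).trans_lt (hm.memY _ ht).lNorm_lt_top)

lemma IsMildSolution.weightNum_eq (hh : IsMildSolution β T g h) {t : ℝ} (ht : t ∈ Icc 0 T) :
    weightNum (h t) = boundaryFlux (h t) :=
  GrainGrowth.weightNum_eq fun n hn => hh.boundary n hn t ht

/-- The weight is continuous in time, being extended by its values at the ends of `[0, T]`. -/
lemma IsMildSolution.continuous_weight (hβ : 0 < β) (hT : 0 ≤ T) (hh : IsMildSolution β T g h) :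
    Continuous fun t => weight β (h (max 0 (min t T))) := by
  have hj := hh.memSolutionSpace.jointCont hT
  have hc : ∀ n, 2 ≤ n → Continuous fun t => h (max 0 (min t T)) n 0 := fun n hn => by
    have := hj.comp hn continuous_id (continuous_const (y := (0 : ℝ)))
    simpa [extend] using this
  have h1 : Continuous fun t => weightNum (h (max 0 (min t T))) := by
    have e : (fun t => weightNum (h (max 0 (min t T)))) =
        fun t => boundaryFlux (h (max 0 (min t T))) :=
      funext fun t => hh.weightNum_eq (clampTime_mem hT t)
    rw [e]
    exact (((continuous_const.mul (hc 2 (by omega))).add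
      (continuous_const.mul (hc 3 (by omega)))).add
      (continuous_const.mul (hc 4 (by omega)))).add (hc 5 (by omega))
  exact h1.div (hh.memSolutionSpace.continuous_weightDen hβ hT) fun t =>
    hh.weightDen_ne_zero _ (clampTime_mem hT t)

/-- Duhamel's formula started at time zero, with the transport group frozen outside the
quadrant, gives the formula along pieces of characteristics. -/
lemma IsMildSolution.solves (hβ : 0 < β) (hT : 0 ≤ T) (hh : IsMildSolution β T g h) :
    Solves β T (fun _ => 0) (fun s n a => weight β (h (max 0 (min s T))) *
      (gain β (fun m => extend T h s m a) n - lam β n * extend T h s n a)) g (extend T h) where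
  init n hn a ha := by rw [extend_apply ⟨le_rfl, hT⟩ n ha, hh.initial n hn a ha]
  boundary n hn t ht := by rw [extend_apply ht n le_rfl, hh.boundary n hn t ht]
  duhamel n hn τ t a h0 h1 h2 h3 h4 := by
    have hj := hh.memSolutionSpace.jointCont hT
    have hQ := ((hj.gain (β := β)).sub (hj.lam_mul (β := β))).mul_time (hh.continuous_weight hβ hT)
    set Q : ℝ → State := fun s n a => weight β (h (max 0 (min s T))) *
      (gain β (fun m => extend T h s m a) n - lam β n * extend T h s n a) with hQdef
    set c : ℝ := (n : ℝ) - 6 with hc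
    have key : ∀ t ∈ Icc 0 T, ∀ a, 0 ≤ a → h t n a = transport t g n a +
        ∫ s in (0 : ℝ)..t, if c * (t - s) ≤ a then Q s n (a - c * (t - s)) else 0 := by
      intro t ht a ha
      rw [hh.duhamel t ht n hn a ha]
      congr 1
      refine intervalIntegral.integral_congr fun s hs => ?_
      rw [uIcc_of_le ht.1] at hs
      have hs' : s ∈ Icc 0 T := ⟨hs.1, hs.2.trans ht.2⟩
      simp only [transport, ← hc]
      split_ifs with hle
      · have hfoot : 0 ≤ a - c * (t - s) := by linarith
        simp only [Pi.smul_apply, smul_eq_mul, hQdef, coupling_eq, clampTime_of_mem hs',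
          extend_apply hs' _ hfoot]
      · rfl
    have hint : ∀ (t a x y : ℝ), IntervalIntegrable
        (fun s => if c * (t - s) ≤ a then Q s n (a - c * (t - s)) else 0) volume x y := by
      intro t a x y
      have hcont : Continuous fun s => Q s n (a - c * (t - s)) :=
        hQ.comp hn continuous_id (by fun_prop)
      have hmeas : MeasurableSet {s : ℝ | c * (t - s) ≤ a} :=
        measurableSet_le (by fun_prop) measurable_const
      have := (hcont.intervalIntegrable (μ := volume) x y)
      rw [intervalIntegrable_iff] at this ⊢
      exact this.indicator hmeas
    have ht : t ∈ Icc 0 T := ⟨h0.trans h1, h2⟩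
    have hτ : τ ∈ Icc 0 T := ⟨h0, h1.trans h2⟩
    rw [extend_apply ht n h3, extend_apply hτ n h4, key t ht a h3, key τ hτ _ h4,
      ← intervalIntegral.integral_add_adjacent_intervals (hint t a 0 τ) (hint t a τ t)]
    have e1 : transport t g n a = transport τ g n (a - c * (t - τ)) := by
      have e : a - c * (t - τ) - c * τ = a - c * t := by ring
      have hiff : c * t ≤ a ↔ c * τ ≤ a - c * (t - τ) := by
        constructor <;> intro _ <;> linarith
      simp only [transport, ← hc, e, hiff]
    have e2 : (∫ s in (0 : ℝ)..τ, if c * (t - s) ≤ a then Q s n (a - c * (t - s)) else 0) =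
        ∫ s in (0 : ℝ)..τ, if c * (τ - s) ≤ a - c * (t - τ) then
          Q s n (a - c * (t - τ) - c * (τ - s)) else 0 := by
      refine intervalIntegral.integral_congr fun s _ => ?_
      have e : a - c * (t - τ) - c * (τ - s) = a - c * (t - s) := by ring
      have hiff : c * (t - s) ≤ a ↔ c * (τ - s) ≤ a - c * (t - τ) := by
        constructor <;> intro _ <;> linarith
      simp only [e, hiff]
    have e3 : (∫ s in τ..t, if c * (t - s) ≤ a then Q s n (a - c * (t - s)) else 0) =
        ∫ s in τ..t, Real.exp (damp β (fun _ => 0) n s - damp β (fun _ => 0) n t) *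
          Q s n (a - c * (t - s)) := by
      refine intervalIntegral.integral_congr fun s hs => ?_
      rw [uIcc_of_le h1] at hs
      have := foot_nonneg h3 h4 hs
      simp only [damp, intervalIntegral.integral_zero, mul_zero, sub_self, Real.exp_zero, one_mul]
      rw [if_pos (by linarith)]
    rw [e1, e2, e3]
    simp only [damp, intervalIntegral.integral_zero, mul_zero, sub_self, Real.exp_zero, one_mul]
    ring

end

/-! ### Uniqueness -/

section
variable {β M c₀ T : ℝ} {g : State} {f h : ℝ → State}

lemma ClippedSolution.exists_bounded (H : ClippedSolution β M c₀ g f) (hT : 0 ≤ T) :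
    ∃ A ρ : ℝ, 0 ≤ A ∧ ratio β ≤ ρ ∧ ρ < 1 ∧ ∀ t, t ≤ T → ∀ n, 2 ≤ n →
      Bounded (f t n) (A * psi ρ n) := by
  obtain ⟨A, ρ, hA, h1, h2, h3⟩ := Curve.exists_bound H.hβ H.hM H.hc H.data hT
  exact ⟨A, ρ, hA, h1, h2, h3 f H.curve⟩

/-- By compactness, a denominator without zeros is bounded away from zero. -/
lemma IsMildSolution.exists_weightDen_ge (hβ : 0 < β) (hT : 0 ≤ T) (hh : IsMildSolution β T g h) :
    ∃ c : ℝ, 0 < c ∧ ∀ t ∈ Icc 0 T, c ≤ |weightDen β (h t)| := by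
  obtain ⟨t₀, ht₀, hmin⟩ := isCompact_Icc.exists_isMinOn (nonempty_Icc.2 hT)
    (hh.memSolutionSpace.continuous_weightDen hβ hT).abs.continuousOn
  refine ⟨_, abs_pos.2 (hh.weightDen_ne_zero _ (clampTime_mem hT t₀)), fun t ht => ?_⟩
  have : _ ≤ |weightDen β (h (max 0 (min t T)))| := hmin ht
  rwa [clampTime_of_mem ht] at this

/-- A mild solution agrees with a solution of the clipped equation along which the clipping is
inactive: their difference is contracted, in the norms used for existence, by a fixed factor. -/
theorem ClippedSolution.eq_of_isMildSolution (H : ClippedSolution β M c₀ g f) (hT : 0 ≤ T)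
    (hclip : ∀ t, 0 ≤ t → c₀ * Real.exp (-2 * t) ≤ weightDen β (f t))
    (hh : IsMildSolution β T g h) {t : ℝ} (ht : t ∈ Icc 0 T) {n : ℕ} (hn : 2 ≤ n) {a : ℝ}
    (ha : 0 ≤ a) : h t n a = f t n a := by
  have hβ := H.hβ
  have hc := H.hc
  have hr := ratio_pos hβ
  have hmem := hh.memSolutionSpace
  obtain ⟨A₁, ρ₁, hA₁, hr₁, hρ₁, hb₁⟩ := H.exists_bounded hT
  obtain ⟨A₂, ρ₂, hA₂, hr₂, hρ₂, hb₂⟩ := hmem.exists_bounded hβ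
  obtain ⟨c, hcpos, hcle⟩ := hh.exists_weightDen_ge hβ hT
  obtain ⟨ρ, h1, h2⟩ := exists_between (max_lt hρ₁ hρ₂)
  have hρr : ratio β < ρ := (hr₁.trans (le_max_left _ _)).trans_lt h1
  have hρ0 : 0 < ρ := hr.trans hρr
  have hψ := psi_nonneg hρ0.le
  have hmax0 : 0 ≤ max ρ₁ ρ₂ := hr.le.trans (hr₁.trans (le_max_left _ _))
  have hbf : ∀ s ∈ Icc 0 T, ∀ n, 2 ≤ n → Bounded (f s n) ((A₁ + A₂) * psi (max ρ₁ ρ₂) n) :=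
    fun s hs n hn => (hb₁ s hs.2 n hn).mono (mul_le_mul (by linarith)
      (psi_mono (hr.le.trans hr₁) (le_max_left _ _) n) (psi_nonneg (hr.le.trans hr₁) n)
      (by positivity))
  have hbh : ∀ s ∈ Icc 0 T, ∀ n, 2 ≤ n →
      Bounded (extend T h s n) ((A₁ + A₂) * psi (max ρ₁ ρ₂) n) :=
    fun s hs n hn => ((hb₂ s hs n hn).mono (mul_le_mul (by linarith)
      (psi_mono (hr.le.trans hr₂) (le_max_right _ _) n) (psi_nonneg (hr.le.trans hr₂) n)
      (by positivity))).congr fun a ha => (extend_apply hs n ha).symm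
  obtain ⟨θ, hθ, hθ1, hgain⟩ := exists_gain_psi_le hβ hρr h2
  obtain ⟨C, hC, hcoup⟩ := exists_bounded_coupling hβ (add_nonneg hA₁ hA₂)
    (hr₁.trans (le_max_left ρ₁ ρ₂)) h1 h2
  have hF : 0 ≤ M * boundaryFlux (fun n _ => phi β n) :=
    (H.curve.boundaryFlux_nonneg 0).trans (H.curve.boundaryFlux_le 0)
  obtain ⟨L, hL, hLip⟩ := exists_weight_lipschitz hβ
    (lt_min hcpos (by positivity : 0 < c₀ * Real.exp (-2 * T))) hF hρ0 h2
  have hW := weightBound_nonneg hβ H.hM hc T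
  set W := weightBound β M c₀ T
  -- the growth rate absorbs the defect of the supersolution and the difference of the weights
  set K := (2 * (β + 1) * W + L * C) / θ with hK
  have hKθ : K * θ = 2 * (β + 1) * W + L * C := by rw [hK]; field_simp
  have hK0 : 0 ≤ K := by positivity
  have hjf := H.jointCont
  have hjh := hmem.jointCont hT
  have hΓf := H.continuous_clipWeight
  have hΓh := hh.continuous_weight hβ hT
  have hQh : JointCont fun s n a => weight β (h (max 0 (min s T))) *
      (gain β (fun m => extend T h s m a) n - lam β n * extend T h s n a) :=
    ((hjh.gain (β := β)).sub hjh.lam_mul).mul_time hΓh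
  -- both solutions are compared in the equation damped with the weight of `f`
  have hS := (hh.solves hβ hT).change_damping continuous_const hΓf hQh
  have hQ' : JointCont fun s n a => weight β (h (max 0 (min s T))) *
      (gain β (fun m => extend T h s m a) n - lam β n * extend T h s n a) +
      lam β n * (clipWeight β c₀ f s - 0) * extend T h s n a := by
    intro n hn
    have := hQh n hn
    have := hjh n hn
    fun_prop
  have hSw := hS.sub (H.solves_damped T) hΓf hQ'
    (H.curve.jointCont_stepSource hβ H.hM hc H.data)
  set R : ℝ → State := fun s n a => (weight β (h (max 0 (min s T))) - clipWeight β c₀ f s) *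
    (gain β (fun m => extend T h s m a) n - lam β n * extend T h s n a) with hR
  have hRc : JointCont R := ((hjh.gain (β := β)).sub hjh.lam_mul).mul_time (hΓh.sub hΓf)
  have hSR : Solves β T (clipWeight β c₀ f) (fun s n a => clipWeight β c₀ f s *
      gain β (fun m => extend T h s m a - f s m a) n + R s n a) (fun n a => g n a - g n a)
      (fun s n a => extend T h s n a - f s n a) := by
    refine hSw.congr fun s _ n _ a _ => ?_
    simp only [hR, stepSource, gain_sub]; ring
  have hmh : ∀ s n, 2 ≤ n → Continuous (extend T h s n) := fun s n hn =>
    hjh.comp hn continuous_const continuous_id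
  -- the difference is its own image under the contraction, so its a priori bound can be improved
  -- by the factor `θ` any number of times
  have hcontract : ∀ j : ℕ, ∀ t ∈ Icc 0 T, ∀ n, 2 ≤ n →
      Bounded (fun a => extend T h t n a - f t n a)
        (θ ^ j * (2 * (A₁ + A₂)) * Real.exp (K * t) * psi ρ n) := by
    intro j
    induction j with
    | zero =>
      intro t ht n hn
      refine ((hbh t ht n hn).sub (hbf t ht n hn) (hmh t n hn).measurable).mono ?_
      have h3 := psi_mono hmax0 h1.le n
      have h4 : 1 ≤ Real.exp (K * t) := Real.one_le_exp (mul_nonneg hK0 ht.1)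
      calc _ = 2 * (A₁ + A₂) * 1 * psi (max ρ₁ ρ₂) n := by ring
        _ ≤ 2 * (A₁ + A₂) * Real.exp (K * t) * psi ρ n := by
          have := psi_nonneg hmax0 n
          gcongr
        _ = _ := by rw [pow_zero, one_mul]
    | succ j ih =>
      have hD : 0 ≤ θ ^ j * (2 * (A₁ + A₂)) := by positivity
      have := Solves.contract (v := fun s n a => extend T h s n a - f s n a) (R := R) (W := W)
        (C := L * C) hβ hρ0 hθ hgain hKθ.ge hK0 hSR (fun n _ a _ => sub_self _) hΓf
        (fun s _ => H.curve.clipWeight_nonneg hc s) (fun s hs => H.curve.clipWeight_le hc hs.2)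
        (hjh.sub hjf) hRc (hjh.sub hjf) hD ih fun s hs n hn => ?_
      · intro t ht n hn
        rw [pow_succ', mul_assoc θ]
        exact this t ht n hn
      · have h3 := hcoup (extend T h s) (extend T h s) (fun n hn => (hmh s n hn).measurable)
          (hbh s hs) (hbh s hs) n hn
        refine (h3.const_mul (weight β (h (max 0 (min s T))) - clipWeight β c₀ f s)).mono ?_
        have hexp : c₀ * Real.exp (-2 * T) ≤ c₀ * Real.exp (-2 * s) :=
          mul_le_mul_of_nonneg_left (Real.exp_le_exp.2 (by linarith [hs.2])) hc.le
        have e : ∀ n, 2 ≤ n → ∀ a, 0 ≤ a → extend T h s n a = h s n a := fun n _ a ha =>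
          extend_apply hs n ha
        have hw : weight β (h (max 0 (min s T))) =
            boundaryFlux (extend T h s) / weightDen β (extend T h s) := by
          rw [clampTime_of_mem hs, weight, hh.weightNum_eq hs, weightDen_congr e, boundaryFlux,
            boundaryFlux, e 2 (by omega) 0 le_rfl, e 3 (by omega) 0 le_rfl,
            e 4 (by omega) 0 le_rfl, e 5 (by omega) 0 le_rfl]
        have hX : 0 ≤ θ ^ j * (2 * (A₁ + A₂)) * Real.exp (K * s) := by positivity
        have hfin : edgeMoment 0 (extend T h s) < ⊤ := by
          rw [edgeMoment_congr e]
          exact (edgeMoment_zero_le_lNorm _).trans_lt (hmem.memY s hs).lNorm_lt_top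
        have h4 := hLip (extend T h s) (f s) (weightDen β (extend T h s)) (weightDen β (f s)) _ hX
          (fun n hn => (hmh s n hn).aestronglyMeasurable)
          (H.curve.measurable hβ H.hM hc H.data s) hfin
          (H.curve.edgeMoment_zero_lt_top hβ H.hM hc H.data s)
          ((min_le_left _ _).trans (by rw [weightDen_congr e]; exact hcle s hs))
          ((min_le_right _ _).trans ((hexp.trans (hclip s hs.1)).trans (le_abs_self _)))
          le_rfl
          (by rw [abs_of_nonneg (H.curve.boundaryFlux_nonneg s)]; exact H.curve.boundaryFlux_le s)
          (ih s hs)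
        rw [hw, clipWeight, max_eq_left (hclip s hs.1)]
        have := hψ n
        calc _ ≤ L * (θ ^ j * (2 * (A₁ + A₂)) * Real.exp (K * s)) * (C * psi ρ n) :=
              mul_le_mul_of_nonneg_right h4 (by positivity)
          _ = _ := by ring
  have hlim : Tendsto (fun j : ℕ => θ ^ j * (2 * (A₁ + A₂)) * Real.exp (K * t) * psi ρ n) atTop
      (𝓝 0) := by
    have := (((tendsto_pow_atTop_nhds_zero_of_lt_one hθ.le hθ1).mul_const
      (2 * (A₁ + A₂))).mul_const (Real.exp (K * t))).mul_const (psi ρ n)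
    simpa using this
  have hle : |extend T h t n a - f t n a| ≤ 0 :=
    ge_of_tendsto' hlim fun j => (hcontract j t ht n hn).1 a ha
  rw [← extend_apply (h := h) ht n ha]
  exact sub_eq_zero.1 (abs_nonpos_iff.1 hle)

end

/-! ### The solution -/

section
variable {β M c₀ T : ℝ} {g : State} {f : ℝ → State}

lemma ClippedSolution.continuous_area (h : ClippedSolution β M c₀ g f) {n : ℕ} (hn : 2 ≤ n)
    (t : ℝ) : Continuous (f t n) :=
  h.curve.continuous_area h.hβ h.hM h.hc h.data hn t

lemma ClippedSolution.betaNorm_le (h : ClippedSolution β M c₀ g f) (t : ℝ) :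
    betaNorm β (f t) ≤ ENNReal.ofReal M :=
  (betaNorm_le_iff h.hβ h.hM).2 fun n hn a _ => by
    rw [abs_of_nonneg (h.curve.nonneg t n hn a)]; exact h.curve.le t n hn a

lemma ClippedSolution.memY (h : ClippedSolution β M c₀ g f) (t : ℝ) : MemY β (f t) where
  continuousOn n hn := (h.continuous_area hn t).continuousOn
  betaNorm_lt_top := (h.betaNorm_le t).trans_lt ENNReal.ofReal_lt_top
  lNorm_lt_top := by
    obtain ⟨q, hq, hq1, hm⟩ := h.curve.edgeMoment_lt_top h.hβ h.hM h.hc h.data t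
    exact (lNorm_le_edgeMoment hq hq1 _).trans_lt (ENNReal.mul_lt_top ENNReal.ofReal_lt_top hm)

lemma ClippedSolution.memSolutionSpace (h : ClippedSolution β M c₀ g f) (T : ℝ) :
    MemSolutionSpace β T f where
  memY t _ := h.memY t
  bounded := ⟨M.toNNReal, fun t _ => h.betaNorm_le t⟩
  continuous_comp n hn t _ := by
    rw [Metric.tendstoUniformlyOn_iff]
    intro ε hε
    filter_upwards [nhdsWithin_le_nhds (h.curve.timeCont n hn t (ε / 2) (by positivity))]
      with s hs a _
    rw [dist_comm, Real.dist_eq]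
    exact (hs a).trans_lt (by linarith)
  continuous_lNorm t _ := by
    obtain ⟨q, hq, hq1, ht⟩ := h.curve.tendsto_edgeMoment h.hβ h.hM h.hc h.data t
    have h1 := ENNReal.Tendsto.const_mul (a := ENNReal.ofReal q⁻¹)
      (ht.mono_left (nhdsWithin_le_nhds (s := Icc 0 T))) (Or.inr ENNReal.ofReal_ne_top)
    rw [mul_zero] at h1
    exact tendsto_of_tendsto_of_tendsto_of_le_of_le tendsto_const_nhds h1 (fun _ => zero_le)
      fun s => lNorm_le_edgeMoment hq hq1 _

/-- Integration along the piece of a characteristic inside the quadrant gives Duhamel's formula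
for the transport group. -/
lemma Solves.duhamel_transport {Q : ℝ → State} (h : Solves β T (fun _ => 0) Q g f) {t : ℝ}
    (ht : t ∈ Icc 0 T) {n : ℕ} (hn : 2 ≤ n) {a : ℝ} (ha : 0 ≤ a) :
    f t n a = transport t g n a + ∫ s in (0 : ℝ)..t, transport (t - s) (Q s) n a := by
  obtain ⟨σ, hσ, hfoot, hcase⟩ := exists_entry (n := n) ht.1 ha
  set c : ℝ := (n : ℝ) - 6 with hc
  have hfoot' : 0 ≤ a - c * (t - σ) := hfoot
  have key := h.duhamel n hn σ t a hσ.1 hσ.2 ht.2 ha hfoot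
  simp only [damp, intervalIntegral.integral_zero, mul_zero, sub_self, Real.exp_zero,
    one_mul] at key
  have hin : ∫ s in σ..t, transport (t - s) (Q s) n a =
      ∫ s in σ..t, Q s n (a - c * (t - s)) := by
    refine intervalIntegral.integral_congr fun s hs => ?_
    rw [uIcc_of_le hσ.2] at hs
    have := foot_nonneg ha hfoot hs
    simp only [transport, ← hc]
    rw [if_pos (by linarith)]
  rw [key, ← hc, ← hin]
  rcases hcase with rfl | ⟨h6, hσ0, hz⟩
  · congr 1
    rw [sub_zero] at hfoot' ⊢
    rw [transport, if_pos (by linarith), h.init n hn _ hfoot']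
  · have hc0 : 0 < c := by
      have : (6 : ℝ) < n := by exact_mod_cast h6
      rw [hc]; linarith
    have hz' : a - c * (t - σ) = 0 := hz
    have hlt : a < c * t := by nlinarith
    have hz1 : f σ n (a - c * (t - σ)) = 0 := by
      rw [hz']; exact h.boundary n h6 σ ⟨hσ.1, hσ.2.trans ht.2⟩
    rw [hz1]
    congr 1
    · rw [transport, if_neg (by rw [← hc]; exact not_le.2 hlt)]
    -- before the entry time the transport semigroup vanishes on the characteristic
    · have e0 : ∀ s, transport (t - s) (Q s) n a =
          (Ici σ).indicator (fun s => transport (t - s) (Q s) n a) s := fun s => by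
        by_cases hs : s ∈ Ici σ
        · rw [indicator_of_mem hs]
        · rw [indicator_of_notMem hs, transport, if_neg]
          rw [mem_Ici, not_le] at hs
          rw [← hc]
          nlinarith
      rw [intervalIntegral.integral_of_le ht.1,
        setIntegral_congr_fun measurableSet_Ioc fun s _ => e0 s,
        setIntegral_indicator measurableSet_Ici, intervalIntegral.integral_of_le hσ.2,
        ← integral_Icc_eq_integral_Ioc]
      congr 2
      ext s
      simp only [mem_inter_iff, mem_Icc, mem_Ioc, mem_Ici]
      constructor
      · rintro ⟨h1, h2⟩; exact ⟨⟨by linarith, h2⟩, h1⟩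
      · rintro ⟨⟨-, h2⟩, h1⟩; exact ⟨h1, h2⟩

lemma ClippedSolution.isMildSolution (h : ClippedSolution β M (cutoff β M g) g f)
    (hβ2 : β < 2) (hP : polyDefect g = 0) (hA : 0 < area g) (T : ℝ) :
    IsMildSolution β T g f where
  memSolutionSpace := h.memSolutionSpace T
  weightDen_ne_zero t ht := (h.weightDen_pos hβ2 hP hA ht.1).ne'
  initial n hn a ha := h.zero_eq hn ha
  boundary n hn t ht := h.boundary hn ht.1
  duhamel t ht n hn a ha := by
    rw [(h.solves T).duhamel_transport ht hn ha]
    congr 1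
    refine intervalIntegral.integral_congr fun s hs => ?_
    rw [uIcc_of_le ht.1] at hs
    simp only [transport, Pi.smul_apply, smul_eq_mul, coupling_eq, h.clipWeight_eq hβ2 hP hA hs.1]

lemma ClippedSolution.isAdmissible (h : ClippedSolution β M (cutoff β M g) g f)
    (hβ2 : β < 2) (hP : polyDefect g = 0) (hA : 0 < area g) {t : ℝ} (ht : 0 ≤ t) :
    IsAdmissible β (f t) where
  memY := h.memY t
  nonneg n hn a _ := h.curve.nonneg t n hn a
  area_pos := by rw [h.area_eq_area hβ2 hP hA ht]; exact hA
  polyhedral := h.polyDefect_eq_zero hβ2 hP hA ht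
  boundary n hn := h.boundary hn ht

/-- Exponential moments that decay geometrically in `n` control the quasi-complement. -/
lemma quasiCompl_le {u : State} {q A ρ : ℝ} (hq : 0 < q) (hA : 0 ≤ A) (hρ : 0 < ρ) (hρ1 : ρ < 1)
    (h : ∀ n, 2 ≤ n → expMoment q (u n) ≤ ENNReal.ofReal (A * psi ρ n)) :
    ∃ d D : ℝ, 0 < d ∧ ∀ α : ℝ, 0 ≤ α → quasiCompl u α ≤ D * Real.exp (-d * α) := by
  set y := √ρ with hy
  have hy0 : 0 < y := Real.sqrt_pos.2 hρ
  have hyy : y * y = ρ := Real.mul_self_sqrt hρ.le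
  have hy1 : y < 1 := by nlinarith
  have hs1 : Summable fun k : ℕ => A * ρ ^ (k + 2) :=
    ((summable_nat_add_iff 2).2 (summable_geometric_of_lt_one hρ.le hρ1)).mul_left A
  have hs2 : Summable fun k : ℕ => A * y ^ (k + 2) :=
    ((summable_nat_add_iff 2).2 (summable_geometric_of_lt_one hy0.le hy1)).mul_left A
  -- half of the exponent absorbs the factor `a` in the area, and a factor `√ρ ^ n` is kept for
  -- summability while the other one decays in `α ≤ n`
  set d := min (q / 2) (-Real.log y) with hd
  have hd0 : 0 < d := lt_min (by positivity) (by have := Real.log_neg hy0 hy1; linarith)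
  set S₁ := ∑' k : ℕ, A * ρ ^ (k + 2)
  set S₂ := ∑' k : ℕ, A * y ^ (k + 2)
  refine ⟨d, 2 / q * S₁ + S₂, hd0, fun α hα => ?_⟩
  have hψ : ∀ n, 2 ≤ n → psi ρ n ≤ ρ ^ n := fun n hn => by
    have : (1 : ℝ) ≤ n := by exact_mod_cast (by omega : 1 ≤ n)
    exact div_le_self (pow_nonneg hρ.le n) this
  have b1 : |∑' k : ℕ, ∫ a in Ioi α, a * u (k + 2) a| ≤ 2 / q * Real.exp (-d * α) * S₁ := by
    rw [← Real.norm_eq_abs]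
    refine tsum_of_norm_bounded (hs1.hasSum.mul_left _) fun k => ?_
    set n := k + 2
    have hn : 2 ≤ n := by omega
    have e : ∫ a in Ioi α, a * u n a = mom ((Ioi α).indicator fun a => a) (u n) := by
      unfold mom
      simp_rw [← indicator_mul_left]
      rw [setIntegral_indicator measurableSet_Ioi, Ioi_inter_Ioi, max_eq_right hα]
    have hχ : ∀ a, 0 ≤ a → |(Ioi α).indicator (fun a => a) a| ≤
        2 / q * Real.exp (-d * α) * Real.exp (q * a) := by
      intro a ha
      by_cases hm : a ∈ Ioi α
      · rw [indicator_of_mem hm, abs_of_nonneg ha]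
        have h1 : a ≤ 2 / q * Real.exp (q / 2 * a) := by
          have := Real.add_one_le_exp (q / 2 * a)
          calc a = 2 / q * (q / 2 * a) := by field_simp
            _ ≤ _ := by gcongr; linarith
        have h2 : d * α ≤ q / 2 * a :=
          mul_le_mul (min_le_left _ _) (le_of_lt hm) hα (by positivity)
        refine h1.trans ?_
        rw [mul_assoc, ← Real.exp_add]
        gcongr
        linarith
      · rw [indicator_of_notMem hm, abs_zero]; positivity
    rw [e, Real.norm_eq_abs]
    have h3 := psi_nonneg hρ.le n
    refine (abs_mom_le (by positivity) (mul_nonneg hA h3) hχ (h n hn)).trans ?_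
    have := hψ n hn
    gcongr
  have b2 : |∑' k : ℕ, if ⌊α⌋₊ + 1 ≤ k + 2 then
      ((k + 2 : ℕ) : ℝ) * ∫ a in Ioi (0 : ℝ), u (k + 2) a else 0| ≤
      Real.exp (-d * α) * S₂ := by
    rw [← Real.norm_eq_abs]
    refine tsum_of_norm_bounded (hs2.hasSum.mul_left _) fun k => ?_
    set n := k + 2
    have hn : 2 ≤ n := by omega
    split_ifs with hle
    · have h3 := psi_nonneg hρ.le n
      have h1 : |∫ a in Ioi (0 : ℝ), u n a| ≤ A * psi ρ n := by
        have := abs_mom_le (χ := fun _ => 1) (q := q) (C := 1) zero_le_one (mul_nonneg hA h3)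
          (fun a ha => by rw [abs_one, one_mul]; exact Real.one_le_exp (by positivity)) (h n hn)
        rwa [mom_one, one_mul] at this
      have h2 : α ≤ n := (Nat.lt_of_floor_lt (by omega : ⌊α⌋₊ < n)).le
      have h4 : y ^ n ≤ Real.exp (-d * α) := by
        rw [← Real.exp_log (pow_pos hy0 n), Real.log_pow]
        refine Real.exp_le_exp.2 ?_
        have := mul_le_mul h2 (min_le_right (q / 2) (-Real.log y)) hd0.le (Nat.cast_nonneg n)
        linarith
      rw [norm_mul, Real.norm_eq_abs, Real.norm_eq_abs, abs_of_nonneg (Nat.cast_nonneg n)]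
      calc (n : ℝ) * |∫ a in Ioi (0 : ℝ), u n a| ≤ n * (A * psi ρ n) := by gcongr
        _ = A * (n * psi ρ n) := by ring
        _ = y ^ n * (A * y ^ n) := by
          rw [mul_psi ρ (by omega), ← hyy, mul_pow]; ring
        _ ≤ _ := by gcongr
    · rw [norm_zero]; positivity
  unfold quasiCompl
  linarith [le_abs_self (∑' k : ℕ, ∫ a in Ioi α, a * u (k + 2) a), le_abs_self
    (∑' k : ℕ, if ⌊α⌋₊ + 1 ≤ k + 2 then
      ((k + 2 : ℕ) : ℝ) * ∫ a in Ioi (0 : ℝ), u (k + 2) a else 0)]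

lemma ClippedSolution.isRegular (h : ClippedSolution β M c₀ g f) {t : ℝ} (ht : 0 ≤ t) :
    IsRegular β (f t) where
  equicontinuous ε hε := by
    obtain ⟨δ₀, h0, h1⟩ := exists_modulus h.hβ h.hM h.hc h.data
      (fun ε δ => h.curve.equi t ε δ ht) hε
    refine ⟨δ₀, h0, fun δ hδ hδ' => (betaNorm_le_iff h.hβ hε.le).2 fun n hn a ha => ?_⟩
    exact h1 δ hδ hδ' t ⟨ht, le_rfl⟩ n hn a ha
  rapidlyDecreasing := by
    obtain ⟨q, A, ρ, hq, -, hA, -, hρ0, hρ1, hm⟩ := h.exists_moment t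
    exact quasiCompl_le hq hA hρ0 hρ1 (hm t le_rfl)

lemma productMoment_le_edgeMoment {q : ℝ} (hq : 0 < q) (hq1 : q ≤ 1) (u : State) :
    productMoment u ≤ ENNReal.ofReal (2 * q⁻¹) * edgeMoment q u := by
  unfold productMoment edgeMoment
  rw [← ENNReal.tsum_mul_left]
  refine ENNReal.tsum_le_tsum fun k => ?_
  have h1 : ∫⁻ a in Ioi (0 : ℝ), ENNReal.ofReal ((1 + a) * |u (k + 2) a|) ≤
      ENNReal.ofReal q⁻¹ * expMoment q (u (k + 2)) := by
    unfold expMoment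
    rw [← lintegral_const_mul' _ _ ENNReal.ofReal_ne_top]
    refine setLIntegral_mono' measurableSet_Ioi fun a ha => ?_
    rw [← mul_assoc, ← ENNReal.ofReal_mul (by positivity), ← ENNReal.ofReal_mul (by positivity)]
    exact ENNReal.ofReal_le_ofReal
      (mul_le_mul_of_nonneg_right (one_add_le_exp hq hq1) (abs_nonneg _))
  have h2 : ENNReal.ofReal (1 + ((k + 2 : ℕ) : ℝ)) ≤ ENNReal.ofReal (2 * ((k + 2 : ℕ) : ℝ)) := by
    refine ENNReal.ofReal_le_ofReal ?_
    push_cast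
    linarith [(Nat.cast_nonneg k : (0 : ℝ) ≤ k)]
  refine (mul_le_mul' h2 h1).trans (le_of_eq ?_)
  rw [← mul_assoc, ← mul_assoc, ← ENNReal.ofReal_mul (by positivity),
    ← ENNReal.ofReal_mul (by positivity)]
  congr 2; ring

lemma ClippedSolution.productMoment_lt_top (h : ClippedSolution β M c₀ g f) (t : ℝ) :
    productMoment (f t) < ⊤ := by
  obtain ⟨q, hq, hq1, hm⟩ := h.curve.edgeMoment_lt_top h.hβ h.hM h.hc h.data t
  exact (productMoment_le_edgeMoment hq hq1 _).trans_lt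
    (ENNReal.mul_lt_top ENNReal.ofReal_lt_top hm)

end

end GrainGrowth

theorem mainTheorem1 (β : ℝ) (hβ₀ : 0 < β) (hβ₂ : β < 2) (g : GrainGrowth.State)
    (hadm : GrainGrowth.IsAdmissible β g) (hreg : GrainGrowth.IsRegular β g) :
    ∃ f : ℝ → GrainGrowth.State,
      (∀ T : ℝ, 0 < T → GrainGrowth.IsMildSolution β T g f) ∧
      (∀ T : ℝ, 0 < T → ∀ h : ℝ → GrainGrowth.State, GrainGrowth.IsMildSolution β T g h →
        ∀ t ∈ Set.Icc 0 T, ∀ n : ℕ, 2 ≤ n → ∀ a : ℝ, 0 ≤ a → h t n a = f t n a) ∧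
      (∀ t : ℝ, 0 ≤ t → GrainGrowth.area (f t) = GrainGrowth.area g) ∧
      AntitoneOn (fun t => GrainGrowth.numGrains (f t)) (Set.Ici 0) ∧
      (∀ t : ℝ, 0 ≤ t →
        GrainGrowth.IsAdmissible β (f t) ∧
        GrainGrowth.IsRegular β (f t) ∧
        GrainGrowth.productMoment (f t) < ⊤ ∧
        GrainGrowth.betaNorm β (f t) ≤ GrainGrowth.betaNorm β g) := by
  have hdata := GrainGrowth.data_of_admissible hβ₀ hadm hreg
  set M := (GrainGrowth.betaNorm β g).toReal with hM
  have hM0 : 0 ≤ M := ENNReal.toReal_nonneg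
  have hP := hadm.polyhedral
  have hA := hadm.area_pos
  have hc := GrainGrowth.cutoff_pos hβ₀ hβ₂ hM0 hadm.nonneg hA
  obtain ⟨f, hcurve, hfix⟩ := GrainGrowth.exists_fixed_point hβ₀ hM0 hc hdata
  have h : GrainGrowth.ClippedSolution β M (GrainGrowth.cutoff β M g) g f :=
    ⟨hβ₀, hM0, hc, hdata, hcurve, hfix⟩
  refine ⟨f, fun T _ => h.isMildSolution hβ₂ hP hA T, fun T hT k hk t ht n hn a ha => ?_,
    fun t ht => h.area_eq_area hβ₂ hP hA ht, h.numGrains_antitoneOn, fun t ht =>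
    ⟨h.isAdmissible hβ₂ hP hA ht, h.isRegular ht, h.productMoment_lt_top t, ?_⟩⟩
  · exact h.eq_of_isMildSolution hT.le (fun s hs => h.cutoff_le_weightDen hβ₂ hP hA hs) hk ht hn ha
  · have := h.betaNorm_le t
    rwa [hM, ENNReal.ofReal_toReal hadm.memY.betaNorm_lt_top.ne] at this
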